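/- Let $\varepsilon_i,\varepsilon_o,\kappa,R>0$, and put $\varepsilon=\varepsilon_i/\varepsilon_o$, $u=\kappa R$. For a complex order $\nu$ and $u>0$ let $$K_\nu(u)=\tfrac12\Big(\frac u2\Big)^{\nu}\int_0^\infty e^{-z-u^2/(4z)}\,\frac{dz}{z^{\nu+1}},\qquad k_s(u)=\sqrt{\frac{\pi}{2u}}\,K_{s+1/2}(u),$$ and define the harmonic coefficients, for complex $s$ with $\operatorname{Re}s\ge 0$, $$M_s(u)=\frac{\varepsilon(s+1)k_s(u)+u k_s'(u)}{\varepsilon s\,k_s(u)-u k_s'(u)},$$ where $k_s'$ is the derivative in $u$. Consider generalized functions $f(t)=c\,\delta(t-1)+g(t)$ on $(0,1]$, with $c\in\mathbb R$ and $g$ a real function. We say that $\{f,M_s(u)\}$ is a finite Mellin transform pair if both of the following hold. * For all $s$ with $\operatorname{Re}s\ge0$, $M_s(u)=\int_0^1 f(t)\,t^{s-1}\,dt:=c+\int_0^1 g(t)\,t^{s-1}\,dt$, the last integral being absolutely convergent. * $f$ is the inverse transform $f(t)=\frac1{2\pi i}\int_{\sigma-i\infty}^{\sigma+i\infty}M_s(u)\,t^{-s}\,ds$,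 that is: for every $\sigma>0$, $M_{\sigma+i\tau}(u)\to c$ as $|\tau|\to\infty$, and for every $t\in(0,1)$, $g(t)=\lim_{T\to\infty}\frac1{2\pi}\int_{-T}^{T}\big(M_{\sigma+i\tau}(u)-c\big)\,t^{-\sigma-i\tau}\,d\tau$. For $\mathbf r_s\in\mathbb R^3$ with $0<r_s=|\mathbf r_s|<R$ consider the Green's function problem $$-\varepsilon_i\Delta G_i=\delta(\mathbf r-\mathbf r_s)\ \ (|\mathbf r|<R),\qquad -\Delta G_o+\kappa^2G_o=0\ \ (|\mathbf r|>R),\qquad G_o\to0\ \ (|\mathbf r|\to\infty),$$ $$G_i=G_o,\qquad \varepsilon_i\partial_rG_i=\varepsilon_o\partial_rG_o\qquad\text{on }|\mathbf r|=R .$$ A solution means: $G_i(\mathbf r)=\frac{1}{4\pi\varepsilon_i|\mathbf r-\mathbf r_s|}+\Phi_{\rm rf}(\mathbf r)$ for $|\mathbf r|\le R$, $\mathbf r\neq\mathbf r_s$, with the reaction potential $\Phi_{\rm rf}$ harmonic in the open ball and continuous on the closed ball; $G_o$ is $C^2$ for $|\mathbf r|>R$ and continuous for $|\mathbf r|\ge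 R$; and the one-sided radial derivatives exist on the sphere. **Theorem.** (i) There is a generalized function $f$ of the above form such that $\{f,M_s(u)\}$ is a finite Mellin transform pair. (ii) For every $\mathbf r_s$ with $0<r_s<R$ the Green's function problem has a solution. (iii) Let $\mathbf r_K=(R/r_s)^2\mathbf r_s$ be the Kelvin point and $r_K=|\mathbf r_K|=R^2/r_s$. For every solution of the problem and every $\mathbf r$ with $r=|\mathbf r|\le R$, the Kirkwood series $$\Phi_{\rm rf}(\mathbf r)=\frac{R/r_s}{4\pi\varepsilon_i}\sum_{n=0}^\infty\frac{r^n}{r_K^{n+1}}M_n(u)P_n(\cos\theta)$$ holds with absolute convergence, where $\theta$ is the angle between $\mathbf r_s$ and $\mathbf r$ and $P_n$ is the Legendre polynomial. Moreover, for every $f=c\,\delta(t-1)+g$ such that $\{f,M_s(u)\}$ is a finite Mellin transform pair, $$\Phi_{\rm rf}(\mathbf r)=\frac1{4\pi\varepsilon_i}\int_{r_K}^\infty\frac{\rho(x)}{|\mathbf r-\mathbf x|}\,dx,\qquad \rho(x)=\frac{f(r_K/x)}{R},\qquad \mathbf x=\frac{x}{r_s}\mathbf r_s .$$ Since $\delta(r_K/x-1)=r_K\,\delta(x-r_K)$,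 this means $$\Phi_{\rm rf}(\mathbf r)=\frac1{4\pi\varepsilon_i}\Big(\frac{c\,r_K/R}{|\mathbf r-\mathbf r_K|}+\int_{r_K}^\infty\frac{g(r_K/x)/R}{|\mathbf r-\mathbf x|}\,dx\Big),$$ with an absolutely convergent integral. -/

import Mathlib

open Filter Topology MeasureTheory InnerProductSpace
open scoped Laplacian

noncomputable section

namespace ImageCharge

/-- Physical space `ℝ³` with its Euclidean norm. -/
abbrev Space : Type := EuclideanSpace ℝ (Fin 3)

/-! ### Special functions -/

/-- The modified Bessel function of the second kind of complex order `ν` at a real argument `u > 0`: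
`K_ν(u) = (1/2) (u/2)^ν ∫_0^∞ exp (-z - u²/(4z)) z^(-ν-1) dz`. -/
def besselK (ν : ℂ) (u : ℝ) : ℂ :=
  (1 / 2) * ((u / 2 : ℝ) : ℂ) ^ ν *
    ∫ z in Set.Ioi (0 : ℝ), (Real.exp (-z - u ^ 2 / (4 * z)) : ℂ) * (z : ℂ) ^ (-ν - 1)

/-- The modified spherical Hankel function, continued to complex order `s`:
`k_s(u) = √(π/(2u)) K_{s+1/2}(u)`. -/
def sphericalK (s : ℂ) (u : ℝ) : ℂ :=
  (Real.sqrt (Real.pi / (2 * u)) : ℂ) * besselK (s + 1 / 2) u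

/-- The harmonic coefficient
`M_s(u) = (ε (s+1) k_s(u) + u k_s'(u)) / (ε s k_s(u) - u k_s'(u))`,
where the prime is the derivative in `u`. -/
def harmonicCoeff (ε u : ℝ) (s : ℂ) : ℂ :=
  ((ε : ℂ) * (s + 1) * sphericalK s u + (u : ℂ) * deriv (fun x : ℝ => sphericalK s x) u) /
    ((ε : ℂ) * s * sphericalK s u - (u : ℂ) * deriv (fun x : ℝ => sphericalK s x) u)

/-- The Legendre polynomial `P_n`, by Rodrigues' formula. -/
def legendreP (n : ℕ) : Polynomial ℝ :=
  Polynomial.C (1 / (2 ^ n * (n.factorial : ℝ))) *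
    Polynomial.derivative^[n] ((Polynomial.X ^ 2 - 1) ^ n)

/-! ### Finite Mellin transform pairs -/

/-- A generalized function `f(t) = atom · δ(t - 1) + density t` on the interval `(0, 1]`
(the unit point mass at the right end point is counted in full by integrals over `(0, 1]`). -/
structure GenFun where
  /-- the weight of `δ(t - 1)` -/
  atom : ℝ
  /-- the ordinary function part; only its values on `(0, 1)` matter -/
  density : ℝ → ℝ

/-- `F` is the finite Mellin transform of `f` on the closed half plane `0 ≤ Re s`:
`F(s) = ∫_0^1 f(t) t^(s-1) dt`, the integral of the function part being absolutely convergent. -/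
def IsFiniteMellinTransform (f : GenFun) (F : ℂ → ℂ) : Prop :=
  ∀ s : ℂ, 0 ≤ s.re →
    IntegrableOn (fun t : ℝ => (f.density t : ℂ) * (t : ℂ) ^ (s - 1)) (Set.Ioc 0 1) ∧
    F s = (f.atom : ℂ) + ∫ t in Set.Ioc (0 : ℝ) 1, (f.density t : ℂ) * (t : ℂ) ^ (s - 1)

/-- `f` is the inverse finite Mellin transform of `F`:
`f(t) = (1/(2πi)) ∫_{σ-i∞}^{σ+i∞} F(s) t^(-s) ds` on every vertical line `Re s = σ > 0`.
The limit of `F` at the two ends of the line is the weight of `δ(t - 1)`, which is the inverse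
transform of the constant `1`. For `0 < t < 1` the remainder of `F` has the inverse transform
`f.density t`, as the limit of the integrals over the symmetric segments `|Im s| ≤ T`. -/
def IsInverseMellinTransform (f : GenFun) (F : ℂ → ℂ) : Prop :=
  ∀ σ : ℝ, 0 < σ →
    Tendsto (fun τ : ℝ => F (σ + τ * Complex.I)) (cocompact ℝ) (𝓝 (f.atom : ℂ)) ∧
    ∀ t : ℝ, 0 < t → t < 1 →
      Tendsto
        (fun T : ℝ => (1 / (2 * Real.pi) : ℂ) *
          ∫ τ in (-T)..T,
            (F (σ + τ * Complex.I) - f.atom) * (t : ℂ) ^ (-((σ : ℂ) + τ * Complex.I)))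
        atTop (𝓝 (f.density t : ℂ))

/-- `{f, F}` is a finite Mellin transform pair. -/
def IsFiniteMellinPair (f : GenFun) (F : ℂ → ℂ) : Prop :=
  IsFiniteMellinTransform f F ∧ IsInverseMellinTransform f F

/-! ### The Green's function problem -/

/-- The Coulomb potential at `r` of a unit point charge at `rs` in a medium of permittivity `εi`. -/
def coulomb (εi : ℝ) (rs r : Space) : ℝ :=
  1 / (4 * Real.pi * εi * ‖r - rs‖)

/-- `Gi`, `Go` solve the Green's function problem for a unit charge at `rs` in the ball of radius
`R` and permittivity `εi`, in a linearized Poisson-Boltzmann medium of permittivity `εo` and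
inverse Debye length `κ`, and `Φ` is the reaction potential. -/
structure IsGreenSolution (εi εo κ R : ℝ) (rs : Space) (Gi Go Φ : Space → ℝ) : Prop where
  /-- Inside the ball `Gi` is the Coulomb potential of the source plus the reaction potential. -/
  inner_eq : ∀ r ∈ Metric.closedBall (0 : Space) R, r ≠ rs → Gi r = coulomb εi rs r + Φ r
  /-- The reaction potential is harmonic in the ball, also at `rs`; with `inner_eq` this is the
  equation `-εi Δ Gi = δ(r - rs)`. -/
  inner_harmonic : HarmonicOnNhd Φ (Metric.ball (0 : Space) R)
  inner_continuous : ContinuousOn Φ (Metric.closedBall (0 : Space) R)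
  /-- `-Δ Go + κ² Go = 0` outside the ball. -/
  outer_contDiff : ContDiffOn ℝ 2 Go {r : Space | R < ‖r‖}
  outer_eq : ∀ r : Space, R < ‖r‖ → -(Δ Go) r + κ ^ 2 * Go r = 0
  outer_continuous : ContinuousOn Go {r : Space | R ≤ ‖r‖}
  /-- `Go` vanishes at infinity. -/
  outer_decay : Tendsto Go (Bornology.cobounded Space) (𝓝 0)
  /-- The potential is continuous across the sphere. -/
  interface_eq : ∀ r ∈ Metric.sphere (0 : Space) R, Gi r = Go r
  /-- `εi ∂_r Gi = εo ∂_r Go` on the sphere, with one-sided radial derivatives. -/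
  interface_flux : ∀ ν : Space, ‖ν‖ = 1 → ∃ a b : ℝ,
    HasDerivWithinAt (fun t : ℝ => Gi (t • ν)) a (Set.Iic R) R ∧
    HasDerivWithinAt (fun t : ℝ => Go (t • ν)) b (Set.Ici R) R ∧
    εi * a = εo * b

/-! ### The Kirkwood series and the image charges -/

/-- The Kelvin point `r_K = (R / r_s)² r_s`. -/
def kelvinPoint (R : ℝ) (rs : Space) : Space := (R / ‖rs‖) ^ 2 • rs

/-- The `n`-th term of the Kirkwood series at `r`. -/
def kirkwoodTerm (εi εo κ R : ℝ) (rs r : Space) (n : ℕ) : ℂ :=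
  ((R / ‖rs‖ / (4 * Real.pi * εi) * (‖r‖ ^ n / ‖kelvinPoint R rs‖ ^ (n + 1)) : ℝ) : ℂ) *
    harmonicCoeff (εi / εo) (κ * R) (n : ℂ) *
    (((legendreP n).eval (Real.cos (InnerProductGeometry.angle rs r)) : ℝ) : ℂ)

/-- The function part `f(r_K/x)/R` of the line charge density `ρ`, divided by the distance from `r`
to the point `(x/r_s) r_s` of the line. -/
def lineIntegrand (R : ℝ) (f : GenFun) (rs r : Space) (x : ℝ) : ℝ :=
  (f.density (‖kelvinPoint R rs‖ / x) / R) / ‖r - (x / ‖rs‖) • rs‖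

/-- `(1/(4π εi)) ∫_{r_K}^∞ ρ(x) / |r - (x/r_s) r_s| dx` with `ρ(x) = f(r_K/x)/R`. As
`δ(r_K/x - 1) = r_K δ(x - r_K)`, the atom of `f` is a point charge `atom · r_K / R` at `r_K`. -/
def linePotential (εi R : ℝ) (f : GenFun) (rs r : Space) : ℝ :=
  1 / (4 * Real.pi * εi) *
    ((f.atom * ‖kelvinPoint R rs‖ / R) / ‖r - kelvinPoint R rs‖ +
      ∫ x in Set.Ioi ‖kelvinPoint R rs‖, lineIntegrand R f rs r x)

end ImageCharge

end

/-! Put `ν = s + 1/2` and `q(s) = u K_{ν-1}(u) / K_ν(u)` (`besselRatio`). The logarithmic derivative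
of `k_s` at `u` is `-(s + 1 + q)/u`, so the harmonic coefficient equals `((ε-1)(s+1) - q) / ((ε+1)s
+ 1 + q)`. With `q` replaced by `0` it would be a constant plus a simple pole, whose inverse Mellin
transforms are a point mass at `1` and a power of `t`. Everything else is in the remainder `-ε q
(2s+1) / (((ε+1)s+1+q)((ε+1)s+1))` (`coeffRemainder`). With `t = exp(-y)` the Mellin transform
becomes a Laplace transform, and the task is to show that the remainder is the Laplace transform of
an integrable function up to and including the line `Re s = 0`.

The analytic facts about `q` come from quantities built from `K_ν`, `K_{ν-1}` that are monotone in
the argument and vanish at infinity. One of them gives `|K_{ν-1}| ≤ |K_ν|` for `Re ν ≥ 1/2`, hence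
`|q| ≤ u`. Another, `besselTail`, is positive for nonreal `ν` with `Re ν > 0`; it gives `K_ν ≠ 0`
and `Im q / Im ν > -1`, so that the denominator has no zero in `Re s ≥ 0`. The remainder is
therefore `O(1/|s|)` on `Re s ≥ 0`, and the recurrence in the order improves this to `O(1/|s|²)` on
`Re s ≥ 1`.

On `Re s = 0` one has `|q| = u` exactly, so the remainder is not integrable along that line and
absolute convergence at `Re s = 0` is delicate. The remedy is an estimate of the derivative: on `Re
ν = 1/2` one has `q' = O(|τ|^(1/3))`, so the remainder has derivative `O(|τ|^(-2/3))`, which is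
square integrable. Let `h` be the inverse transform. By Plancherel `y h(y)` is in `L²`; as `h` is
continuous and vanishes for `y ≤ 0`, it follows that `h` is in `L¹`. Fourier inversion on `Re s =
1`, the identity theorem and continuity then recover the remainder on the whole closed half plane.

For the boundary value problem, Laplace's formula writes `|r|^n P_n` as an average of `n`-th powers
of complex linear forms on null vectors, which gives harmonicity and derivative bounds at once. The
Kirkwood series inside and a series of screened multipoles outside both converge past the sphere and
match there term by term, which is existence. Uniqueness is a maximum principle: a positive maximum
on the sphere would have a nonnegative inner radial derivative, while comparison with a decaying
radial solution makes the outer one negative. Finally `M_n = c + ∫ g(t) t^(n-1) dt` is inserted in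
the Kirkwood series; the generating function of the Legendre polynomials sums it, and `x = r_K / t`
turns the result into a point charge and a line charge. -/

namespace ImageCharge

/-! ### The integrals `∫ t ^ k exp (ν t - x cosh t) dt` -/

/-- `∫ t ^ k exp (ν t - x cosh t) dt`, the `k`-th derivative in `ν` of `2 K_ν(x)`. -/
noncomputable def besselInt (k : ℕ) (ν : ℂ) (x : ℝ) : ℂ :=
  ∫ t : ℝ, (t : ℂ) ^ k * Complex.exp (ν * t - x * Real.cosh t)

theorem one_add_sq_div_two_le_cosh (t : ℝ) : 1 + t ^ 2 / 2 ≤ Real.cosh t := by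
  have h1 : |t| / 2 ≤ Real.sinh (|t| / 2) := Real.self_le_sinh_iff.2 (by positivity)
  have h2 : Real.cosh t = 1 + 2 * Real.sinh (|t| / 2) ^ 2 := by
    rw [← Real.cosh_abs, show |t| = 2 * (|t| / 2) by ring, Real.cosh_two_mul, Real.cosh_sq]
    ring_nf
  have h3 : (|t| / 2) ^ 2 ≤ Real.sinh (|t| / 2) ^ 2 := by gcongr
  rw [div_pow, sq_abs] at h3
  linarith

/-- The power is absorbed in `k! exp |t|`. Since `cosh t ≥ 1 + t²/2`, half of the Gaussian exponent
`x t²/2` pays for the linear term `(c + 1)|t|` by completing the square, and the other half remains.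
-/
theorem pow_mul_exp_le {k : ℕ} {c x : ℝ} (hx : 0 < x) (t : ℝ) :
    |t| ^ k * Real.exp (c * |t| - x * Real.cosh t) ≤
      (k.factorial * Real.exp ((c + 1) ^ 2 / x)) * Real.exp (-(x / 4) * t ^ 2) := by
  have h1 : |t| ^ k ≤ k.factorial * Real.exp |t| := by
    have := Real.pow_div_factorial_le_exp |t| (abs_nonneg t) k
    rwa [div_le_iff₀ (by positivity), mul_comm] at this
  have h2 := one_add_sq_div_two_le_cosh t
  calc |t| ^ k * Real.exp (c * |t| - x * Real.cosh t)
      ≤ (k.factorial * Real.exp |t|) * Real.exp (c * |t| - x * Real.cosh t) := by gcongr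
    _ = k.factorial * Real.exp (|t| + (c * |t| - x * Real.cosh t)) := by
        rw [mul_assoc, ← Real.exp_add]
    _ ≤ k.factorial * Real.exp ((c + 1) ^ 2 / x + -(x / 4) * t ^ 2) := by
        refine mul_le_mul_of_nonneg_left (Real.exp_le_exp.2 ?_) (by positivity)
        have h3 : 0 ≤ ((c + 1) / x - |t| / 2) ^ 2 * x := by positivity
        have h4 : ((c + 1) / x - |t| / 2) ^ 2 * x
            = (c + 1) ^ 2 / x - (c + 1) * |t| + x / 4 * t ^ 2 := by
          rw [← sq_abs t]; field_simp; ring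
        have h5 : x * (1 + t ^ 2 / 2) ≤ x * Real.cosh t := by gcongr
        linarith
    _ = _ := by rw [Real.exp_add, mul_assoc]

theorem norm_besselInt_integrand (k : ℕ) (ν : ℂ) (x t : ℝ) :
    ‖(t : ℂ) ^ k * Complex.exp (ν * t - x * Real.cosh t)‖ =
      |t| ^ k * Real.exp (ν.re * t - x * Real.cosh t) := by
  rw [norm_mul, norm_pow, Complex.norm_real, Real.norm_eq_abs, Complex.norm_exp]
  congr 2
  simp

theorem norm_besselInt_integrand_le {k : ℕ} {ν : ℂ} {c x : ℝ} (hc : |ν.re| ≤ c) (t : ℝ) :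
    ‖(t : ℂ) ^ k * Complex.exp (ν * t - x * Real.cosh t)‖ ≤
      |t| ^ k * Real.exp (c * |t| - x * Real.cosh t) := by
  rw [norm_besselInt_integrand]
  refine mul_le_mul_of_nonneg_left (Real.exp_le_exp.2 (sub_le_sub_right ?_ _)) (by positivity)
  calc ν.re * t ≤ |ν.re * t| := le_abs_self _
    _ = |ν.re| * |t| := abs_mul _ _
    _ ≤ c * |t| := by gcongr

theorem integrable_besselInt_majorant (k : ℕ) (c : ℝ) {x : ℝ} (hx : 0 < x) :
    Integrable fun t : ℝ => |t| ^ k * Real.exp (c * |t| - x * Real.cosh t) := by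
  refine ((integrable_exp_neg_mul_sq (show 0 < x / 4 by positivity)).const_mul
    (k.factorial * Real.exp ((c + 1) ^ 2 / x))).mono' ?_ ?_
  · exact (by fun_prop : Continuous fun t : ℝ =>
      |t| ^ k * Real.exp (c * |t| - x * Real.cosh t)).aestronglyMeasurable
  · refine ae_of_all _ fun t => ?_
    rw [Real.norm_of_nonneg (by positivity)]
    exact pow_mul_exp_le hx t

theorem integrable_besselInt (k : ℕ) (ν : ℂ) {x : ℝ} (hx : 0 < x) :
    Integrable fun t : ℝ => (t : ℂ) ^ k * Complex.exp (ν * t - x * Real.cosh t) :=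
  (integrable_besselInt_majorant k |ν.re| hx).mono'
    (by fun_prop : Continuous fun t : ℝ => (t : ℂ) ^ k *
      Complex.exp (ν * t - x * Real.cosh t)).aestronglyMeasurable
    (ae_of_all _ fun t => norm_besselInt_integrand_le le_rfl t)

theorem hasDerivAt_besselInt_order (k : ℕ) (ν : ℂ) {x : ℝ} (hx : 0 < x) :
    HasDerivAt (fun ν => besselInt k ν x) (besselInt (k + 1) ν x) ν := by
  refine (hasDerivAt_integral_of_dominated_loc_of_deriv_le
    (F := fun (ν : ℂ) (t : ℝ) => (t : ℂ) ^ k * Complex.exp (ν * t - x * Real.cosh t))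
    (F' := fun (ν : ℂ) (t : ℝ) => (t : ℂ) ^ (k + 1) * Complex.exp (ν * t - x * Real.cosh t))
    (bound := fun t => |t| ^ (k + 1) * Real.exp ((|ν.re| + 1) * |t| - x * Real.cosh t))
    (Metric.ball_mem_nhds ν one_pos) ?_ (integrable_besselInt k ν hx) ?_ ?_
    (integrable_besselInt_majorant _ _ hx) ?_).2
  · refine Eventually.of_forall fun ν => (integrable_besselInt k ν hx).aestronglyMeasurable
  · exact (integrable_besselInt (k + 1) ν hx).aestronglyMeasurable
  · refine ae_of_all _ fun t μ hμ => norm_besselInt_integrand_le ?_ t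
    have h1 : |(μ - ν).re| ≤ 1 :=
      (Complex.abs_re_le_norm _).trans (by rw [← dist_eq_norm]; exact (Metric.mem_ball.1 hμ).le)
    have h2 := abs_add_le ν.re (μ - ν).re
    simp only [Complex.sub_re, add_sub_cancel] at h1 h2
    linarith
  · refine ae_of_all _ fun t μ _ => ?_
    have h : HasDerivAt (fun μ : ℂ => μ * t - x * Real.cosh t) (t : ℂ) μ := by
      simpa using ((hasDerivAt_id μ).mul_const (t : ℂ)).sub_const ((x : ℂ) * Real.cosh t)
    convert! (h.cexp.const_mul ((t : ℂ) ^ k)) using 1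
    ring

theorem besselInt_add_one_add_sub_one (k : ℕ) (ν : ℂ) {x : ℝ} (hx : 0 < x) :
    besselInt k (ν + 1) x + besselInt k (ν - 1) x =
      ∫ t : ℝ, 2 * Real.cosh t * ((t : ℂ) ^ k * Complex.exp (ν * t - x * Real.cosh t)) := by
  rw [besselInt, besselInt, ← integral_add (integrable_besselInt k _ hx)
    (integrable_besselInt k _ hx)]
  congr 1; ext t
  have h1 : (ν + 1) * t - x * Real.cosh t = (ν * t - x * Real.cosh t) + t := by ring
  have h2 : (ν - 1) * t - x * Real.cosh t = (ν * t - x * Real.cosh t) + (-t) := by ring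
  rw [h1, h2, Complex.exp_add, Complex.exp_add, Complex.ofReal_cosh, Complex.cosh]
  ring

theorem hasDerivAt_besselInt_arg (k : ℕ) (ν : ℂ) {x : ℝ} (hx : 0 < x) :
    HasDerivAt (fun x : ℝ => besselInt k ν x)
      (-(besselInt k (ν + 1) x + besselInt k (ν - 1) x) / 2) x := by
  have key := (hasDerivAt_integral_of_dominated_loc_of_deriv_le (x₀ := x)
    (F := fun (x : ℝ) (t : ℝ) => (t : ℂ) ^ k * Complex.exp (ν * t - x * Real.cosh t))
    (F' := fun (x : ℝ) (t : ℝ) => -Real.cosh t *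
      ((t : ℂ) ^ k * Complex.exp (ν * t - x * Real.cosh t)))
    -- On the neighbourhood `y > x/2` the exponent keeps `(x/2) cosh t`; the factor `cosh t ≤ exp
    -- |t|` from the derivative raises the growth rate by one.
    (bound := fun t => |t| ^ k * Real.exp ((|ν.re| + 1) * |t| - (x / 2) * Real.cosh t))
    (Ioi_mem_nhds (show x / 2 < x by linarith)) ?_ (integrable_besselInt k ν hx) ?_ ?_
    (integrable_besselInt_majorant _ _ (by positivity)) ?_).2
  · convert! key using 1
    rw [besselInt_add_one_add_sub_one k ν hx, ← integral_neg, ← integral_div]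
    congr 1; ext t; ring
  · filter_upwards [Ioi_mem_nhds hx] with y hy using
      (integrable_besselInt k ν hy).aestronglyMeasurable
  · exact (by fun_prop : Continuous fun t : ℝ => -(Real.cosh t : ℂ) *
      ((t : ℂ) ^ k * Complex.exp (ν * t - x * Real.cosh t))).aestronglyMeasurable
  · refine ae_of_all _ fun t y hy => ?_
    have hy' : x / 2 < y := hy
    rw [norm_mul, norm_neg, Complex.norm_real, Real.norm_of_nonneg (Real.cosh_pos t).le]
    have h1 : Real.cosh t ≤ Real.exp |t| := by
      rw [← Real.cosh_abs, Real.cosh_eq]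
      have := Real.exp_le_exp.2 (show -|t| ≤ |t| by linarith [abs_nonneg t])
      linarith
    calc Real.cosh t * ‖(t : ℂ) ^ k * Complex.exp (ν * t - y * Real.cosh t)‖
        ≤ Real.exp |t| * (|t| ^ k * Real.exp (|ν.re| * |t| - y * Real.cosh t)) := by
          gcongr; exact norm_besselInt_integrand_le le_rfl t
      _ = |t| ^ k * Real.exp (|t| + (|ν.re| * |t| - y * Real.cosh t)) := by
          rw [Real.exp_add]; ring
      _ ≤ _ := by
          gcongr
          nlinarith [Real.cosh_pos t]
  · refine ae_of_all _ fun t y _ => ?_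
    have h : HasDerivAt (fun y : ℝ => ν * t - (y : ℂ) * Real.cosh t) (-(Real.cosh t : ℂ)) y := by
      simpa using (((Complex.ofRealCLM.hasDerivAt (x := y)).mul_const
        (Real.cosh t : ℂ)).const_sub (ν * t))
    convert! (h.cexp.const_mul ((t : ℂ) ^ k)) using 1
    ring

/-- The integral over the line of the derivative in `t` of `exp (ν t - x cosh t)` vanishes, and
`sinh t` shifts the order by `±1`. -/
theorem besselInt_zero_recurrence (ν : ℂ) {x : ℝ} (hx : 0 < x) :
    x * (besselInt 0 (ν + 1) x - besselInt 0 (ν - 1) x) = 2 * ν * besselInt 0 ν x := by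
  have hd : ∀ t : ℝ, HasDerivAt (fun t : ℝ => Complex.exp (ν * t - x * Real.cosh t))
      (ν * Complex.exp (ν * t - x * Real.cosh t) -
        x / 2 * (Complex.exp ((ν + 1) * t - x * Real.cosh t) -
          Complex.exp ((ν - 1) * t - x * Real.cosh t))) t := by
    intro t
    have h1 : HasDerivAt (fun t : ℝ => ν * (t : ℂ) - x * (Real.cosh t : ℂ))
        (ν - x * Real.sinh t) t := by
      have h2 := (Real.hasDerivAt_cosh t).ofReal_comp
      have h3 := (Complex.ofRealCLM.hasDerivAt (x := t)).const_mul ν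
      simpa using! h3.sub (h2.const_mul (x : ℂ))
    convert! h1.cexp using 1
    have h1 : (ν + 1) * t - x * Real.cosh t = (ν * t - x * Real.cosh t) + t := by ring
    have h2 : (ν - 1) * t - x * Real.cosh t = (ν * t - x * Real.cosh t) + (-t) := by ring
    rw [h1, h2, Complex.exp_add, Complex.exp_add, Complex.ofReal_sinh, Complex.sinh]
    ring
  have i0 := integrable_besselInt 0 ν hx
  have i1 := integrable_besselInt 0 (ν + 1) hx
  have i2 := integrable_besselInt 0 (ν - 1) hx
  simp only [pow_zero, one_mul] at i0 i1 i2
  have key := integral_eq_zero_of_hasDerivAt_of_integrable hd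
    ((i0.const_mul ν).sub ((i1.sub i2).const_mul (x / 2 : ℂ))) i0
  have key2 : ∫ t : ℝ, x / 2 * (Complex.exp ((ν + 1) * t - x * Real.cosh t) -
      Complex.exp ((ν - 1) * t - x * Real.cosh t)) = _ :=
    (integral_const_mul _ _).trans (by rw [integral_sub i1 i2])
  have key3 := integral_sub (i0.const_mul ν) ((i1.sub i2).const_mul (x / 2 : ℂ))
  have key4 := key3.symm.trans key
  rw [integral_const_mul] at key4
  replace key := (congrArg (fun z => ν * _ - z) key2).symm.trans key4
  simp only [besselInt, pow_zero, one_mul]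
  linear_combination (-2) * key

/-- Derivative of the preceding recurrence with respect to the order. -/
theorem besselInt_one_recurrence (ν : ℂ) {x : ℝ} (hx : 0 < x) :
    x * (besselInt 1 (ν + 1) x - besselInt 1 (ν - 1) x) =
      2 * besselInt 0 ν x + 2 * ν * besselInt 1 ν x := by
  have h1 := ((hasDerivAt_besselInt_order 0 (ν + 1) hx).comp_add_const ν 1).sub
    ((hasDerivAt_besselInt_order 0 (ν - 1) hx).comp_sub_const ν 1)
  have h2 := ((hasDerivAt_id ν).const_mul 2).mul (hasDerivAt_besselInt_order 0 ν hx)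
  have h3 := (h1.const_mul (x : ℂ))
  have : (fun ν : ℂ => (x : ℂ) * (besselInt 0 (ν + 1) x - besselInt 0 (ν - 1) x)) =
      fun ν => 2 * ν * besselInt 0 ν x := by
    ext ν; exact besselInt_zero_recurrence ν hx
  have h4 := h3.unique (by convert! h2 using 1)
  simpa using h4

theorem besselInt_zero_neg (ν : ℂ) (x : ℝ) : besselInt 0 (-ν) x = besselInt 0 ν x := by
  rw [besselInt, besselInt, ← integral_neg_eq_self]
  simp

theorem conj_besselInt (k : ℕ) (ν : ℂ) (x : ℝ) :
    (starRingEnd ℂ) (besselInt k ν x) = besselInt k ((starRingEnd ℂ) ν) x := by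
  rw [besselInt, besselInt, ← integral_conj]
  congr 1; ext t
  simp only [map_mul, map_pow, Complex.conj_ofReal, ← Complex.exp_conj, map_sub]

/-- As `cosh t ≥ 1`, the factor `exp (-(x - x₀) cosh t)` is at most `exp (-(x - x₀))`. This
exponential decay supplies all the limits at infinity used below. -/
theorem norm_besselInt_le {k : ℕ} {ν : ℂ} {c x₀ x : ℝ} (hc : |ν.re| ≤ c) (hx₀ : 0 < x₀)
    (hx : x₀ ≤ x) : ‖besselInt k ν x‖ ≤ Real.exp (-(x - x₀)) *
      ∫ t : ℝ, |t| ^ k * Real.exp (c * |t| - x₀ * Real.cosh t) := by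
  rw [← integral_const_mul]
  refine norm_integral_le_of_norm_le
    ((integrable_besselInt_majorant k c hx₀).const_mul _) (ae_of_all _ fun t => ?_)
  refine (norm_besselInt_integrand_le hc t).trans ?_
  rw [mul_left_comm, ← Real.exp_add]
  gcongr
  nlinarith [Real.one_le_cosh t]

/-- Substitution `z = (u/2) exp (-t)`, which makes the exponent `-u cosh t`. -/
theorem besselK_eq_besselInt (ν : ℂ) {u : ℝ} (hu : 0 < u) :
    besselK ν u = besselInt 0 ν u / 2 := by
  have hderiv : ∀ t ∈ Set.univ, HasDerivWithinAt (fun t : ℝ => u / 2 * Real.exp (-t))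
      (-(u / 2 * Real.exp (-t))) Set.univ t := by
    intro t _
    have := ((hasDerivAt_neg t).exp).const_mul (u / 2)
    exact (this.congr_deriv (by ring)).hasDerivWithinAt
  have hinj : Set.InjOn (fun t : ℝ => u / 2 * Real.exp (-t)) Set.univ := by
    intro a _ b _ h
    have h1 := mul_left_cancel₀ (by positivity) h
    exact neg_injective (Real.exp_injective h1)
  have himg : (fun t : ℝ => u / 2 * Real.exp (-t)) '' Set.univ = Set.Ioi 0 := by
    ext z
    simp only [Set.image_univ, Set.mem_range, Set.mem_Ioi]
    constructor
    · rintro ⟨t, rfl⟩; positivity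
    · intro hz
      refine ⟨-Real.log (2 * z / u), ?_⟩
      rw [neg_neg, Real.exp_log (by positivity)]
      field_simp
  have key := integral_image_eq_integral_abs_deriv_smul MeasurableSet.univ hderiv hinj
    (fun z : ℝ => (Real.exp (-z - u ^ 2 / (4 * z)) : ℂ) * (z : ℂ) ^ (-ν - 1))
  rw [himg, Measure.restrict_univ] at key
  rw [besselK, key, besselInt, mul_assoc, ← integral_const_mul, mul_comm (1 / 2 : ℂ),
    ← div_eq_mul_one_div]
  congr 2; ext t
  have hpos : 0 < u / 2 * Real.exp (-t) := by positivity
  rw [abs_neg, abs_of_pos hpos, pow_zero, one_mul, Complex.real_smul]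
  have e1 : -(u / 2 * Real.exp (-t)) - u ^ 2 / (4 * (u / 2 * Real.exp (-t))) =
      -(u * Real.cosh t) := by
    rw [Real.cosh_eq, Real.exp_neg]
    field_simp
    ring
  have hne : ((u / 2 * Real.exp (-t) : ℝ) : ℂ) ≠ 0 := by exact_mod_cast hpos.ne'
  have e2 : ((u / 2 * Real.exp (-t) : ℝ) : ℂ) ^ (-ν - 1) =
      ((u / 2 : ℝ) : ℂ) ^ (-ν) * Complex.exp (ν * t) / ((u / 2 * Real.exp (-t) : ℝ) : ℂ) := by
    rw [Complex.cpow_sub _ _ hne, Complex.cpow_one, Complex.ofReal_mul,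
      Complex.mul_cpow_ofReal_nonneg (by positivity) (by positivity), Complex.ofReal_exp,
      Complex.cpow_def_of_ne_zero (Complex.exp_ne_zero _), ← Complex.ofReal_exp,
      ← Complex.ofReal_log (Real.exp_pos _).le, Real.log_exp]
    congr 3
    push_cast; ring
  have hu2 : ((u / 2 : ℝ) : ℂ) ≠ 0 := by
    have : u / 2 ≠ 0 := by positivity
    exact_mod_cast this
  have e3 : ((u / 2 : ℝ) : ℂ) ^ ν * ((u / 2 : ℝ) : ℂ) ^ (-ν) = 1 := by
    rw [← Complex.cpow_add _ _ hu2, add_neg_cancel, Complex.cpow_zero]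
  rw [e1, e2, Complex.exp_sub, div_eq_mul_inv (Complex.exp (ν * t)), ← Complex.exp_neg]
  have e4 : Complex.exp (-(u * Real.cosh t : ℂ)) = (Real.exp (-(u * Real.cosh t)) : ℂ) := by
    push_cast; rfl
  rw [e4]
  generalize ((u / 2 * Real.exp (-t) : ℝ) : ℂ) = w at hne ⊢
  generalize ((u / 2 : ℝ) : ℂ) ^ ν = A at e3 ⊢
  generalize ((u / 2 : ℝ) : ℂ) ^ (-ν) = A' at e3 ⊢
  field_simp
  exact e3

/-! ### Laplace's method for large argument -/

/-- With `t = y/√x` and the factor `exp (-x)` removed, the integrand tends to `exp (-y²/2)` under a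
Gaussian majorant. Only the nonvanishing of the limit is needed: it makes `besselTail` strictly
positive. -/
theorem tendsto_sqrt_mul_besselInt (ν : ℂ) :
    Tendsto (fun x : ℝ => ∫ y : ℝ, Complex.exp (ν * (y / Real.sqrt x : ℝ) -
      x * (Real.cosh (y / Real.sqrt x) - 1))) atTop
      (𝓝 (∫ y : ℝ, Complex.exp (-(1 / 2 : ℂ) * (y : ℂ) ^ 2))) := by
  refine tendsto_integral_filter_of_dominated_convergence
    (fun y => Real.exp (ν.re ^ 2 + 1) * Real.exp (-(1 / 4) * y ^ 2)) ?_ ?_ ?_ ?_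
  · filter_upwards [eventually_gt_atTop 0] with x hx
    exact (by fun_prop : Continuous fun y : ℝ => Complex.exp (ν * (y / Real.sqrt x : ℝ) -
      x * (Real.cosh (y / Real.sqrt x) - 1))).aestronglyMeasurable
  · filter_upwards [eventually_ge_atTop 1] with x hx
    refine ae_of_all _ fun y => ?_
    have hs : 1 ≤ Real.sqrt x := Real.one_le_sqrt.2 hx
    have hss : Real.sqrt x ^ 2 = x := Real.sq_sqrt (by linarith)
    rw [Complex.norm_exp, ← Real.exp_add]
    refine Real.exp_le_exp.2 ?_
    have h1 := one_add_sq_div_two_le_cosh (y / Real.sqrt x)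
    have h2 : y ^ 2 / 2 ≤ x * (Real.cosh (y / Real.sqrt x) - 1) := by
      rw [div_pow, hss] at h1
      have : x * (y ^ 2 / x / 2) ≤ x * (Real.cosh (y / Real.sqrt x) - 1) := by
        gcongr; linarith
      calc y ^ 2 / 2 = x * (y ^ 2 / x / 2) := by field_simp
        _ ≤ _ := this
    have h3 : ν.re * (y / Real.sqrt x) ≤ ν.re ^ 2 + y ^ 2 / 4 := by
      have h4 : (y / Real.sqrt x) ^ 2 ≤ y ^ 2 := by
        rw [div_pow, hss]; exact div_le_self (sq_nonneg _) hx
      nlinarith [sq_nonneg (ν.re - y / Real.sqrt x / 2)]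
    have h5 : (ν * (y / Real.sqrt x : ℝ) - x * (Real.cosh (y / Real.sqrt x) - 1)).re =
        ν.re * (y / Real.sqrt x) - x * (Real.cosh (y / Real.sqrt x) - 1) := by
      rw [Complex.sub_re, Complex.re_mul_ofReal, Complex.re_ofReal_mul, Complex.sub_re,
        Complex.ofReal_re, Complex.one_re]
    rw [h5]
    linarith
  · exact (integrable_exp_neg_mul_sq (by norm_num)).const_mul _
  · refine ae_of_all _ fun y => ?_
    refine (Complex.continuous_exp.tendsto _).comp ?_
    have h0 : Tendsto (fun x : ℝ => y / Real.sqrt x) atTop (𝓝 0) :=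
      Real.tendsto_sqrt_atTop.const_div_atTop y
    have h1 : Tendsto (fun x : ℝ => x * (Real.cosh (y / Real.sqrt x) - 1)) atTop
        (𝓝 (y ^ 2 / 2)) := by
      refine tendsto_of_tendsto_of_tendsto_of_le_of_le' tendsto_const_nhds
        (h := fun x => y ^ 2 / 2 * Real.exp ((y / Real.sqrt x) ^ 2 / 2)) ?_ ?_ ?_
      · have : Continuous fun v : ℝ => y ^ 2 / 2 * Real.exp (v ^ 2 / 2) := by fun_prop
        simpa [Function.comp_def] using! (this.tendsto 0).comp h0
      all_goals
        filter_upwards [eventually_gt_atTop 0] with x hx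
        have hss : Real.sqrt x ^ 2 = x := Real.sq_sqrt hx.le
        have e : y ^ 2 / 2 = x * ((y / Real.sqrt x) ^ 2 / 2) := by
          rw [div_pow, hss]; field_simp
        rw [e]
      · gcongr
        linarith [one_add_sq_div_two_le_cosh (y / Real.sqrt x)]
      · rw [mul_assoc]
        refine mul_le_mul_of_nonneg_left ?_ hx.le
        refine (sub_le_sub_right (Real.cosh_le_exp_half_sq _) 1).trans ?_
        generalize (y / Real.sqrt x) ^ 2 / 2 = v
        have h2 := Real.add_one_le_exp (-v)
        have h3 : Real.exp (-v) * Real.exp v = 1 := by rw [← Real.exp_add]; simp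
        nlinarith [Real.exp_pos v]
    have h2 := ((Complex.continuous_ofReal.tendsto _).comp h0).const_mul ν
    have h3 := (Complex.continuous_ofReal.tendsto _).comp h1
    have h4 := h2.sub h3
    simp only [Complex.ofReal_zero, mul_zero, zero_sub] at h4
    convert! h4 using 2
    · simp
    · push_cast; ring_nf

theorem besselInt_eventually_ne_zero (ν : ℂ) : ∀ᶠ x in atTop, besselInt 0 ν x ≠ 0 := by
  have hne : ∫ y : ℝ, Complex.exp (-(1 / 2 : ℂ) * (y : ℂ) ^ 2) ≠ 0 := by
    rw [integral_gaussian_complex (by norm_num)]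
    simp [Complex.cpow_eq_zero_iff]
  filter_upwards [(tendsto_sqrt_mul_besselInt ν).eventually_ne hne, eventually_gt_atTop 0]
    with x hx hx0 h0
  refine hx ?_
  have h1 := Measure.integral_comp_div (fun t : ℝ =>
    Complex.exp (ν * t - x * (Real.cosh t - 1))) (Real.sqrt x)
  have h2 : ∫ t : ℝ, Complex.exp (ν * t - x * (Real.cosh t - 1)) =
      Complex.exp x * besselInt 0 ν x := by
    rw [besselInt, ← integral_const_mul]
    congr 1; ext t
    rw [pow_zero, one_mul, ← Complex.exp_add]
    congr 1; ring
  rw [h2, h0, mul_zero, smul_zero] at h1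
  exact h1

/-! ### The first order system for `K_ν`, `K_{ν-1}` and its conservation laws -/

/-- The recurrence eliminates the order `ν + 1`, so that the orders `ν` and `ν - 1` satisfy a closed
linear system of first order in `x`. All the conservation laws below are computed from it. -/
theorem hasDerivAt_besselInt_zero (ν : ℂ) {x : ℝ} (hx : 0 < x) :
    HasDerivAt (fun x : ℝ => besselInt 0 ν x)
      (-besselInt 0 (ν - 1) x - ν / x * besselInt 0 ν x) x := by
  have hx' : (x : ℂ) ≠ 0 := by exact_mod_cast hx.ne'
  convert! hasDerivAt_besselInt_arg 0 ν hx using 1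
  have h := besselInt_zero_recurrence ν hx
  field_simp
  linear_combination h

theorem hasDerivAt_besselInt_zero_sub_one (ν : ℂ) {x : ℝ} (hx : 0 < x) :
    HasDerivAt (fun x : ℝ => besselInt 0 (ν - 1) x)
      (-besselInt 0 ν x + (ν - 1) / x * besselInt 0 (ν - 1) x) x := by
  have hx' : (x : ℂ) ≠ 0 := by exact_mod_cast hx.ne'
  convert! hasDerivAt_besselInt_arg 0 (ν - 1) hx using 1
  have h := besselInt_zero_recurrence (ν - 1) hx
  rw [sub_add_cancel] at h ⊢
  field_simp
  linear_combination -h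

theorem hasDerivAt_besselInt_one (ν : ℂ) {x : ℝ} (hx : 0 < x) :
    HasDerivAt (fun x : ℝ => besselInt 1 ν x)
      (-besselInt 1 (ν - 1) x - ν / x * besselInt 1 ν x - besselInt 0 ν x / x) x := by
  have hx' : (x : ℂ) ≠ 0 := by exact_mod_cast hx.ne'
  convert! hasDerivAt_besselInt_arg 1 ν hx using 1
  have h := besselInt_one_recurrence ν hx
  field_simp
  linear_combination h

theorem hasDerivAt_besselInt_one_sub_one (ν : ℂ) {x : ℝ} (hx : 0 < x) :
    HasDerivAt (fun x : ℝ => besselInt 1 (ν - 1) x)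
      (-besselInt 1 ν x + (ν - 1) / x * besselInt 1 (ν - 1) x + besselInt 0 (ν - 1) x / x) x := by
  have hx' : (x : ℂ) ≠ 0 := by exact_mod_cast hx.ne'
  convert! hasDerivAt_besselInt_arg 1 (ν - 1) hx using 1
  have h := besselInt_one_recurrence (ν - 1) hx
  rw [sub_add_cancel] at h ⊢
  field_simp
  linear_combination -h

theorem tendsto_mul_besselInt_mul_besselInt (k l : ℕ) (μ ν : ℂ) :
    Tendsto (fun x : ℝ => x * (besselInt k μ x * besselInt l ν x)) atTop (𝓝 0) := by
  set A := ∫ t : ℝ, |t| ^ k * Real.exp (|μ.re| * |t| - 1 * Real.cosh t)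
  set C := ∫ t : ℝ, |t| ^ l * Real.exp (|ν.re| * |t| - 1 * Real.cosh t)
  have hA : 0 ≤ A := integral_nonneg fun t => by positivity
  have h : Tendsto (fun x : ℝ => x ^ 1 * Real.exp (-x) * (Real.exp 1 * A * C)) atTop
      (𝓝 (0 * (Real.exp 1 * A * C))) :=
    (Real.tendsto_pow_mul_exp_neg_atTop_nhds_zero 1).mul_const _
  rw [zero_mul] at h
  refine squeeze_zero_norm' ?_ h
  filter_upwards [eventually_ge_atTop 1] with x hx
  have h1 : ‖besselInt k μ x‖ ≤ Real.exp (-(x - 1)) * A := norm_besselInt_le le_rfl one_pos hx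
  have h2 : ‖besselInt l ν x‖ ≤ Real.exp (-(x - 1)) * C := norm_besselInt_le le_rfl one_pos hx
  have h3 : ‖besselInt l ν x‖ ≤ C := by
    refine h2.trans (mul_le_of_le_one_left (integral_nonneg fun t => by positivity) ?_)
    exact Real.exp_le_one_iff.2 (by linarith)
  rw [norm_mul, norm_mul, Complex.norm_real, Real.norm_of_nonneg (by linarith)]
  calc x * (‖besselInt k μ x‖ * ‖besselInt l ν x‖)
      ≤ x * ((Real.exp (-(x - 1)) * A) * C) := by gcongr
    _ = _ := by rw [show -(x - 1) = -x + 1 by ring, Real.exp_add]; ring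

theorem tendsto_besselInt_mul_besselInt (k l : ℕ) (μ ν : ℂ) :
    Tendsto (fun x : ℝ => besselInt k μ x * besselInt l ν x) atTop (𝓝 0) := by
  have h := (Complex.continuous_ofReal.tendsto _).comp tendsto_inv_atTop_zero |>.mul
    (tendsto_mul_besselInt_mul_besselInt k l μ ν)
  simp only [Complex.ofReal_zero, mul_zero] at h
  refine h.congr' ?_
  filter_upwards [eventually_gt_atTop 0] with x hx
  have hx' : (x : ℂ) ≠ 0 := by exact_mod_cast hx.ne'
  simp only [Function.comp, Complex.ofReal_inv]
  field_simp

theorem besselInt_conj_sub_one (ν : ℂ) (x : ℝ) :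
    besselInt 0 ((starRingEnd ℂ) ν - 1) x = (starRingEnd ℂ) (besselInt 0 (ν - 1) x) := by
  rw [conj_besselInt]; simp

theorem hasDerivAt_re {f : ℝ → ℂ} {f' : ℂ} {x : ℝ} (h : HasDerivAt f f' x) :
    HasDerivAt (fun x => (f x).re) f'.re x :=
  (Complex.reCLM.hasFDerivAt (x := f x)).comp_hasDerivAt x h

theorem tendsto_re_zero {f : ℝ → ℂ} {l : Filter ℝ} (h : Tendsto f l (𝓝 0)) :
    Tendsto (fun x => (f x).re) l (𝓝 0) := by
  simpa using! (Complex.continuous_re.tendsto 0).comp h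

theorem antitoneOn_of_hasDerivAt_nonpos {f f' : ℝ → ℝ} {s : Set ℝ} (hs : Convex ℝ s)
    (hf : ∀ x ∈ s, HasDerivAt f (f' x) x) (hf' : ∀ x ∈ s, f' x ≤ 0) : AntitoneOn f s :=
  antitoneOn_of_hasDerivWithinAt_nonpos hs (fun x hx => (hf x hx).continuousAt.continuousWithinAt)
    (fun x hx => (hf x (interior_subset hx)).hasDerivWithinAt)
    (fun x hx => hf' x (interior_subset hx))

theorem nonneg_of_antitoneOn_of_tendsto {f : ℝ → ℝ} {a : ℝ} (hf : AntitoneOn f (Set.Ioi a))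
    (h : Tendsto f atTop (𝓝 0)) {x : ℝ} (hx : a < x) : 0 ≤ f x :=
  le_of_tendsto h ((eventually_ge_atTop x).mono fun _ hy => hf hx (hx.trans_le hy) hy)

/-- Let `B` and `B'` be the integrals of orders `ν` and `ν - 1`. The function `x(|B|² - |B'|²)` has
derivative `-(2 Re ν - 1)(|B|² + |B'|²) ≤ 0` and tends to `0` at infinity, hence is nonnegative. -/
theorem norm_besselInt_sub_one_le {ν : ℂ} (hν : 1 / 2 ≤ ν.re) {x : ℝ} (hx : 0 < x) :
    ‖besselInt 0 (ν - 1) x‖ ≤ ‖besselInt 0 ν x‖ := by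
  set μ := (starRingEnd ℂ) ν with hμ
  have hd : ∀ y ∈ Set.Ioi (0 : ℝ), HasDerivAt (fun y : ℝ => (y * (besselInt 0 ν y * besselInt 0 μ y) -
      y * (besselInt 0 (ν - 1) y * besselInt 0 (μ - 1) y)).re)
      (-(2 * ν.re - 1) * (‖besselInt 0 ν y‖ ^ 2 + ‖besselInt 0 (ν - 1) y‖ ^ 2)) y := by
    intro y hy
    have hy' : (y : ℂ) ≠ 0 := by exact_mod_cast (ne_of_gt hy : y ≠ 0)
    have hid : HasDerivAt (fun y : ℝ => (y : ℂ)) 1 y := Complex.ofRealCLM.hasDerivAt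
    have h := hasDerivAt_re ((hid.mul ((hasDerivAt_besselInt_zero ν hy).mul
      (hasDerivAt_besselInt_zero μ hy))).sub (hid.mul ((hasDerivAt_besselInt_zero_sub_one ν hy).mul
        (hasDerivAt_besselInt_zero_sub_one μ hy))))
    refine h.congr_deriv ?_
    simp only [Pi.mul_apply]
    have e1 : besselInt 0 μ y = (starRingEnd ℂ) (besselInt 0 ν y) := (conj_besselInt 0 ν y).symm
    have e2 := besselInt_conj_sub_one ν y
    rw [← hμ] at e2
    have n1 := Complex.mul_conj (besselInt 0 ν y)
    have n2 := Complex.mul_conj (besselInt 0 (ν - 1) y)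
    have n3 : ν + μ = ((2 * ν.re : ℝ) : ℂ) := Complex.add_conj ν
    rw [← e1, Complex.normSq_eq_norm_sq] at n1
    rw [← e2, Complex.normSq_eq_norm_sq] at n2
    rw [← Complex.ofReal_re (-(2 * ν.re - 1) *
      (‖besselInt 0 ν y‖ ^ 2 + ‖besselInt 0 (ν - 1) y‖ ^ 2))]
    congr 1
    push_cast at n1 n2 n3 ⊢
    rw [← n1, ← n2, ← n3]
    field_simp
    ring
  have hanti := antitoneOn_of_hasDerivAt_nonpos (convex_Ioi 0) hd fun y _ => by
    have : 0 ≤ (2 * ν.re - 1) * (‖besselInt 0 ν y‖ ^ 2 + ‖besselInt 0 (ν - 1) y‖ ^ 2) := by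
      have : 0 ≤ 2 * ν.re - 1 := by linarith
      positivity
    linarith
  have hlim := (tendsto_mul_besselInt_mul_besselInt 0 0 ν μ).sub
    (tendsto_mul_besselInt_mul_besselInt 0 0 (ν - 1) (μ - 1))
  rw [sub_zero] at hlim
  replace hlim := tendsto_re_zero hlim
  have h0 := nonneg_of_antitoneOn_of_tendsto hanti hlim hx
  rw [← mul_sub, Complex.re_ofReal_mul, ← conj_besselInt, besselInt_conj_sub_one,
    Complex.mul_conj, Complex.mul_conj, ← Complex.ofReal_sub, Complex.ofReal_re,
    Complex.normSq_eq_norm_sq, Complex.normSq_eq_norm_sq] at h0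
  have h1 := nonneg_of_mul_nonneg_right h0 hx
  exact (sq_le_sq₀ (norm_nonneg _) (norm_nonneg _)).1 (by linarith)

/-- For `ν = σ + i τ` this is `2 σ ∫_x^∞ |2 K_ν|² dy / y`. -/
noncomputable def besselTail (ν : ℂ) (x : ℝ) : ℝ :=
  ‖besselInt 0 ν x‖ ^ 2 -
    x * (besselInt 0 ν x * (starRingEnd ℂ) (besselInt 0 (ν - 1) x)).im / ν.im

/-- In this form conjugates are replaced by integrals of order `conj ν`, so that the first order
system can be applied to each factor. -/
theorem besselTail_eq {ν : ℂ} (hν : ν.im ≠ 0) (x : ℝ) :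
    (besselTail ν x : ℂ) = (besselInt 0 ν x * besselInt 0 ((starRingEnd ℂ) ν) x) -
      x * (besselInt 0 ν x * besselInt 0 ((starRingEnd ℂ) ν - 1) x -
        besselInt 0 (ν - 1) x * besselInt 0 ((starRingEnd ℂ) ν) x) / (ν - (starRingEnd ℂ) ν) := by
  have e1 := (conj_besselInt 0 ν x).symm
  have e2 := besselInt_conj_sub_one ν x
  have hν' : (ν.im : ℂ) ≠ 0 := by exact_mod_cast hν
  rw [e1, e2, Complex.sub_conj, Complex.mul_conj, Complex.normSq_eq_norm_sq, besselTail]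
  have h := Complex.sub_conj (besselInt 0 ν x * (starRingEnd ℂ) (besselInt 0 (ν - 1) x))
  rw [map_mul, Complex.conj_conj, mul_comm ((starRingEnd ℂ) (besselInt 0 ν x))] at h
  rw [h]
  push_cast
  field_simp [Complex.I_ne_zero]

/-- The mixed products cancel in the derivative; what is left is `|B|²` times the sum of `ν` and its
conjugate, divided by `-x`. -/
theorem hasDerivAt_besselTail {ν : ℂ} (hν : ν.im ≠ 0) {x : ℝ} (hx : 0 < x) :
    HasDerivAt (besselTail ν) (-(2 * ν.re / x) * ‖besselInt 0 ν x‖ ^ 2) x := by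
  set μ := (starRingEnd ℂ) ν with hμ
  have hx' : (x : ℂ) ≠ 0 := by exact_mod_cast hx.ne'
  have hid : HasDerivAt (fun y : ℝ => (y : ℂ)) 1 x := Complex.ofRealCLM.hasDerivAt
  have a1 := hasDerivAt_besselInt_zero ν hx
  have a2 := hasDerivAt_besselInt_zero μ hx
  have b1 := hasDerivAt_besselInt_zero_sub_one ν hx
  have b2 := hasDerivAt_besselInt_zero_sub_one μ hx
  have h := hasDerivAt_re
    ((a1.mul a2).sub ((hid.mul ((a1.mul b2).sub (b1.mul a2))).div_const (ν - μ)))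
  have hfun : besselTail ν = fun y : ℝ => (besselInt 0 ν y * besselInt 0 μ y -
      y * (besselInt 0 ν y * besselInt 0 (μ - 1) y -
        besselInt 0 (ν - 1) y * besselInt 0 μ y) / (ν - μ)).re := by
    ext y
    rw [← besselTail_eq hν, Complex.ofReal_re]
  rw [hfun]
  refine h.congr_deriv ?_
  simp only [Pi.mul_apply, Pi.sub_apply]
  have hne : ν - μ ≠ 0 := by
    rw [Complex.sub_conj]
    have : (ν.im : ℂ) ≠ 0 := by exact_mod_cast hν
    simp [hν]
  have n1 := Complex.mul_conj (besselInt 0 ν x)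
  rw [conj_besselInt, ← hμ, Complex.normSq_eq_norm_sq] at n1
  have n3 : ν + μ = ((2 * ν.re : ℝ) : ℂ) := Complex.add_conj ν
  rw [← Complex.ofReal_re (-(2 * ν.re / x) * ‖besselInt 0 ν x‖ ^ 2)]
  congr 1
  push_cast at n1 n3 ⊢
  rw [← n1, ← n3]
  field_simp
  ring

theorem tendsto_besselTail {ν : ℂ} (hν : ν.im ≠ 0) :
    Tendsto (besselTail ν) atTop (𝓝 0) := by
  set μ := (starRingEnd ℂ) ν with hμ
  have h := (tendsto_besselInt_mul_besselInt 0 0 ν μ).sub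
    (((tendsto_mul_besselInt_mul_besselInt 0 0 ν (μ - 1)).sub
      (tendsto_mul_besselInt_mul_besselInt 0 0 (ν - 1) μ)).div_const (ν - μ))
  simp only [sub_zero, zero_div] at h
  refine (tendsto_re_zero h).congr fun x => ?_
  rw [← Complex.ofReal_re (besselTail ν x), besselTail_eq hν, ← hμ]
  congr 1; ring

/-- A decreasing function with limit `0` is nonnegative. A zero at `x` would force it to vanish
beyond `x`, hence also its derivative and with it the Bessel integral, against the behaviour for
large argument. -/
theorem besselTail_pos {ν : ℂ} (hν : ν.im ≠ 0) (hre : 0 < ν.re) {x : ℝ} (hx : 0 < x) :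
    0 < besselTail ν x := by
  have hanti : AntitoneOn (besselTail ν) (Set.Ioi 0) :=
    antitoneOn_of_hasDerivAt_nonpos (convex_Ioi 0) (fun y hy => hasDerivAt_besselTail hν hy)
      fun y hy => by
        have : 0 < y := hy
        have : 0 ≤ 2 * ν.re / y * ‖besselInt 0 ν y‖ ^ 2 := by positivity
        linarith
  refine (nonneg_of_antitoneOn_of_tendsto hanti (tendsto_besselTail hν) hx).lt_of_ne' fun h0 => ?_
  obtain ⟨y, hy, hxy⟩ := ((besselInt_eventually_ne_zero ν).and (eventually_gt_atTop x)).exists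
  have hy0 := hx.trans hxy
  have hzero : ∀ᶠ z in 𝓝 y, besselTail ν z = 0 := by
    filter_upwards [Ioi_mem_nhds hxy] with z hz
    exact le_antisymm (h0 ▸ hanti hx (hx.trans hz) (le_of_lt hz))
      (nonneg_of_antitoneOn_of_tendsto hanti (tendsto_besselTail hν) (hx.trans hz))
  have h1 := (hasDerivAt_besselTail hν hy0).unique
    ((hasDerivAt_const y (0 : ℝ)).congr_of_eventuallyEq hzero)
  have h2 : 0 < 2 * ν.re / y * ‖besselInt 0 ν y‖ ^ 2 := by positivity
  linarith

theorem besselInt_zero_ofReal (ν x : ℝ) : besselInt 0 ν x =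
    ((∫ t : ℝ, Real.exp (ν * t - x * Real.cosh t) : ℝ) : ℂ) := by
  rw [besselInt, ← integral_complex_ofReal]
  congr 1; ext t
  push_cast
  rw [pow_zero, one_mul]

theorem besselInt_zero_re_pos (ν : ℝ) {x : ℝ} (hx : 0 < x) : 0 < (besselInt 0 ν x).re := by
  rw [besselInt_zero_ofReal, Complex.ofReal_re]
  have h := (integrable_besselInt 0 (ν : ℂ) hx).re
  refine integral_pos_of_integrable_nonneg_nonzero (x := 0) (by fun_prop) ?_
    (fun t => (Real.exp_pos _).le) (Real.exp_pos _).ne'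
  refine h.congr (ae_of_all _ fun t => ?_)
  have : Complex.exp (ν * t - x * Real.cosh t) = (Real.exp (ν * t - x * Real.cosh t) : ℂ) := by
    push_cast; rfl
  simp only [pow_zero, one_mul]
  rw [this]
  exact Complex.ofReal_re _

/-- For real `ν` the integrand is positive. Otherwise a zero of the integral would make both terms
of `besselTail` vanish. -/
theorem besselInt_ne_zero {ν : ℂ} (hν : 0 < ν.re) {x : ℝ} (hx : 0 < x) :
    besselInt 0 ν x ≠ 0 := by
  intro h0
  by_cases him : ν.im = 0
  · have : ν = (ν.re : ℂ) := Complex.ext rfl (by simp [him])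
    rw [this] at h0
    have := besselInt_zero_re_pos ν.re hx
    rw [h0] at this
    simp at this
  · have := besselTail_pos him hν hx
    simp [besselTail, h0] at this

/-! ### The ratio `u K_{ν-1}(u) / K_ν(u)` -/

/-- The ratio `u K_{ν-1}(u) / K_ν(u)`. -/
noncomputable def besselRatio (u : ℝ) (ν : ℂ) : ℂ :=
  u * besselInt 0 (ν - 1) u / besselInt 0 ν u

theorem norm_besselRatio_le {u : ℝ} (hu : 0 < u) {ν : ℂ} (hν : 1 / 2 ≤ ν.re) :
    ‖besselRatio u ν‖ ≤ u := by
  have h := norm_besselInt_sub_one_le hν hu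
  rw [besselRatio, norm_div, norm_mul, Complex.norm_real, Real.norm_of_nonneg hu.le, mul_div_assoc]
  exact mul_le_of_le_one_right hu.le (div_le_one_of_le₀ h (norm_nonneg _))

/-- The recurrence in the order, written as one step of a continued fraction. It gives the ratio at
`ν + 1` as `u²` over something of size `2|ν|`, which is the gain of a factor `1/|ν|` away from the
critical line. -/
theorem besselRatio_add_one {u : ℝ} (hu : 0 < u) {ν : ℂ} (hν : 0 < ν.re) :
    besselRatio u (ν + 1) * (2 * ν + besselRatio u ν) = u ^ 2 := by
  have h0 := besselInt_ne_zero hν hu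
  have h1 := besselInt_ne_zero (ν := ν + 1) (by simp; linarith) hu
  have h := besselInt_zero_recurrence ν hu
  rw [besselRatio, besselRatio, add_sub_cancel_right]
  field_simp
  linear_combination -(u : ℂ) * h

theorem norm_besselRatio_mul_le {u : ℝ} (hu : 0 < u) {ν : ℂ} (hν : 3 / 2 ≤ ν.re) :
    ‖besselRatio u ν‖ * (2 * ‖ν - 1‖ - u) ≤ u ^ 2 := by
  have hre : 1 / 2 ≤ (ν - 1).re := by simp; linarith
  have h := besselRatio_add_one (ν := ν - 1) hu (by linarith)
  rw [sub_add_cancel] at h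
  have h1 := congrArg norm h
  rw [norm_mul, norm_pow, Complex.norm_real, Real.norm_of_nonneg hu.le] at h1
  rw [← h1]
  gcongr
  have h2 := norm_sub_le_norm_add (2 * (ν - 1)) (besselRatio u (ν - 1))
  have h3 := norm_besselRatio_le hu hre
  rw [norm_mul, Complex.norm_ofNat] at h2
  linarith

theorem hasDerivAt_besselRatio {u : ℝ} (hu : 0 < u) {ν : ℂ} (hν : 0 < ν.re) :
    HasDerivAt (besselRatio u) (u * (besselInt 0 ν u * besselInt 1 (ν - 1) u -
      besselInt 0 (ν - 1) u * besselInt 1 ν u) / besselInt 0 ν u ^ 2) ν := by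
  have h1 := (hasDerivAt_besselInt_order 0 (ν - 1) hu).comp_sub_const ν 1
  have h := (h1.const_mul (u : ℂ)).div (hasDerivAt_besselInt_order 0 ν hu) (besselInt_ne_zero hν hu)
  refine h.congr_deriv ?_
  congr 1
  ring

theorem conj_besselRatio (u : ℝ) (ν : ℂ) :
    (starRingEnd ℂ) (besselRatio u ν) = besselRatio u ((starRingEnd ℂ) ν) := by
  simp [besselRatio, conj_besselInt]

/-- The left factor of `besselTail ν u = |B|² (1 + Im q / Im ν)`, with `B` the integral of order
`ν`, is positive. The imaginary part of `q` can therefore never cancel that of `(ε + 1) s`. -/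
theorem im_besselRatio_div_pos {u : ℝ} (hu : 0 < u) {ν : ℂ} (hν : 0 < ν.re) (him : ν.im ≠ 0) :
    0 < 1 + (besselRatio u ν).im / ν.im := by
  have h := besselTail_pos him hν hu
  have hB := besselInt_ne_zero hν hu
  have hN : 0 < ‖besselInt 0 ν u‖ ^ 2 := by positivity
  have e : (besselRatio u ν).im * ‖besselInt 0 ν u‖ ^ 2 =
      -(u * (besselInt 0 ν u * (starRingEnd ℂ) (besselInt 0 (ν - 1) u)).im) := by
    have e1 : besselRatio u ν * (‖besselInt 0 ν u‖ ^ 2 : ℝ) =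
        (u : ℂ) * (besselInt 0 (ν - 1) u * (starRingEnd ℂ) (besselInt 0 ν u)) := by
      rw [← Complex.normSq_eq_norm_sq, ← Complex.mul_conj, besselRatio]
      field_simp
    have e2 := congrArg Complex.im e1
    rw [Complex.im_mul_ofReal, Complex.im_ofReal_mul] at e2
    rw [e2]
    simp only [Complex.mul_im, Complex.conj_re, Complex.conj_im]
    ring
  have e3 : besselTail ν u = ‖besselInt 0 ν u‖ ^ 2 * (1 + (besselRatio u ν).im / ν.im) := by
    rw [besselTail, mul_add, mul_one, ← mul_div_assoc, mul_comm _ (besselRatio u ν).im, e]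
    ring
  rw [e3] at h
  exact pos_of_mul_pos_right h hN.le

theorem besselRatio_ofReal {u : ℝ} (hu : 0 < u) (ν : ℝ) :
    0 < (besselRatio u ν).re ∧ (besselRatio u ν).im = 0 := by
  have h1 := besselInt_zero_re_pos (ν - 1) hu
  have h2 := besselInt_zero_re_pos ν hu
  have e : besselRatio u ν =
      ((u * (besselInt 0 ((ν - 1 : ℝ) : ℂ) u).re / (besselInt 0 (ν : ℂ) u).re : ℝ) : ℂ) := by
    push_cast
    rw [besselRatio]
    congr 2
    · rw [← Complex.ofReal_one, ← Complex.ofReal_sub, besselInt_zero_ofReal, Complex.ofReal_re]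
    · rw [besselInt_zero_ofReal, Complex.ofReal_re]
  rw [e, Complex.ofReal_re, Complex.ofReal_im]
  exact ⟨by positivity, rfl⟩

/-! ### The derivative of the ratio on the critical line `Re ν = 1/2` -/

/-- Mean value inequality with a real majorant: `g` plays the part of an explicit primitive, so that
no integral has to be estimated. -/
theorem norm_le_norm_add_of_norm_deriv_le {f f' : ℝ → ℂ} {g g' : ℝ → ℝ} {a b : ℝ} (hab : a ≤ b)
    (hf : ∀ x ∈ Set.Icc a b, HasDerivAt f (f' x) x) (hg : ∀ x ∈ Set.Icc a b, HasDerivAt g (g' x) x)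
    (h : ∀ x ∈ Set.Icc a b, ‖f' x‖ ≤ -g' x) : ‖f a‖ ≤ ‖f b‖ + (g a - g b) := by
  have key := image_norm_le_of_norm_deriv_right_le_deriv_boundary' (f := fun x => f x - f a)
    (f' := f') (B := fun x => g a - g x) (B' := fun x => -g' x) (a := a) (b := b)
    (fun x hx => ((hf x hx).continuousAt.sub continuousAt_const).continuousWithinAt)
    (fun x hx => ((hf x (Set.Ico_subset_Icc_self hx)).sub_const (f a)).hasDerivWithinAt)
    (by simp)
    (fun x hx => (continuousAt_const.sub (hg x hx).continuousAt).continuousWithinAt)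
    (fun x hx => ((hg x (Set.Ico_subset_Icc_self hx)).const_sub (g a)).hasDerivWithinAt)
    (fun x hx => h x (Set.Ico_subset_Icc_self hx))
  have h1 := key (Set.right_mem_Icc.2 hab)
  have h2 := norm_sub_norm_le (f a) (f b)
  rw [norm_sub_rev] at h2
  linarith

theorem norm_le_of_norm_deriv_le_of_tendsto {f f' : ℝ → ℂ} {g g' : ℝ → ℝ} {a : ℝ}
    (hf : ∀ x ∈ Set.Ici a, HasDerivAt f (f' x) x) (hg : ∀ x ∈ Set.Ici a, HasDerivAt g (g' x) x)
    (h : ∀ x ∈ Set.Ici a, ‖f' x‖ ≤ -g' x) (hf0 : Tendsto f atTop (𝓝 0))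
    (hg0 : Tendsto g atTop (𝓝 0)) : ‖f a‖ ≤ g a := by
  have h1 : Tendsto (fun b => ‖f b‖ + (g a - g b)) atTop (𝓝 (‖(0 : ℂ)‖ + (g a - 0))) :=
    hf0.norm.add (tendsto_const_nhds.sub hg0)
  simp only [norm_zero, sub_zero, zero_add] at h1
  refine ge_of_tendsto h1 ((eventually_ge_atTop a).mono fun b hb => ?_)
  exact norm_le_norm_add_of_norm_deriv_le hb (fun x hx => hf x hx.1) (fun x hx => hg x hx.1)
    (fun x hx => h x hx.1)

/-- On the line `Re ν = 1/2` one has `ν - 1 = -conj ν`, and the integral is even in the order. -/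
theorem besselInt_sub_one_of_re_eq {ν : ℂ} (hν : ν.re = 1 / 2) (x : ℝ) :
    besselInt 0 (ν - 1) x = (starRingEnd ℂ) (besselInt 0 ν x) := by
  rw [conj_besselInt, ← besselInt_zero_neg]
  congr 1
  apply Complex.ext <;> simp [hν]
  norm_num

/-- The Wronskian in the order of `K_ν` and `K_{ν-1}`. -/
noncomputable def orderWronskian (ν : ℂ) (x : ℝ) : ℂ :=
  besselInt 0 ν x * besselInt 1 (ν - 1) x - besselInt 0 (ν - 1) x * besselInt 1 ν x

/-- The terms with an order derivative cancel. Since `q' = u W / B²`, with `W` the Wronskian and `B`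
the integral of order `ν`, a bound for `q'` amounts to a bound for the integral of this derivative
from `u` to infinity; on the critical line its modulus is `2|B|²`. -/
theorem hasDerivAt_mul_orderWronskian (ν : ℂ) {x : ℝ} (hx : 0 < x) :
    HasDerivAt (fun x : ℝ => x * orderWronskian ν x)
      (2 * (besselInt 0 ν x * besselInt 0 (ν - 1) x)) x := by
  have hx' : (x : ℂ) ≠ 0 := by exact_mod_cast hx.ne'
  have hid : HasDerivAt (fun y : ℝ => (y : ℂ)) 1 x := Complex.ofRealCLM.hasDerivAt
  have h := hid.mul (((hasDerivAt_besselInt_zero ν hx).mul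
    (hasDerivAt_besselInt_one_sub_one ν hx)).sub
      ((hasDerivAt_besselInt_zero_sub_one ν hx).mul (hasDerivAt_besselInt_one ν hx)))
  refine h.congr_deriv ?_
  simp only [Pi.mul_apply, Pi.sub_apply]
  field_simp
  ring

theorem tendsto_mul_orderWronskian (ν : ℂ) :
    Tendsto (fun x : ℝ => x * orderWronskian ν x) atTop (𝓝 0) := by
  have h := (tendsto_mul_besselInt_mul_besselInt 0 1 ν (ν - 1)).sub
    (tendsto_mul_besselInt_mul_besselInt 0 1 (ν - 1) ν)
  rw [sub_zero] at h
  exact h.congr fun x => by rw [orderWronskian]; ring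

theorem besselTail_of_re_eq {ν : ℂ} (hν : ν.re = 1 / 2) (x : ℝ) : besselTail ν x =
    ‖besselInt 0 ν x‖ ^ 2 - x * (besselInt 0 ν x ^ 2).im / ν.im := by
  rw [besselTail, besselInt_sub_one_of_re_eq hν, Complex.conj_conj, sq (besselInt 0 ν x)]

/-- For `x` below `|Im ν| / 2` this makes the tail and `|B|²` comparable, with `B` the integral of
order `ν`. -/
theorem abs_besselTail_sub_le {ν : ℂ} (hν : ν.re = 1 / 2) {x : ℝ} (hx : 0 ≤ x) :
    |besselTail ν x - ‖besselInt 0 ν x‖ ^ 2| ≤ x / |ν.im| * ‖besselInt 0 ν x‖ ^ 2 := by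
  rw [besselTail_of_re_eq hν, sub_sub_cancel_left, abs_neg, abs_div, abs_mul, abs_of_nonneg hx,
    div_mul_eq_mul_div]
  gcongr
  rw [← norm_pow]
  exact Complex.abs_im_le_norm _

theorem norm_mul_orderWronskian_le_besselTail {ν : ℂ} (hν : ν.re = 1 / 2) {x : ℝ} (him : ν.im ≠ 0) (hx : 0 < x) :
    ‖x * orderWronskian ν x‖ ≤ ‖besselInt 0 ν x‖ ^ 2 + 2 * ν.im ^ 2 / x * besselTail ν x := by
  set τ := ν.im with hτ
  -- The derivative of `Re (y B²)`, with `B` the integral of order `ν`, is `-2y|B|²` plus an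
  -- oscillating term. Adding `2τ²` times the tail turns that term into a negative multiple of the
  -- tail. Hence `-Z'/x ≥ 2|B|²` for `y ≥ x`, and `Z/x` is a majorant for `y W(y)`.
  set Z : ℝ → ℝ := fun y => (y * (besselInt 0 ν y * besselInt 0 ν y)).re +
    2 * τ ^ 2 * besselTail ν y with hZ
  have hZd : ∀ y ∈ Set.Ici x, HasDerivAt Z (-(2 * y * ‖besselInt 0 ν y‖ ^ 2) -
      2 * τ ^ 2 / y * besselTail ν y) y := by
    intro y hy
    have hy0 : 0 < y := hx.trans_le hy
    have hy' : (y : ℂ) ≠ 0 := by exact_mod_cast hy0.ne'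
    have hid : HasDerivAt (fun y : ℝ => (y : ℂ)) 1 y := Complex.ofRealCLM.hasDerivAt
    have a := hasDerivAt_besselInt_zero ν hy0
    have h1 := (hasDerivAt_re (hid.mul (a.mul a))).add
      ((hasDerivAt_besselTail him hy0).const_mul (2 * τ ^ 2))
    refine h1.congr_deriv ?_
    have e : 1 * ((fun x : ℝ => besselInt 0 ν x) * fun x : ℝ => besselInt 0 ν x) y +
        (y : ℂ) * ((-besselInt 0 (ν - 1) y - ν / y * besselInt 0 ν y) * besselInt 0 ν y +
          besselInt 0 ν y * (-besselInt 0 (ν - 1) y - ν / y * besselInt 0 ν y)) =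
        ((-(2 * y * ‖besselInt 0 ν y‖ ^ 2) : ℝ) : ℂ) - (2 * τ : ℝ) * Complex.I *
          besselInt 0 ν y ^ 2 := by
      have n1 := Complex.mul_conj (besselInt 0 ν y)
      rw [Complex.normSq_eq_norm_sq] at n1
      have n2 : ν = 1 / 2 + τ * Complex.I := by
        apply Complex.ext <;> simp [hν, hτ]
      rw [besselInt_sub_one_of_re_eq hν]
      simp only [Pi.mul_apply]
      push_cast at n1 ⊢
      rw [← n1]
      field_simp
      linear_combination (-2 * besselInt 0 ν y ^ 2) * n2
    rw [e, besselTail_of_re_eq hν, Complex.sub_re, Complex.ofReal_re,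
      mul_assoc (_ : ℂ), Complex.re_ofReal_mul, Complex.I_mul_re, hν, ← hτ]
    field_simp
    ring
  have hZ0 : Tendsto Z atTop (𝓝 0) := by
    have h := (tendsto_re_zero (tendsto_mul_besselInt_mul_besselInt 0 0 ν ν)).add
      ((tendsto_besselTail him).const_mul (2 * τ ^ 2))
    rwa [mul_zero, add_zero] at h
  have key := norm_le_of_norm_deriv_le_of_tendsto (a := x) (g := fun y => Z y / x)
    (fun y hy => hasDerivAt_mul_orderWronskian ν (hx.trans_le hy))
    (fun y hy => (hZd y hy).div_const x) (fun y hy => ?_) (tendsto_mul_orderWronskian ν)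
    (by simpa using hZ0.div_const x)
  · refine key.trans ?_
    have h1 : (x * (besselInt 0 ν x * besselInt 0 ν x)).re ≤ x * ‖besselInt 0 ν x‖ ^ 2 := by
      rw [Complex.re_ofReal_mul]
      gcongr
      refine (Complex.re_le_norm _).trans ?_
      rw [norm_mul, sq]
    rw [div_le_iff₀ hx, hZ]
    have e : (‖besselInt 0 ν x‖ ^ 2 + 2 * τ ^ 2 / x * besselTail ν x) * x =
        x * ‖besselInt 0 ν x‖ ^ 2 + 2 * τ ^ 2 * besselTail ν x := by field_simp
    rw [e]
    linarith
  · have hy' : x ≤ y := hy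
    have hy0 : 0 < y := hx.trans_le hy
    have hpos := besselTail_pos him (by rw [hν]; norm_num) hy0
    rw [besselInt_sub_one_of_re_eq hν, Complex.mul_conj, Complex.normSq_eq_norm_sq, norm_mul,
      Complex.norm_real, Complex.norm_ofNat, Real.norm_of_nonneg (sq_nonneg _), ← neg_div,
      le_div_iff₀ hx]
    have h1 : 0 ≤ 2 * τ ^ 2 / y * besselTail ν y := by positivity
    have h2 : ‖besselInt 0 ν y‖ ^ 2 * x ≤ ‖besselInt 0 ν y‖ ^ 2 * y := by gcongr
    linarith

/-- For `y ≤ |Im ν|/2` the tail is at most `3/2 |B|²`, where `B` is the integral of order `ν`, while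
its derivative is `-|B|²/y`. So `y^(2/3)` times the tail decreases. -/
theorem besselTail_le_mul_rpow {ν : ℂ} (hν : ν.re = 1 / 2) (him : ν.im ≠ 0) {u x : ℝ} (hu : 0 < u)
    (hux : u ≤ x) (hx : x ≤ |ν.im| / 2) :
    besselTail ν x ≤ besselTail ν u * (u / x) ^ (2 / 3 : ℝ) := by
  have hτ : 0 < |ν.im| := abs_pos.2 him
  have hd : ∀ y ∈ Set.Icc u x, HasDerivAt (fun y => y ^ (2 / 3 : ℝ) * besselTail ν y)
      (2 / 3 * y ^ (2 / 3 - 1 : ℝ) * besselTail ν y +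
        y ^ (2 / 3 : ℝ) * (-(2 * ν.re / y) * ‖besselInt 0 ν y‖ ^ 2)) y := by
    intro y hy
    have hy0 : 0 < y := hu.trans_le hy.1
    exact (Real.hasDerivAt_rpow_const (Or.inl hy0.ne')).mul (hasDerivAt_besselTail him hy0)
  have hanti := antitoneOn_of_hasDerivAt_nonpos (convex_Icc u x) hd fun y hy => by
    have hy0 : 0 < y := hu.trans_le hy.1
    have h1 := (abs_le.1 (abs_besselTail_sub_le hν hy0.le)).2
    have h2 : y / |ν.im| ≤ 1 / 2 := by
      rw [div_le_iff₀ hτ]; linarith [hy.2]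
    have h3 : y / |ν.im| * ‖besselInt 0 ν y‖ ^ 2 ≤ 1 / 2 * ‖besselInt 0 ν y‖ ^ 2 := by gcongr
    rw [Real.rpow_sub_one hy0.ne', hν]
    have e : 2 / 3 * (y ^ (2 / 3 : ℝ) / y) * besselTail ν y +
        y ^ (2 / 3 : ℝ) * (-(2 * (1 / 2) / y) * ‖besselInt 0 ν y‖ ^ 2) =
        y ^ (2 / 3 : ℝ) / y * (2 / 3 * besselTail ν y - ‖besselInt 0 ν y‖ ^ 2) := by
      ring
    rw [e]
    exact mul_nonpos_of_nonneg_of_nonpos (by positivity) (by linarith)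
  have hx0 : 0 < x := hu.trans_le hux
  have h := hanti (Set.left_mem_Icc.2 hux) (Set.right_mem_Icc.2 hux) hux
  rw [Real.div_rpow hu.le hx0.le, ← mul_div_assoc, le_div_iff₀ (by positivity)]
  simp only at h
  linarith

/-- The range of integration is split at `Y = |Im ν|/2`. Beyond `Y` the contribution is of the order
of `Y` times the tail at `Y`, which has already decayed like `Y^(-2/3)`; below `Y` the decay of the
tail is integrated. Both parts are of order `|Im ν|^(1/3)`. -/
theorem norm_mul_orderWronskian_le {ν : ℂ} (hν : ν.re = 1 / 2) {u : ℝ} (hu : 0 < u)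
    (him : 2 * u ≤ |ν.im|) :
    ‖u * orderWronskian ν u‖ ≤
      (3 + 30 * u ^ (2 / 3 : ℝ) * |ν.im| ^ (1 / 3 : ℝ)) * ‖besselInt 0 ν u‖ ^ 2 := by
  have hτ : 0 < |ν.im| := by linarith
  have hne : ν.im ≠ 0 := abs_pos.1 hτ
  set Y := |ν.im| / 2 with hY
  have huY : u ≤ Y := by linarith
  have hY0 : 0 < Y := by linarith
  set e := besselTail ν with he
  have hre : 0 < ν.re := by rw [hν]; norm_num
  have hepos : ∀ {x : ℝ}, 0 < x → 0 < e x := fun hx => besselTail_pos hne hre hx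
  have hNe : ∀ x, 0 < x → x ≤ Y → ‖besselInt 0 ν x‖ ^ 2 ≤ 2 * e x ∧
      e x ≤ 3 / 2 * ‖besselInt 0 ν x‖ ^ 2 := by
    intro x hx0 hxY
    have h1 := abs_le.1 (abs_besselTail_sub_le hν hx0.le)
    have h2 : x / |ν.im| ≤ 1 / 2 := by
      rw [div_le_iff₀ hτ]; linarith
    have h3 : x / |ν.im| * ‖besselInt 0 ν x‖ ^ 2 ≤ 1 / 2 * ‖besselInt 0 ν x‖ ^ 2 := by gcongr
    constructor <;> linarith [h1.1, h1.2]
  have hdec : ∀ x, u ≤ x → x ≤ Y → e x ≤ e u * (u / x) ^ (2 / 3 : ℝ) := fun x h1 h2 =>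
    besselTail_le_mul_rpow hν hne hu h1 h2
  have hA : ‖Y * orderWronskian ν Y‖ ≤ (2 + 8 * Y) * e Y := by
    refine (norm_mul_orderWronskian_le_besselTail hν hne hY0).trans ?_
    have e1 : 2 * ν.im ^ 2 / Y = 8 * Y := by
      rw [← sq_abs, show |ν.im| = 2 * Y by rw [hY]; ring]
      field_simp; norm_num
    rw [e1]
    linarith [(hNe Y hY0 le_rfl).1]
  have hB := norm_le_norm_add_of_norm_deriv_le huY
    (f := fun x : ℝ => x * orderWronskian ν x)
    -- A primitive, up to sign, of the bound `2|B|² ≤ 4 e(x) ≤ 4 e(u) (u/x)^(2/3)`.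
    (g := fun x => -(12 * e u * u ^ (2 / 3 : ℝ)) * x ^ (1 / 3 : ℝ))
    (g' := fun x => -(12 * e u * u ^ (2 / 3 : ℝ)) * (1 / 3 * x ^ (1 / 3 - 1 : ℝ)))
    (fun x hx => hasDerivAt_mul_orderWronskian ν (hu.trans_le hx.1))
    (fun x hx => (Real.hasDerivAt_rpow_const (Or.inl (hu.trans_le hx.1).ne')).const_mul _)
    (fun x hx => ?_)
  · have h1 := hdec Y huY le_rfl
    have hYe : e Y ≤ e u := h1.trans (mul_le_of_le_one_right (hepos hu).le
      (Real.rpow_le_one (by positivity) ((div_le_one hY0).2 huY) (by norm_num)))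
    have h2 : Y * e Y ≤ e u * u ^ (2 / 3 : ℝ) * Y ^ (1 / 3 : ℝ) := by
      have e2 : Y * (e u * (u / Y) ^ (2 / 3 : ℝ)) = e u * u ^ (2 / 3 : ℝ) * Y ^ (1 / 3 : ℝ) := by
        rw [Real.div_rpow hu.le hY0.le, show (1 / 3 : ℝ) = 1 - 2 / 3 by norm_num,
          Real.rpow_sub hY0, Real.rpow_one]
        field_simp
      rw [← e2]; gcongr
    have h3 : Y ^ (1 / 3 : ℝ) ≤ |ν.im| ^ (1 / 3 : ℝ) := by
      apply Real.rpow_le_rpow hY0.le _ (by norm_num)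
      rw [hY]; linarith
    have h4 := (hNe u hu huY).2
    have h5 : 0 ≤ 12 * e u * u ^ (2 / 3 : ℝ) * u ^ (1 / 3 : ℝ) := by
      have := hepos hu; positivity
    have h6 : e u * u ^ (2 / 3 : ℝ) * Y ^ (1 / 3 : ℝ) ≤
        3 / 2 * ‖besselInt 0 ν u‖ ^ 2 * u ^ (2 / 3 : ℝ) * |ν.im| ^ (1 / 3 : ℝ) := by
      gcongr
    nlinarith [hB, hA, h2, hYe, h4, h5, h6]
  · have hx0 : 0 < x := hu.trans_le hx.1
    rw [besselInt_sub_one_of_re_eq hν, Complex.mul_conj, Complex.normSq_eq_norm_sq, norm_mul,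
      Complex.norm_real, Complex.norm_ofNat, Real.norm_of_nonneg (sq_nonneg _)]
    have h1 := (hNe x hx0 hx.2).1
    have h2 := hdec x hx.1 hx.2
    have e2 : e u * (u / x) ^ (2 / 3 : ℝ) = e u * u ^ (2 / 3 : ℝ) * x ^ (1 / 3 - 1 : ℝ) := by
      rw [Real.div_rpow hu.le hx0.le, show (1 / 3 - 1 : ℝ) = -(2 / 3) by norm_num,
        Real.rpow_neg hx0.le]
      ring
    rw [e2] at h2
    linarith

theorem norm_deriv_besselRatio_le {u : ℝ} (hu : 0 < u) {ν : ℂ} (hν : ν.re = 1 / 2)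
    (him : 2 * u ≤ |ν.im|) :
    ‖deriv (besselRatio u) ν‖ ≤ 3 + 30 * u ^ (2 / 3 : ℝ) * |ν.im| ^ (1 / 3 : ℝ) := by
  have hre : 0 < ν.re := by rw [hν]; norm_num
  have hB := besselInt_ne_zero hre hu
  rw [(hasDerivAt_besselRatio hu hre).deriv, norm_div, norm_pow, div_le_iff₀ (by positivity)]
  exact norm_mul_orderWronskian_le hν hu him

open scoped FourierTransform in
/-- Plancherel's identity for functions that are both integrable and square integrable. -/
theorem eLpNorm_fourierInv_eq {f : ℝ → ℂ} (h1 : Integrable f) (h2 : MemLp f 2) :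
    eLpNorm (𝓕⁻ f) 2 volume = eLpNorm f 2 volume := by
  set g : Lp ℂ 2 (volume : Measure ℝ) := h2.toLp f with hg
  have hgf : (g : ℝ → ℂ) =ᵐ[volume] f := h2.coeFn_toLp
  have hL : Continuous fun p : ℝ × ℝ => (-innerₗ ℝ) p.1 p.2 := continuous_inner.neg
  have hcont : Continuous (𝓕⁻ f) :=
    VectorFourier.fourierIntegral_continuous Real.continuous_fourierChar hL h1
  have hdist := Lp.fourierInv_toTemperedDistribution_eq g
  -- The `L²` transform and the integral transform coincide almost everywhere, because they have the
  -- same integrals against test functions: the transform is passed on to the test function in both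
  -- cases.
  have hae : ((𝓕⁻ g : Lp ℂ 2 (volume : Measure ℝ)) : ℝ → ℂ) =ᵐ[volume] 𝓕⁻ f := by
    refine ae_eq_of_integral_contDiff_smul_eq
      ((Lp.memLp (𝓕⁻ g)).locallyIntegrable (by norm_num)) hcont.locallyIntegrable ?_
    intro φ hφ hφc
    have hc : HasCompactSupport (fun x => (φ x : ℂ)) := hφc.comp_left (g := Complex.ofReal) rfl
    have hs : ContDiff ℝ ((⊤ : ℕ∞) : WithTop ℕ∞) (fun x => (φ x : ℂ)) := Complex.ofRealCLM.contDiff.comp hφ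
    let ψ : SchwartzMap ℝ ℂ := hc.toSchwartzMap hs
    have h3 := congrArg (fun T : TemperedDistribution ℝ ℂ => T ψ) hdist
    simp only [TemperedDistribution.fourierInv_apply, Lp.toTemperedDistribution_apply] at h3
    have h4 : ∫ x, (𝓕⁻ ψ) x • f x = ∫ x, ψ x • (𝓕⁻ f) x := by
      have h := VectorFourier.integral_fourierIntegral_smul_eq_flip (L := -innerₗ ℝ)
        Real.continuous_fourierChar hL (ψ.integrable (μ := volume)) h1
      rw [show (-innerₗ ℝ).flip = -innerₗ ℝ by ext; simp] at h
      simp only [SchwartzMap.fourierInv_coe]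
      exact h
    have h5 : ∫ x, (𝓕⁻ ψ) x • g x = ∫ x, (𝓕⁻ ψ) x • f x := by
      refine integral_congr_ae ?_
      filter_upwards [hgf] with x hx
      rw [hx]
    exact (h3.symm.trans h5).trans h4
  rw [← eLpNorm_congr_ae hae, ← eLpNorm_congr_ae hgf]
  have h5 : ‖𝓕⁻ g‖ = ‖g‖ := (Lp.fourierTransformₗᵢ ℝ ℂ).symm.norm_map g
  rw [Lp.norm_def, Lp.norm_def] at h5
  exact (ENNReal.toReal_eq_toReal_iff' (Lp.eLpNorm_ne_top _) (Lp.eLpNorm_ne_top _)).1 h5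

/-! ### Inversion of Laplace transforms on the closed right half plane -/

/-- The integral of `G(s) exp (s y)` over the segment `|Im s| ≤ T` of the line `Re s = σ`. -/
noncomputable def segmentIntegral (G : ℂ → ℂ) (y σ T : ℝ) : ℂ :=
  ∫ τ in (-T)..T, G (σ + τ * Complex.I) * Complex.exp ((σ + τ * Complex.I) * y)

/-- The inverse Laplace transform of `G`, as an integral over the line `Re s = 1`. -/
noncomputable def inverseLaplace (G : ℂ → ℂ) (y : ℝ) : ℂ :=
  (1 / (2 * Real.pi) : ℂ) *
    ∫ τ : ℝ, G (1 + τ * Complex.I) * Complex.exp ((1 + τ * Complex.I) * y)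

/-- Bounds on a function on the right half plane that make it the Laplace transform of an
integrable function. -/
structure LaplaceSymbol (G : ℂ → ℂ) (C : ℝ) : Prop where
  differentiableAt : ∀ s : ℂ, 0 ≤ s.re → DifferentiableAt ℂ G s
  norm_le : ∀ s : ℂ, 0 ≤ s.re → ‖G s‖ ≤ C / (1 + ‖s‖)
  norm_le_sq : ∀ s : ℂ, 1 ≤ s.re → ‖G s‖ ≤ C / (1 + ‖s‖) ^ 2
  norm_deriv_le : ∀ τ : ℝ, ‖deriv G (τ * Complex.I)‖ ≤ C * (1 + |τ|) ^ (-(2 / 3) : ℝ)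

theorem abs_le_norm_add_mul_I (σ τ : ℝ) : |τ| ≤ ‖(σ : ℂ) + τ * Complex.I‖ := by
  simpa using Complex.abs_im_le_norm ((σ : ℂ) + τ * Complex.I)

theorem re_add_mul_I (σ τ : ℝ) : ((σ : ℂ) + τ * Complex.I).re = σ := by simp

theorem norm_exp_add_mul_I (σ τ y : ℝ) :
    ‖Complex.exp ((σ + τ * Complex.I) * y)‖ = Real.exp (σ * y) := by
  rw [Complex.norm_exp]; simp

theorem hasDerivAt_ofReal_mul_I (τ : ℝ) :
    HasDerivAt (fun τ : ℝ => (τ : ℂ) * Complex.I) Complex.I τ := by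
  simpa using! (Complex.ofRealCLM.hasDerivAt (x := τ)).mul_const Complex.I

theorem integrable_one_add_abs_rpow {p : ℝ} (hp : 1 < p) :
    Integrable fun τ : ℝ => (1 + |τ|) ^ (-p) := by
  have h := integrable_one_add_norm (E := ℝ) (μ := volume) (r := p) (by simpa using hp)
  simpa using h

namespace LaplaceSymbol

variable {G : ℂ → ℂ} {C : ℝ}

theorem nonneg (hG : LaplaceSymbol G C) : 0 ≤ C := by
  have := (norm_nonneg _).trans (hG.norm_le 0 le_rfl)
  simpa using this

theorem continuous_line (hG : LaplaceSymbol G C) {σ : ℝ} (hσ : 0 ≤ σ) :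
    Continuous fun τ : ℝ => G (σ + τ * Complex.I) :=
  continuous_iff_continuousAt.2 fun τ =>
    (hG.differentiableAt _ (by simpa using hσ)).continuousAt.comp
      (f := fun τ : ℝ => (σ : ℂ) + τ * Complex.I) (by fun_prop)

/-- Cauchy's theorem on the rectangle between the two segments. The difference is made up of the
horizontal sides, where `G` is at most `C/(1 + T)`. -/
theorem norm_segmentIntegral_sub_le (hG : LaplaceSymbol G C) {σ σ' T : ℝ} (hσ : 0 ≤ σ)
    (hσ' : σ ≤ σ') (hT : 0 ≤ T) (y : ℝ) :
    ‖segmentIntegral G y σ T - segmentIntegral G y σ' T‖ ≤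
      2 * (C / (1 + T) * Real.exp (σ' * |y|) * (σ' - σ)) := by
  have key := Complex.integral_boundary_rect_eq_zero_of_differentiableOn
    (fun s => G s * Complex.exp (s * y)) (σ + (-T : ℝ) * Complex.I) (σ' + T * Complex.I) ?_
  · simp only [Complex.add_re, Complex.add_im, Complex.mul_re, Complex.mul_im, Complex.ofReal_re,
      Complex.ofReal_im, Complex.I_re, Complex.I_im, mul_zero, mul_one, sub_zero, add_zero,
      zero_add] at key
    have hor : ∀ T' : ℝ, |T'| = T → ‖∫ x in σ..σ', G (x + T' * Complex.I) *
        Complex.exp ((x + T' * Complex.I) * y)‖ ≤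
        C / (1 + T) * Real.exp (σ' * |y|) * (σ' - σ) := by
      intro T' hT'
      rw [← abs_of_nonneg (sub_nonneg.2 hσ')]
      refine intervalIntegral.norm_integral_le_of_norm_le_const fun x hx => ?_
      rw [Set.uIoc_of_le hσ'] at hx
      have hx0 : 0 ≤ x := hσ.trans hx.1.le
      rw [norm_mul, norm_exp_add_mul_I]
      have hC := hG.nonneg
      refine mul_le_mul ((hG.norm_le _ (by simpa using hx0)).trans ?_) ?_ (by positivity)
        (by positivity)
      · gcongr
        rw [← hT']; exact abs_le_norm_add_mul_I x T'
      · refine Real.exp_le_exp.2 ((mul_le_mul_of_nonneg_left (le_abs_self y) hx0).trans ?_)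
        exact mul_le_mul_of_nonneg_right hx.2 (abs_nonneg y)
    have h1 := hor (-T) (by rw [abs_neg, abs_of_nonneg hT])
    have h2 := hor T (abs_of_nonneg hT)
    have e : Complex.I * (segmentIntegral G y σ T - segmentIntegral G y σ' T) =
        (∫ x in σ..σ', G (x + (-T : ℝ) * Complex.I) *
          Complex.exp ((x + (-T : ℝ) * Complex.I) * y)) -
        ∫ x in σ..σ', G (x + T * Complex.I) * Complex.exp ((x + T * Complex.I) * y) := by
      simp only [segmentIntegral, smul_eq_mul] at key ⊢
      linear_combination -key
    have h3 := congrArg norm e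
    rw [norm_mul, Complex.norm_I, one_mul] at h3
    rw [h3]
    refine (norm_sub_le _ _).trans ?_
    linarith
  · intro s hs
    have hs' : σ ≤ s.re := by
      have := hs.1
      simp only [Set.mem_preimage, Complex.add_re, Complex.mul_re, Complex.ofReal_re,
        Complex.ofReal_im, Complex.I_re, Complex.I_im, mul_zero, sub_zero, add_zero,
        mul_one] at this
      rw [Set.uIcc_of_le hσ'] at this
      exact this.1
    exact ((hG.differentiableAt s (hσ.trans hs')).mul (by fun_prop)).differentiableWithinAt

theorem integrable_line (hG : LaplaceSymbol G C) {σ : ℝ} (hσ : 1 ≤ σ) (y : ℝ) :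
    Integrable fun τ : ℝ => G (σ + τ * Complex.I) * Complex.exp ((σ + τ * Complex.I) * y) := by
  refine ((integrable_one_add_abs_rpow (p := 2) (by norm_num)).const_mul
    (C * Real.exp (σ * y))).mono' ?_ (ae_of_all _ fun τ => ?_)
  · exact ((hG.continuous_line (zero_le_one.trans hσ)).mul (by fun_prop)).aestronglyMeasurable
  · have hC := hG.nonneg
    rw [norm_mul, norm_exp_add_mul_I, mul_right_comm]
    gcongr
    refine (hG.norm_le_sq _ (by simpa using hσ)).trans ?_
    rw [Real.rpow_neg (by positivity), ← div_eq_mul_inv, Real.rpow_two]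
    gcongr
    exact abs_le_norm_add_mul_I σ τ

theorem tendsto_segmentIntegral_one (hG : LaplaceSymbol G C) (y : ℝ) :
    Tendsto (segmentIntegral G y 1) atTop (𝓝 (2 * Real.pi * inverseLaplace G y)) := by
  have h := intervalIntegral_tendsto_integral (hG.integrable_line le_rfl y) tendsto_neg_atTop_atBot
    tendsto_id
  have e : 2 * Real.pi * inverseLaplace G y =
      ∫ τ : ℝ, G ((1 : ℝ) + τ * Complex.I) * Complex.exp (((1 : ℝ) + τ * Complex.I) * y) := by
    rw [inverseLaplace, ← mul_assoc, mul_one_div_cancel (by simp [Real.pi_ne_zero]), one_mul,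
      Complex.ofReal_one]
  rw [e]
  exact h

/-- The symmetric integrals have the same limit on every line `Re s = σ ≥ 0`. Absolute convergence
is available only for `σ ≥ 1`; to the left the limit is inherited by shifting the line. -/
theorem tendsto_segmentIntegral (hG : LaplaceSymbol G C) {σ : ℝ} (hσ : 0 ≤ σ) (y : ℝ) :
    Tendsto (segmentIntegral G y σ) atTop (𝓝 (2 * Real.pi * inverseLaplace G y)) := by
  have hdiff : ∀ {σ σ' : ℝ}, 0 ≤ σ → σ ≤ σ' → Tendsto
      (fun T => segmentIntegral G y σ T - segmentIntegral G y σ' T) atTop (𝓝 0) := by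
    intro σ σ' h0 h1
    have h : Tendsto (fun T : ℝ => 2 * (C / (1 + T) * Real.exp (σ' * |y|) * (σ' - σ))) atTop
        (𝓝 (2 * (0 * Real.exp (σ' * |y|) * (σ' - σ)))) :=
      (((tendsto_atTop_add_const_left _ _ tendsto_id).const_div_atTop C).mul_const _
        |>.mul_const _).const_mul 2
    rw [zero_mul, zero_mul, mul_zero] at h
    refine squeeze_zero_norm' ?_ h
    filter_upwards [eventually_ge_atTop 0] with T hT
    exact hG.norm_segmentIntegral_sub_le h0 h1 hT y
  rcases le_total σ 1 with h | h
  · simpa using (hdiff hσ h).add (hG.tendsto_segmentIntegral_one y)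
  · simpa using (hG.tendsto_segmentIntegral_one y).sub (hdiff zero_le_one h)

/-- The line is moved to `Re s → ∞`, where the factor `exp (σ y)` tends to `0` for negative `y`
while the remaining integral is bounded independently of `σ`. -/
theorem inverseLaplace_eq_zero (hG : LaplaceSymbol G C) {y : ℝ} (hy : y < 0) :
    inverseLaplace G y = 0 := by
  have hC := hG.nonneg
  have hb : ∀ σ : ℝ, 1 ≤ σ → ‖2 * Real.pi * inverseLaplace G y‖ ≤
      Real.exp (σ * y) * ∫ τ : ℝ, C * (1 + |τ|) ^ (-(2 : ℝ)) := by
    intro σ hσ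
    have h1 := intervalIntegral_tendsto_integral (hG.integrable_line hσ y)
      tendsto_neg_atTop_atBot tendsto_id
    rw [tendsto_nhds_unique (hG.tendsto_segmentIntegral (zero_le_one.trans hσ) y) h1,
      ← integral_const_mul]
    refine norm_integral_le_of_norm_le (((integrable_one_add_abs_rpow (p := 2)
      (by norm_num)).const_mul C).const_mul _) (ae_of_all _ fun τ => ?_)
    rw [norm_mul, norm_exp_add_mul_I, mul_comm]
    gcongr
    refine (hG.norm_le_sq _ (by simpa using hσ)).trans ?_
    rw [Real.rpow_neg (by positivity), ← div_eq_mul_inv, Real.rpow_two]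
    gcongr
    exact abs_le_norm_add_mul_I σ τ
  have hlim : Tendsto (fun σ : ℝ => Real.exp (σ * y) * ∫ τ : ℝ, C * (1 + |τ|) ^ (-(2 : ℝ))) atTop
      (𝓝 (0 * ∫ τ : ℝ, C * (1 + |τ|) ^ (-(2 : ℝ)))) :=
    (Real.tendsto_exp_atBot.comp (tendsto_id.atTop_mul_const_of_neg hy)).mul_const _
  rw [zero_mul] at hlim
  have h0 : ‖2 * Real.pi * inverseLaplace G y‖ ≤ 0 :=
    ge_of_tendsto hlim ((eventually_ge_atTop 1).mono fun σ hσ => hb σ hσ)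
  have h1 := norm_le_zero_iff.1 h0
  have h2 : (2 * Real.pi : ℂ) ≠ 0 := by simp [Real.pi_ne_zero]
  exact (mul_eq_zero.1 h1).resolve_left h2

open scoped FourierTransform in
theorem fourierInv_line (G : ℂ → ℂ) (y : ℝ) :
    𝓕⁻ (fun v : ℝ => G (1 + (2 * Real.pi * v : ℝ) * Complex.I)) y =
      Complex.exp (-y) * inverseLaplace G y := by
  have h := Measure.integral_comp_mul_left (fun τ : ℝ => G (1 + τ * Complex.I) *
    Complex.exp ((1 + τ * Complex.I) * y)) (2 * Real.pi)
  rw [abs_of_pos (by positivity)] at h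
  rw [Real.fourierInv_eq', inverseLaplace]
  have e : (1 / (2 * Real.pi) : ℂ) * ∫ τ : ℝ, G (1 + τ * Complex.I) *
      Complex.exp ((1 + τ * Complex.I) * y) = ∫ v : ℝ, G (1 + (2 * Real.pi * v : ℝ) * Complex.I) *
      Complex.exp ((1 + (2 * Real.pi * v : ℝ) * Complex.I) * y) := by
    rw [h, Complex.real_smul]; push_cast; ring
  rw [e, ← integral_const_mul]
  congr 1; ext v
  rw [mul_left_comm, ← Complex.exp_add, smul_eq_mul, mul_comm (Complex.exp _)]
  congr 2
  simp only [RCLike.inner_apply, conj_trivial]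
  push_cast; ring

theorem integrable_fourierInv_arg (hG : LaplaceSymbol G C) :
    Integrable (fun v : ℝ => G (1 + (2 * Real.pi * v : ℝ) * Complex.I)) := by
  have h := hG.integrable_line le_rfl 0
  simp only [Complex.ofReal_zero, mul_zero, Complex.exp_zero, mul_one, Complex.ofReal_one] at h
  exact h.comp_mul_left' (by positivity)

theorem continuous_inverseLaplace (hG : LaplaceSymbol G C) : Continuous (inverseLaplace G) := by
  have hL : Continuous fun p : ℝ × ℝ => (-innerₗ ℝ) p.1 p.2 := continuous_inner.neg
  have h := VectorFourier.fourierIntegral_continuous Real.continuous_fourierChar hL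
    hG.integrable_fourierInv_arg
  have e : inverseLaplace G = fun y : ℝ => Complex.exp y *
      VectorFourier.fourierIntegral Real.fourierChar volume (-innerₗ ℝ)
        (fun v : ℝ => G (1 + (2 * Real.pi * v : ℝ) * Complex.I)) y := by
    ext y
    have := fourierInv_line G y
    have h2 : VectorFourier.fourierIntegral Real.fourierChar volume (-innerₗ ℝ)
        (fun v : ℝ => G (1 + (2 * Real.pi * v : ℝ) * Complex.I)) y = _ := this
    rw [h2, ← mul_assoc, ← Complex.exp_add]
    simp
  rw [e]
  exact (by fun_prop : Continuous fun y : ℝ => Complex.exp y).mul h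

end LaplaceSymbol

/-! ### Integrability of the inverse transform, and the inversion formula -/

namespace LaplaceSymbol

variable {G : ℂ → ℂ} {C : ℝ}

theorem intervalIntegrable_deriv (hG : LaplaceSymbol G C) (a b y : ℝ) : IntervalIntegrable
    (fun τ : ℝ => deriv G (τ * Complex.I) * Complex.exp (τ * Complex.I * y)) volume a b := by
  refine (intervalIntegrable_const (c := C)).mono_fun ?_ (ae_of_all _ fun τ => ?_)
  · exact (((measurable_deriv G).comp (by fun_prop)).mul
      (by fun_prop)).aestronglyMeasurable
  · have hC := hG.nonneg
    have h2 : ‖Complex.exp (τ * Complex.I * y)‖ = 1 := by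
      rw [Complex.norm_exp]; simp
    simp only [norm_mul, h2, mul_one, Real.norm_of_nonneg hC]
    refine (hG.norm_deriv_le τ).trans (mul_le_of_le_one_right hC ?_)
    exact Real.rpow_le_one_of_one_le_of_nonpos (by linarith [abs_nonneg τ]) (by norm_num)

/-- Integration by parts on the imaginary axis: a factor `y` is traded for a derivative of the
symbol. -/
theorem mul_segmentIntegral_zero (hG : LaplaceSymbol G C) (y T : ℝ) :
    Complex.I * y * segmentIntegral G y 0 T =
      G (T * Complex.I) * Complex.exp (T * Complex.I * y) -
        G ((-T : ℝ) * Complex.I) * Complex.exp ((-T : ℝ) * Complex.I * y) -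
      Complex.I * ∫ τ in (-T)..T, deriv G (τ * Complex.I) * Complex.exp (τ * Complex.I * y) := by
  have hcont : Continuous fun τ : ℝ => G (τ * Complex.I) * Complex.exp (τ * Complex.I * y) := by
    have := hG.continuous_line (σ := 0) le_rfl
    simp only [Complex.ofReal_zero, zero_add] at this
    exact this.mul (by fun_prop)
  have h := intervalIntegral.integral_eq_sub_of_hasDerivAt (a := -T) (b := T)
    (f := fun τ : ℝ => G (τ * Complex.I) * Complex.exp (τ * Complex.I * y))
    (f' := fun τ : ℝ => Complex.I * (deriv G (τ * Complex.I) * Complex.exp (τ * Complex.I * y)) +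
      Complex.I * y * (G (τ * Complex.I) * Complex.exp (τ * Complex.I * y))) ?_ ?_
  · rw [intervalIntegral.integral_add ((hG.intervalIntegrable_deriv _ _ y).const_mul _)
      ((hcont.intervalIntegrable _ _).const_mul _), intervalIntegral.integral_const_mul,
      intervalIntegral.integral_const_mul] at h
    simp only [segmentIntegral, Complex.ofReal_zero, zero_add]
    linear_combination h
  · intro τ _
    have h1 := hasDerivAt_ofReal_mul_I τ
    have h2 : HasDerivAt (fun τ : ℝ => G (τ * Complex.I)) (deriv G (τ * Complex.I) * Complex.I) τ :=
      (hG.differentiableAt (τ * Complex.I) (by simp)).hasDerivAt.comp (h := fun τ : ℝ =>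
        (τ : ℂ) * Complex.I) τ h1
    refine (h2.mul (h1.mul_const (y : ℂ)).cexp).congr_deriv ?_
    ring
  · exact ((hG.intervalIntegrable_deriv _ _ y).const_mul _).add
      ((hcont.intervalIntegrable _ _).const_mul _)

/-- The derivative of the symbol on the imaginary axis, cut off at frequency `n`. -/
noncomputable def cutoffDeriv (G : ℂ → ℂ) (n : ℕ) : ℝ → ℂ :=
  Set.indicator (Set.Ioc (-(n : ℝ)) n) fun v => -deriv G ((2 * Real.pi * v : ℝ) * Complex.I)

theorem norm_cutoffDeriv_le (hG : LaplaceSymbol G C) (n : ℕ) (v : ℝ) :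
    ‖cutoffDeriv G n v‖ ≤ C * (1 + |v|) ^ (-(2 / 3) : ℝ) := by
  have hC := hG.nonneg
  rw [cutoffDeriv]
  refine (norm_indicator_le_norm_self _ _).trans ?_
  rw [norm_neg]
  refine (hG.norm_deriv_le _).trans ?_
  refine mul_le_mul_of_nonneg_left (Real.rpow_le_rpow_of_nonpos (by positivity) ?_ (by norm_num)) hC
  rw [abs_mul, abs_of_pos (by positivity : 0 < 2 * Real.pi)]
  nlinarith [Real.pi_gt_three, abs_nonneg v]

theorem aestronglyMeasurable_cutoffDeriv (G : ℂ → ℂ) (n : ℕ) :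
    AEStronglyMeasurable (cutoffDeriv G n) volume :=
  ((((measurable_deriv G).comp (by fun_prop)).neg).indicator
    measurableSet_Ioc).aestronglyMeasurable

theorem integrable_cutoffDeriv (hG : LaplaceSymbol G C) (n : ℕ) :
    Integrable (cutoffDeriv G n) := by
  refine (integrable_indicator_iff measurableSet_Ioc).2 ?_
  have hc : IntegrableOn (fun _ : ℝ => C) (Set.Ioc (-(n : ℝ)) n) := by
    simp [integrableOn_const_iff]
  refine hc.mono' (((measurable_deriv G).comp (by fun_prop)).neg).aestronglyMeasurable
    (ae_of_all _ fun v => ?_)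
  rw [norm_neg]
  refine (hG.norm_deriv_le _).trans (mul_le_of_le_one_right hG.nonneg ?_)
  exact Real.rpow_le_one_of_one_le_of_nonpos
    (by linarith [abs_nonneg (2 * Real.pi * v)]) (by norm_num)

theorem memLp_majorant (C : ℝ) : MemLp (fun v : ℝ => C * (1 + |v|) ^ (-(2 / 3) : ℝ)) 2 := by
  have hm : AEStronglyMeasurable (fun v : ℝ => C * (1 + |v|) ^ (-(2 / 3) : ℝ)) volume := by
    exact (by fun_prop : Measurable fun v : ℝ => C * (1 + |v|) ^ (-(2 / 3) : ℝ)).aestronglyMeasurable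
  rw [memLp_two_iff_integrable_sq hm]
  have h := (integrable_one_add_abs_rpow (p := 4 / 3) (by norm_num)).const_mul (C ^ 2)
  refine h.congr (ae_of_all _ fun v => ?_)
  simp only
  rw [mul_pow, ← Real.rpow_natCast, ← Real.rpow_natCast ((1 + |v|) ^ _),
    ← Real.rpow_mul (by positivity)]
  norm_num

open scoped FourierTransform in
-- In the integration by parts at height `T = 2πn` the boundary terms are at most `C/(1 + T)`, and
-- the segment integrals on `Re s = 0` converge. The cut-off is needed because the derivative of the
-- symbol is square integrable but need not be integrable.
theorem tendsto_fourierInv_cutoffDeriv (hG : LaplaceSymbol G C) (y : ℝ) :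
    Tendsto (fun n : ℕ => 𝓕⁻ (cutoffDeriv G n) y) atTop (𝓝 (y * inverseLaplace G y)) := by
  have hT : Tendsto (fun n : ℕ => 2 * Real.pi * (n : ℝ)) atTop atTop :=
    tendsto_natCast_atTop_atTop.const_mul_atTop (by positivity)
  have hb : ∀ ε : ℝ, |ε| = 1 → Tendsto (fun n : ℕ => G ((ε * (2 * Real.pi * n) : ℝ) * Complex.I) *
      Complex.exp ((ε * (2 * Real.pi * n) : ℝ) * Complex.I * y)) atTop (𝓝 0) := by
    intro ε hε
    have h : Tendsto (fun n : ℕ => C / (1 + 2 * Real.pi * n)) atTop (𝓝 0) :=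
      (tendsto_atTop_add_const_left _ _ hT).const_div_atTop C
    refine squeeze_zero_norm (fun n => ?_) h
    have h2 : ‖Complex.exp ((ε * (2 * Real.pi * n) : ℝ) * Complex.I * y)‖ = 1 := by
      rw [Complex.norm_exp]; simp
    rw [norm_mul, h2, mul_one]
    refine (hG.norm_le _ (by simp)).trans (le_of_eq ?_)
    rw [norm_mul, Complex.norm_I, mul_one, Complex.norm_real, Real.norm_eq_abs, abs_mul, hε,
      one_mul, abs_of_nonneg (by positivity)]
  have h1 := (((hG.tendsto_segmentIntegral le_rfl y).comp hT).const_mul (Complex.I * y)).sub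
    ((hb 1 (by simp)).sub (hb (-1) (by simp)))
  have h2 := h1.const_mul (1 / (2 * Real.pi * Complex.I))
  have e : 1 / (2 * Real.pi * Complex.I) * (Complex.I * y *
      (2 * Real.pi * inverseLaplace G y) - (0 - 0)) = y * inverseLaplace G y := by
    have : (Real.pi : ℂ) ≠ 0 := by simp [Real.pi_ne_zero]
    field_simp [Complex.I_ne_zero]
    ring
  rw [e] at h2
  refine h2.congr fun n => ?_
  have h3 := hG.mul_segmentIntegral_zero y (2 * Real.pi * n)
  have h4 := intervalIntegral.integral_comp_mul_left (a := -(n : ℝ)) (b := n) (c := 2 * Real.pi)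
    (fun τ : ℝ => deriv G (τ * Complex.I) * Complex.exp (τ * Complex.I * y)) (by positivity)
  have h5 : 𝓕⁻ (cutoffDeriv G n) y = -∫ v in (-(n : ℝ))..n,
      deriv G ((2 * Real.pi * v : ℝ) * Complex.I) *
        Complex.exp ((2 * Real.pi * v : ℝ) * Complex.I * y) := by
    rw [Real.fourierInv_eq', intervalIntegral.integral_of_le (by linarith [n.cast_nonneg (α := ℝ)]),
      ← integral_indicator measurableSet_Ioc, ← integral_neg]
    congr 1; ext v
    rw [cutoffDeriv]
    by_cases hv : v ∈ Set.Ioc (-(n : ℝ)) n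
    · rw [Set.indicator_of_mem hv, Set.indicator_of_mem hv, smul_eq_mul, mul_neg, mul_comm]
      congr 3
      simp only [RCLike.inner_apply, conj_trivial]
      push_cast; ring
    · rw [Set.indicator_of_notMem hv, Set.indicator_of_notMem hv]; simp
  rw [h5, h4, Complex.real_smul]
  simp only [Function.comp, one_mul, neg_one_mul] at h3 ⊢
  rw [h3, show 2 * Real.pi * -(n : ℝ) = -(2 * Real.pi * n) by ring]
  have : (Real.pi : ℂ) ≠ 0 := by simp [Real.pi_ne_zero]
  push_cast
  field_simp [Complex.I_ne_zero]
  ring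

open scoped FourierTransform in
-- Fatou's lemma: by Plancherel the transforms of the cut-off derivatives have `L²` norms bounded by
-- that of the majorant, and they converge pointwise.
theorem memLp_mul_inverseLaplace (hG : LaplaceSymbol G C) :
    MemLp (fun y : ℝ => (y : ℂ) * inverseLaplace G y) 2 := by
  have hcont : Continuous fun y : ℝ => (y : ℂ) * inverseLaplace G y :=
    (by fun_prop : Continuous fun y : ℝ => (y : ℂ)).mul hG.continuous_inverseLaplace
  refine ⟨hcont.aestronglyMeasurable, ?_⟩
  have hL : Continuous fun p : ℝ × ℝ => (-innerₗ ℝ) p.1 p.2 := continuous_inner.neg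
  have hmem : ∀ n, MemLp (cutoffDeriv G n) 2 := fun n =>
    (memLp_majorant C).mono' (aestronglyMeasurable_cutoffDeriv G n)
      (ae_of_all _ (hG.norm_cutoffDeriv_le n))
  have h1 := Lp.eLpNorm_lim_le_liminf_eLpNorm (p := 2) (μ := volume)
    (f := fun n => 𝓕⁻ (cutoffDeriv G n))
    (fun n => (VectorFourier.fourierIntegral_continuous Real.continuous_fourierChar hL
      (hG.integrable_cutoffDeriv n)).aestronglyMeasurable)
    (fun y : ℝ => (y : ℂ) * inverseLaplace G y)
    (ae_of_all _ fun y => hG.tendsto_fourierInv_cutoffDeriv y)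
  refine (h1.trans ?_).trans_lt (memLp_majorant C).2
  refine liminf_le_of_le (by isBoundedDefault) fun b hb => ?_
  obtain ⟨n, hn⟩ := hb.exists
  rw [eLpNorm_fourierInv_eq (hG.integrable_cutoffDeriv n) (hmem n)] at hn
  exact hn.trans (eLpNorm_mono_real (hG.norm_cutoffDeriv_le n))

/-- Continuity settles `|y| ≤ 1`. For `|y| ≥ 1` one uses `2|h| ≤ |y h|² + |y|⁻²`, both terms of
which are integrable there. -/
theorem integrable_inverseLaplace (hG : LaplaceSymbol G C) : Integrable (inverseLaplace G) := by
  have hcont := hG.continuous_inverseLaplace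
  have h1 : IntegrableOn (inverseLaplace G) (Set.Icc (-1) 1) :=
    hcont.continuousOn.integrableOn_compact isCompact_Icc
  have h2 : IntegrableOn (inverseLaplace G) (Set.Icc (-1) 1)ᶜ := by
    have hsq := (memLp_two_iff_integrable_sq_norm hG.memLp_mul_inverseLaplace.1).1
      hG.memLp_mul_inverseLaplace
    have hm := (hsq.add ((integrable_one_add_abs_rpow (p := 2) (by norm_num)).const_mul 4))
    refine hm.integrableOn.mono' hcont.aestronglyMeasurable ?_
    refine (ae_restrict_iff' measurableSet_Icc.compl).2 (ae_of_all _ fun y hy => ?_)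
    have hy1 : 1 ≤ |y| := by
      by_contra h
      exact hy (abs_le.1 (not_le.1 h).le)
    have e : ‖(y : ℂ) * inverseLaplace G y‖ = |y| * ‖inverseLaplace G y‖ := by
      rw [norm_mul, Complex.norm_real, Real.norm_eq_abs]
    simp only [Pi.add_apply]
    rw [e, Real.rpow_neg (by positivity), Real.rpow_two]
    set a := ‖inverseLaplace G y‖
    have h3 : (1 + |y|) ^ 2 ≤ 4 * |y| ^ 2 := by nlinarith
    have h4 : (|y| ^ 2)⁻¹ ≤ 4 * ((1 + |y|) ^ 2)⁻¹ := by
      rw [inv_le_iff_one_le_mul₀ (by positivity), mul_right_comm, ← div_eq_mul_inv,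
        le_div_iff₀ (by positivity)]
      linarith
    have h5 : a ≤ (|y| * a) ^ 2 + (|y| ^ 2)⁻¹ := by
      have h6 : 0 ≤ (|y| * a - |y|⁻¹) ^ 2 := sq_nonneg _
      have h7 : (|y| * a - |y|⁻¹) ^ 2 = (|y| * a) ^ 2 + (|y| ^ 2)⁻¹ - 2 * a := by
        field_simp
        ring
      have h8 : 0 ≤ a := norm_nonneg _
      linarith
    linarith
  have := h1.union h2
  rwa [Set.union_compl_self, integrableOn_univ] at this

theorem inverseLaplace_eq_zero_of_nonpos (hG : LaplaceSymbol G C) {y : ℝ} (hy : y ≤ 0) :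
    inverseLaplace G y = 0 := by
  rcases hy.lt_or_eq with h | rfl
  · exact hG.inverseLaplace_eq_zero h
  · have h1 : Tendsto (inverseLaplace G) (𝓝[<] 0) (𝓝 (inverseLaplace G 0)) :=
      (hG.continuous_inverseLaplace.tendsto 0).mono_left nhdsWithin_le_nhds
    have h2 : Tendsto (inverseLaplace G) (𝓝[<] 0) (𝓝 0) :=
      tendsto_const_nhds.congr' (eventually_nhdsWithin_of_forall fun y hy =>
        (hG.inverseLaplace_eq_zero hy).symm)
    exact tendsto_nhds_unique h1 h2

theorem norm_exp_neg_mul_inverseLaplace_le (hG : LaplaceSymbol G C) {s : ℂ} (hs : 0 ≤ s.re)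
    (y : ℝ) : ‖Complex.exp (-s * y) * inverseLaplace G y‖ ≤ ‖inverseLaplace G y‖ := by
  rcases le_or_gt y 0 with hy | hy
  · simp [hG.inverseLaplace_eq_zero_of_nonpos hy]
  · rw [norm_mul, Complex.norm_exp]
    refine mul_le_of_le_one_left (norm_nonneg _) (Real.exp_le_one_iff.2 ?_)
    simp only [Complex.re_mul_ofReal, Complex.neg_re]
    nlinarith

theorem integrable_exp_neg_mul_inverseLaplace (hG : LaplaceSymbol G C) {s : ℂ} (hs : 0 ≤ s.re) :
    Integrable fun y : ℝ => Complex.exp (-s * y) * inverseLaplace G y :=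
  hG.integrable_inverseLaplace.norm.mono' ((by fun_prop : Continuous fun y : ℝ =>
    Complex.exp (-s * y)).mul hG.continuous_inverseLaplace).aestronglyMeasurable
    (ae_of_all _ (hG.norm_exp_neg_mul_inverseLaplace_le hs))

open scoped FourierTransform in
-- Fourier inversion on `Re s = 1`, where both the symbol and its transform are integrable.
theorem eq_integral_of_re_eq_one (hG : LaplaceSymbol G C) (τ : ℝ) :
    G (1 + τ * Complex.I) =
      ∫ y : ℝ, Complex.exp (-(1 + τ * Complex.I) * y) * inverseLaplace G y := by
  set φ : ℝ → ℂ := fun v : ℝ => G (1 + (2 * Real.pi * v : ℝ) * Complex.I) with hφ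
  have hcont : Continuous φ := by
    have h := (hG.continuous_line zero_le_one).comp
      (by fun_prop : Continuous fun v : ℝ => 2 * Real.pi * v)
    simpa [Function.comp_def, hφ] using h
  have hF : 𝓕⁻ φ = fun y : ℝ => Complex.exp (-(1 : ℂ) * y) * inverseLaplace G y := by
    ext y
    rw [fourierInv_line G y, neg_one_mul]
  have hint : Integrable (𝓕⁻ φ) := by
    rw [hF]
    exact hG.integrable_exp_neg_mul_inverseLaplace (by simp)
  have hint' : Integrable (𝓕 φ) := by
    refine hint.comp_neg.congr (ae_of_all _ fun y => ?_)
    simp only [Real.fourierInv_eq_fourier_neg, neg_neg]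
  have h := congrFun (hcont.fourier_fourierInv_eq hG.integrable_fourierInv_arg hint')
    (τ / (2 * Real.pi))
  have e : 2 * Real.pi * (τ / (2 * Real.pi)) = τ := by
    field_simp
  rw [hφ] at h
  simp only [e] at h
  rw [← h, ← hφ, hF, Real.fourier_eq']
  congr 1; ext y
  rw [smul_eq_mul, ← mul_assoc, ← Complex.exp_add]
  congr 2
  simp only [RCLike.inner_apply, conj_trivial]
  have : (Real.pi : ℂ) ≠ 0 := by simp [Real.pi_ne_zero]
  push_cast
  field_simp
  ring

theorem continuousOn_laplace (hG : LaplaceSymbol G C) : ContinuousOn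
    (fun s : ℂ => ∫ y : ℝ, Complex.exp (-s * y) * inverseLaplace G y) {s | 0 ≤ s.re} :=
  continuousOn_of_dominated (bound := fun y => ‖inverseLaplace G y‖)
    (fun s hs => (hG.integrable_exp_neg_mul_inverseLaplace hs).aestronglyMeasurable)
    (fun s hs => ae_of_all _ (hG.norm_exp_neg_mul_inverseLaplace_le hs))
    hG.integrable_inverseLaplace.norm
    (ae_of_all _ fun y => by fun_prop)

theorem differentiableOn_laplace (hG : LaplaceSymbol G C) : DifferentiableOn ℂ
    (fun s : ℂ => ∫ y : ℝ, Complex.exp (-s * y) * inverseLaplace G y) {s | 0 < s.re} := by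
  intro s hs
  have hs' : 0 < s.re := hs
  have hnhds : {z : ℂ | s.re / 2 < z.re} ∈ 𝓝 s :=
    (isOpen_lt continuous_const Complex.continuous_re).mem_nhds (by
      simp only [Set.mem_ofPred_eq]; linarith)
  refine (hasDerivAt_integral_of_dominated_loc_of_deriv_le
    (F := fun (s : ℂ) (y : ℝ) => Complex.exp (-s * y) * inverseLaplace G y)
    (F' := fun (s : ℂ) (y : ℝ) => -y * (Complex.exp (-s * y) * inverseLaplace G y))
    (bound := fun y => 2 / s.re * ‖inverseLaplace G y‖) hnhds ?_
    (hG.integrable_exp_neg_mul_inverseLaplace hs'.le) ?_ ?_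
    (hG.integrable_inverseLaplace.norm.const_mul _) ?_).2.differentiableAt.differentiableWithinAt
  · filter_upwards [hnhds] with z hz
    refine (hG.integrable_exp_neg_mul_inverseLaplace ?_).aestronglyMeasurable
    have : s.re / 2 < z.re := hz
    linarith
  · exact ((by fun_prop : Continuous fun y : ℝ => (-y : ℂ)).mul ((by fun_prop : Continuous
      fun y : ℝ => Complex.exp (-s * y)).mul hG.continuous_inverseLaplace)).aestronglyMeasurable
  · refine ae_of_all _ fun y z hz => ?_
    have hz' : s.re / 2 < z.re := hz
    rcases le_or_gt y 0 with hy | hy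
    · simp [hG.inverseLaplace_eq_zero_of_nonpos hy]
    · rw [norm_mul, norm_mul, ← mul_assoc, norm_neg, Complex.norm_real, Real.norm_of_nonneg hy.le,
        Complex.norm_exp]
      gcongr
      simp only [Complex.re_mul_ofReal, Complex.neg_re]
      have h1 : Real.exp (-z.re * y) ≤ Real.exp (-(s.re / 2 * y)) := by
        apply Real.exp_le_exp.2; nlinarith
      have h2 := Real.add_one_le_exp (s.re / 2 * y)
      have h3 : Real.exp (-(s.re / 2 * y)) * Real.exp (s.re / 2 * y) = 1 := by
        rw [← Real.exp_add]; simp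
      rw [le_div_iff₀ hs']
      have h4 := Real.exp_pos (-(s.re / 2 * y))
      -- The inequality `x exp (-x) ≤ 1` at `x = y Re s / 2`, which bounds the factor `y` uniformly
      -- near `s`.
      have h5 : s.re / 2 * y * Real.exp (-(s.re / 2 * y)) ≤ 1 := by nlinarith
      have h6 : y * Real.exp (-z.re * y) * s.re ≤ y * Real.exp (-(s.re / 2 * y)) * s.re := by
        gcongr
      linarith
  · refine ae_of_all _ fun y z _ => ?_
    have h : HasDerivAt (fun z : ℂ => -z * (y : ℂ)) (-(y : ℂ)) z := by
      simpa using! ((hasDerivAt_id z).neg).mul_const (y : ℂ)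
    refine (h.cexp.mul_const (inverseLaplace G y)).congr_deriv ?_
    ring

/-- Both sides are holomorphic for `Re s > 0` and agree on the line `Re s = 1`, so they agree there
by the identity theorem. The boundary line is reached by continuity, which for the integral rests on
the integrability of the inverse transform. -/
theorem eq_laplace (hG : LaplaceSymbol G C) {s : ℂ} (hs : 0 ≤ s.re) :
    G s = ∫ y : ℝ, Complex.exp (-s * y) * inverseLaplace G y := by
  have hopen : IsOpen {s : ℂ | 0 < s.re} := isOpen_lt continuous_const Complex.continuous_re
  have hGd : DifferentiableOn ℂ G {s | 0 < s.re} := fun s hs =>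
    (hG.differentiableAt s (le_of_lt hs)).differentiableWithinAt
  have hfreq : ∃ᶠ z in 𝓝[≠] (1 : ℂ),
      G z = ∫ y : ℝ, Complex.exp (-z * y) * inverseLaplace G y := by
    have ht : Tendsto (fun τ : ℝ => (1 : ℂ) + τ * Complex.I) (𝓝[≠] 0) (𝓝[≠] 1) := by
      refine tendsto_nhdsWithin_iff.2 ⟨?_, ?_⟩
      · have : Continuous fun τ : ℝ => (1 : ℂ) + τ * Complex.I := by fun_prop
        have h := this.tendsto 0
        simp only [Complex.ofReal_zero, zero_mul, add_zero] at h
        exact h.mono_left nhdsWithin_le_nhds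
      · filter_upwards [self_mem_nhdsWithin] with τ hτ
        simpa using hτ
    exact ht.frequently (Eventually.of_forall fun τ => hG.eq_integral_of_re_eq_one τ).frequently
  have heq := (hGd.analyticOnNhd hopen).eqOn_of_preconnected_of_frequently_eq
    (hG.differentiableOn_laplace.analyticOnNhd hopen)
    (convex_halfSpace_re_gt 0).isPreconnected (show (0 : ℝ) < (1 : ℂ).re by simp) hfreq
  have ht : Tendsto (fun n : ℕ => s + (1 / ((n : ℝ) + 1) : ℝ)) atTop (𝓝[{s | 0 ≤ s.re}] s) := by
    refine tendsto_nhdsWithin_iff.2 ⟨?_, Eventually.of_forall fun n => ?_⟩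
    · have := ((Complex.continuous_ofReal.tendsto _).comp
        (tendsto_one_div_add_atTop_nhds_zero_nat (𝕜 := ℝ))).const_add s
      simpa [Function.comp_def] using this
    · simp only [Set.mem_ofPred_eq, Complex.add_re, Complex.ofReal_re]; positivity
  have h1 := ((hG.continuousOn_laplace s hs).tendsto).comp ht
  have h2 := ((hG.differentiableAt s hs).continuousAt.continuousWithinAt
    (s := {s : ℂ | 0 ≤ s.re})).tendsto.comp ht
  refine tendsto_nhds_unique h2 (h1.congr fun n => (heq ?_).symm)
  simp only [Set.mem_ofPred_eq, Complex.add_re, Complex.ofReal_re]; positivity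

theorem conj_inverseLaplace {G : ℂ → ℂ}
    (hconj : ∀ s : ℂ, 0 ≤ s.re → (starRingEnd ℂ) (G s) = G ((starRingEnd ℂ) s)) (y : ℝ) :
    (starRingEnd ℂ) (inverseLaplace G y) = inverseLaplace G y := by
  rw [inverseLaplace, map_mul, ← integral_conj, ← integral_neg_eq_self]
  congr 1
  · simp [map_ofNat]
  · congr 1; ext τ
    rw [map_mul, hconj _ (by simp), ← Complex.exp_conj]
    simp

end LaplaceSymbol

/-! ### The harmonic coefficients in the right half plane -/

theorem sphericalK_eq (s : ℂ) {u : ℝ} (hu : 0 < u) :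
    sphericalK s u = (Real.sqrt (Real.pi / (2 * u)) : ℂ) * (besselInt 0 (s + 1 / 2) u / 2) := by
  rw [sphericalK, besselK_eq_besselInt _ hu]

theorem sphericalK_ne_zero {s : ℂ} (hs : -(1 / 2) < s.re) {u : ℝ} (hu : 0 < u) :
    sphericalK s u ≠ 0 := by
  rw [sphericalK_eq s hu]
  have h1 : (Real.sqrt (Real.pi / (2 * u)) : ℂ) ≠ 0 := by
    have : 0 < Real.sqrt (Real.pi / (2 * u)) := by positivity
    exact_mod_cast this.ne'
  have h2 : besselInt 0 (s + 1 / 2) u ≠ 0 := besselInt_ne_zero (by simp; linarith) hu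
  exact mul_ne_zero h1 (div_ne_zero h2 two_ne_zero)

theorem hasDerivAt_sphericalK {s : ℂ} (hs : -(1 / 2) < s.re) {u : ℝ} (hu : 0 < u) :
    HasDerivAt (fun x : ℝ => sphericalK s x)
      (-((s + 1 + besselRatio u (s + 1 / 2)) / u) * sphericalK s u) u := by
  have hu' : (u : ℂ) ≠ 0 := by exact_mod_cast hu.ne'
  have hB : besselInt 0 (s + 1 / 2) u ≠ 0 := besselInt_ne_zero (by simp; linarith) hu
  have h0 : Real.pi / (2 * u) ≠ 0 := by positivity
  have hd : HasDerivAt (fun x : ℝ => Real.pi / (2 * x)) (-(Real.pi / (2 * u)) / u) u := by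
    have := (((hasDerivAt_id u).const_mul 2).fun_inv (by simpa using hu.ne')).const_mul Real.pi
    simp only [id, ← div_eq_mul_inv] at this
    refine this.congr_deriv ?_
    field_simp
  have h1 : HasDerivAt (fun x : ℝ => Real.sqrt (Real.pi / (2 * x)))
      (-(Real.sqrt (Real.pi / (2 * u)) / (2 * u))) u := by
    refine (hd.sqrt h0).congr_deriv ?_
    have h3 : Real.sqrt (Real.pi / (2 * u)) ^ 2 = Real.pi / (2 * u) :=
      Real.sq_sqrt (by positivity)
    have h4 : Real.sqrt (Real.pi / (2 * u)) ≠ 0 := by positivity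
    nth_rewrite 1 [← h3]
    field_simp
  have h2 := (h1.ofReal_comp).mul ((hasDerivAt_besselInt_zero (s + 1 / 2) hu).div_const 2)
  have h3 : (fun x : ℝ => sphericalK s x) =ᶠ[𝓝 u] fun x : ℝ =>
      (Real.sqrt (Real.pi / (2 * x)) : ℂ) * (besselInt 0 (s + 1 / 2) x / 2) := by
    filter_upwards [Ioi_mem_nhds hu] with x hx using sphericalK_eq s hx
  refine (h2.congr_of_eventuallyEq h3).congr_deriv ?_
  rw [sphericalK_eq s hu, besselRatio]
  push_cast
  generalize besselInt 0 (s + 1 / 2 - 1) u = B' at *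
  generalize besselInt 0 (s + 1 / 2) u = B at *
  field_simp
  ring

/-- The denominator of the harmonic coefficient, divided by `k_s(u)`. -/
noncomputable def coeffDen (ε u : ℝ) (s : ℂ) : ℂ :=
  (ε + 1) * s + 1 + besselRatio u (s + 1 / 2)

/-- Numerator and denominator are multiples of `k_s(u)`, which does not vanish and cancels. -/
theorem harmonicCoeff_eq (ε : ℝ) {u : ℝ} (hu : 0 < u) {s : ℂ} (hs : -(1 / 2) < s.re) :
    harmonicCoeff ε u s =
      ((ε - 1) * (s + 1) - besselRatio u (s + 1 / 2)) / coeffDen ε u s := by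
  have hu' : (u : ℂ) ≠ 0 := by exact_mod_cast hu.ne'
  have hk := sphericalK_ne_zero hs hu
  rw [harmonicCoeff, (hasDerivAt_sphericalK hs hu).deriv, coeffDen]
  generalize besselRatio u (s + 1 / 2) = q
  generalize sphericalK s u = k at *
  have e1 : ε * (s + 1) * k + u * (-((s + 1 + q) / u) * k) = ((ε - 1) * (s + 1) - q) * k := by
    field_simp; ring
  have e2 : ε * s * k - u * (-((s + 1 + q) / u) * k) = ((ε + 1) * s + 1 + q) * k := by
    field_simp; ring
  rw [e1, e2, mul_div_mul_right _ _ hk]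

section

variable {ε u : ℝ}

theorem re_add_half (s : ℂ) : (s + 1 / 2).re = s.re + 1 / 2 := by simp

theorem norm_besselRatio_add_half_le (hu : 0 < u) {s : ℂ} (hs : 0 ≤ s.re) :
    ‖besselRatio u (s + 1 / 2)‖ ≤ u :=
  norm_besselRatio_le hu (by rw [re_add_half]; linarith)

/-- For real `s` every term of the denominator is nonnegative and `1` is positive. For nonreal `s` a
vanishing imaginary part would mean `Im q / Im s = -(ε + 1)`, whereas this quotient exceeds `-1`. -/
theorem coeffDen_ne_zero (hε : 0 < ε) (hu : 0 < u) {s : ℂ} (hs : 0 ≤ s.re) :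
    coeffDen ε u s ≠ 0 := by
  intro h
  by_cases him : s.im = 0
  · obtain ⟨h1, -⟩ := besselRatio_ofReal hu (s.re + 1 / 2)
    have e : s + 1 / 2 = ((s.re + 1 / 2 : ℝ) : ℂ) := by
      apply Complex.ext <;> simp [him]
    have h2 := congrArg Complex.re h
    rw [← e] at h1
    simp only [coeffDen, Complex.add_re, Complex.mul_re, Complex.ofReal_re, Complex.one_re,
      Complex.add_im, Complex.ofReal_im, Complex.one_im, Complex.zero_re] at h2
    have h3 : 0 ≤ (ε + 1) * s.re := by positivity
    nlinarith
  · have h1 := im_besselRatio_div_pos (ν := s + 1 / 2) hu (by rw [re_add_half]; linarith)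
      (by simpa using him)
    have e : (s + 1 / 2).im = s.im := by simp
    rw [e] at h1
    have h2 := congrArg Complex.im h
    simp only [coeffDen, Complex.add_im, Complex.mul_im, Complex.ofReal_re, Complex.one_re,
      Complex.add_re, Complex.ofReal_im, Complex.one_im, Complex.zero_im] at h2
    have h3 : (besselRatio u (s + 1 / 2)).im = -((ε + 1) * s.im) := by linarith
    rw [h3, neg_div, mul_div_cancel_right₀ _ him] at h1
    linarith

theorem differentiableAt_besselRatio_add_half (hu : 0 < u) {s : ℂ} (hs : -(1 / 2) < s.re) :
    HasDerivAt (fun s => besselRatio u (s + 1 / 2)) (deriv (besselRatio u) (s + 1 / 2)) s :=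
  ((hasDerivAt_besselRatio hu (by rw [re_add_half]; linarith)).differentiableAt.hasDerivAt
    ).comp_add_const s (1 / 2)

theorem hasDerivAt_coeffDen (ε : ℝ) (hu : 0 < u) {s : ℂ} (hs : -(1 / 2) < s.re) :
    HasDerivAt (coeffDen ε u) ((ε + 1) + deriv (besselRatio u) (s + 1 / 2)) s := by
  have h := (((hasDerivAt_id s).const_mul ((ε : ℂ) + 1)).add_const 1).add
    (differentiableAt_besselRatio_add_half hu hs)
  exact h.congr_deriv (by simp)

theorem exists_le_norm_coeffDen (hε : 0 < ε) (hu : 0 < u) :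
    ∃ c > 0, ∀ s : ℂ, 0 ≤ s.re → c * (1 + ‖s‖) ≤ ‖coeffDen ε u s‖ := by
  -- Beyond this radius `|q| ≤ u` alone gives `|D| ≥ |s| - 1 - u ≥ (1 + |s|)/2` for the denominator
  -- `D`. Inside it the minimum over a compact half disc is positive.
  set ρ := 2 * (2 + u) with hρ
  set K : Set ℂ := {s | 0 ≤ s.re} ∩ Metric.closedBall 0 ρ with hK
  have hKc : IsCompact K :=
    (isCompact_closedBall 0 ρ).inter_left (isClosed_le continuous_const Complex.continuous_re)
  have hcont : ContinuousOn (fun s => ‖coeffDen ε u s‖) K := fun s hs =>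
    ((hasDerivAt_coeffDen ε hu (by
      have : 0 ≤ s.re := hs.1
      linarith)).continuousAt.norm).continuousWithinAt
  obtain ⟨s₀, hs₀, hmin⟩ := hKc.exists_isMinOn ⟨0, by simp [hK, hρ]; positivity⟩ hcont
  have hm : 0 < ‖coeffDen ε u s₀‖ := norm_pos_iff.2 (coeffDen_ne_zero hε hu hs₀.1)
  refine ⟨min (1 / 2) (‖coeffDen ε u s₀‖ / (1 + ρ)), by positivity, fun s hs => ?_⟩
  rcases le_or_gt ‖s‖ ρ with h | h
  · have h1 : ‖coeffDen ε u s₀‖ ≤ ‖coeffDen ε u s‖ := hmin ⟨hs, by simpa using h⟩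
    refine le_trans ?_ h1
    calc _ ≤ ‖coeffDen ε u s₀‖ / (1 + ρ) * (1 + ρ) := by
          gcongr; exact min_le_right _ _
      _ = _ := div_mul_cancel₀ _ (by positivity)
  · have h1 := norm_besselRatio_add_half_le hu hs
    have h2 : ‖s‖ ≤ ‖((ε : ℂ) + 1) * s‖ := by
      rw [norm_mul]
      refine le_mul_of_one_le_left (norm_nonneg _) ?_
      rw [← Complex.ofReal_one, ← Complex.ofReal_add, Complex.norm_real, Real.norm_of_nonneg] <;>
        linarith
    have h3 : ‖((ε : ℂ) + 1) * s‖ ≤ ‖coeffDen ε u s‖ + (1 + u) := by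
      have e : ((ε : ℂ) + 1) * s = coeffDen ε u s - (1 + besselRatio u (s + 1 / 2)) := by
        rw [coeffDen]; ring
      rw [e]
      refine (norm_sub_le _ _).trans ?_
      gcongr
      refine (norm_add_le _ _).trans ?_
      rw [norm_one]
      gcongr
    calc _ ≤ 1 / 2 * (1 + ‖s‖) := by gcongr; exact min_le_left _ _
      _ ≤ _ := by linarith

theorem le_norm_mul_add_one (hε : 0 < ε) {s : ℂ} (hs : 0 ≤ s.re) :
    (1 + ‖s‖) / 2 ≤ ‖((ε : ℂ) + 1) * s + 1‖ ∧ ‖2 * s + 1‖ ≤ 2 * ‖((ε : ℂ) + 1) * s + 1‖ := by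
  set p := ((ε : ℂ) + 1) * s + 1
  have hre : p.re = (ε + 1) * s.re + 1 := by simp [p]
  have him : p.im = (ε + 1) * s.im := by simp [p]
  have h0 : 0 ≤ ε * s.re := by positivity
  have h1 : (1 : ℝ) ≤ ‖p‖ := by
    refine le_trans ?_ ((le_abs_self _).trans (Complex.abs_re_le_norm p))
    rw [hre]; nlinarith
  have hsq : ‖s‖ ^ 2 ≤ ‖p‖ ^ 2 := by
    rw [← Complex.normSq_eq_norm_sq, ← Complex.normSq_eq_norm_sq, Complex.normSq_apply,
      Complex.normSq_apply, hre, him]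
    nlinarith [mul_nonneg h0 hs, sq_nonneg s.im, mul_nonneg hε.le (sq_nonneg s.im),
      mul_nonneg (mul_nonneg hε.le hε.le) (sq_nonneg s.im), sq_nonneg (ε * s.re)]
  have h2 : ‖s‖ ≤ ‖p‖ := (sq_le_sq₀ (norm_nonneg _) (norm_nonneg _)).1 hsq
  refine ⟨by linarith, ?_⟩
  have hsq2 : ‖2 * s + 1‖ ^ 2 ≤ (2 * ‖p‖) ^ 2 := by
    rw [mul_pow, ← Complex.normSq_eq_norm_sq, ← Complex.normSq_eq_norm_sq, Complex.normSq_apply,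
      Complex.normSq_apply, hre, him]
    simp only [Complex.add_re, Complex.add_im, Complex.mul_re, Complex.mul_im, Complex.re_ofNat,
      Complex.im_ofNat, Complex.one_re, Complex.one_im]
    nlinarith [mul_nonneg h0 hs, sq_nonneg s.im, mul_nonneg hε.le (sq_nonneg s.im),
      mul_nonneg (mul_nonneg hε.le hε.le) (sq_nonneg s.im), sq_nonneg (ε * s.re)]
  exact (sq_le_sq₀ (norm_nonneg _) (by positivity)).1 hsq2

/-- The harmonic coefficient without its value at infinity and its leading term. -/
noncomputable def coeffRemainder (ε u : ℝ) (s : ℂ) : ℂ :=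
  -ε * (besselRatio u (s + 1 / 2) / coeffDen ε u s) * ((2 * s + 1) / ((ε + 1) * s + 1))

/-- The first two terms are the partial fractions of `(ε-1)(s+1)/((ε+1)s+1)`, the coefficient with
`q` replaced by `0`. In the difference the numerator collapses to `-ε q (2s+1)`. -/
theorem harmonicCoeff_eq_add_coeffRemainder (hε : 0 < ε) (hu : 0 < u) {s : ℂ} (hs : 0 ≤ s.re) :
    harmonicCoeff ε u s = ((ε - 1) / (ε + 1) : ℝ) +
      (ε * (ε - 1) / (ε + 1) ^ 2 : ℝ) / (s + (1 / (ε + 1) : ℝ)) + coeffRemainder ε u s := by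
  rw [harmonicCoeff_eq ε hu (by linarith), coeffRemainder]
  have hD := coeffDen_ne_zero hε hu hs
  have hp : ((ε : ℂ) + 1) * s + 1 ≠ 0 := by
    have := (le_norm_mul_add_one hε hs).1
    exact norm_pos_iff.1 (lt_of_lt_of_le (by positivity) this)
  have he : (ε : ℂ) + 1 ≠ 0 := by
    have : ε + 1 ≠ 0 := by positivity
    exact_mod_cast this
  have e : s + (1 / (ε + 1) : ℝ) = (((ε : ℂ) + 1) * s + 1) / (ε + 1) := by
    push_cast; field_simp
  have hq : besselRatio u (s + 1 / 2) = coeffDen ε u s - (((ε : ℂ) + 1) * s + 1) := by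
    rw [coeffDen]; ring
  rw [e, hq]
  have hs1 : s + 1 = ((((ε : ℂ) + 1) * s + 1) + ε) / (ε + 1) := by field_simp; ring
  have hs2 : 2 * s + 1 = (2 * (((ε : ℂ) + 1) * s + 1) + ε - 1) / (ε + 1) := by field_simp; ring
  rw [hs1, hs2]
  generalize coeffDen ε u s = D at *
  generalize ((ε : ℂ) + 1) * s + 1 = p at *
  push_cast
  field_simp
  ring

theorem norm_coeffRemainder_le (hε : 0 < ε) {s : ℂ} (hs : 0 ≤ s.re) :
    ‖coeffRemainder ε u s‖ ≤ 2 * ε * (‖besselRatio u (s + 1 / 2)‖ / ‖coeffDen ε u s‖) := by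
  obtain ⟨h1, h2⟩ := le_norm_mul_add_one hε hs
  have h3 : 0 < ‖((ε : ℂ) + 1) * s + 1‖ := lt_of_lt_of_le (by positivity) h1
  rw [coeffRemainder, norm_mul, norm_mul, norm_neg, Complex.norm_real, Real.norm_of_nonneg hε.le,
    norm_div, norm_div]
  have h4 : ‖2 * s + 1‖ / ‖((ε : ℂ) + 1) * s + 1‖ ≤ 2 := by rwa [div_le_iff₀ h3]
  calc _ ≤ ε * (‖besselRatio u (s + 1 / 2)‖ / ‖coeffDen ε u s‖) * 2 := by gcongr
    _ = _ := by ring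

/-- For `|s| ≥ 1 + u` the continued fraction step gives the decay, with `1 + |s|` absorbed at the
cost of a factor `2`. On the remaining bounded set `|q| ≤ u` suffices. -/
theorem norm_besselRatio_add_half_le_div (hu : 0 < u) {s : ℂ} (hs : 1 ≤ s.re) :
    ‖besselRatio u (s + 1 / 2)‖ ≤ (2 * u ^ 2 + u * (2 + u)) / (1 + ‖s‖) := by
  rw [le_div_iff₀ (by positivity)]
  rcases le_or_gt (1 + u) ‖s‖ with h | h
  · have h1 := norm_besselRatio_mul_le (ν := s + 1 / 2) hu (by rw [re_add_half]; linarith)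
    have h2 : ‖s‖ ≤ ‖s + 1 / 2 - 1‖ + 1 / 2 := by
      have := norm_sub_le (s + 1 / 2 - 1) (-(1 / 2 : ℂ))
      rw [norm_neg, show s + 1 / 2 - 1 - -(1 / 2 : ℂ) = s by ring] at this
      simpa using this
    have h3 : ‖besselRatio u (s + 1 / 2)‖ * (1 + ‖s‖) ≤
        2 * (‖besselRatio u (s + 1 / 2)‖ * (2 * ‖s + 1 / 2 - 1‖ - u)) := by
      rw [mul_left_comm]
      gcongr
      linarith
    nlinarith
  · have h1 := norm_besselRatio_add_half_le hu (by linarith : 0 ≤ s.re)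
    have h2 : ‖besselRatio u (s + 1 / 2)‖ * (1 + ‖s‖) ≤ u * (2 + u) := by
      exact mul_le_mul h1 (by linarith) (by positivity) hu.le
    nlinarith

/-- The estimate on the critical line needs `|τ| ≥ 2u`; the remaining segment is compact. -/
theorem exists_norm_deriv_besselRatio_le (hu : 0 < u) : ∃ K, 0 ≤ K ∧ ∀ τ : ℝ,
    ‖deriv (besselRatio u) (τ * Complex.I + 1 / 2)‖ ≤ K * (1 + |τ|) ^ (1 / 3 : ℝ) := by
  have hopen : IsOpen {ν : ℂ | 0 < ν.re} := isOpen_lt continuous_const Complex.continuous_re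
  have hd : DifferentiableOn ℂ (besselRatio u) {ν : ℂ | 0 < ν.re} := fun ν hν =>
    (hasDerivAt_besselRatio hu hν).differentiableAt.differentiableWithinAt
  have hcont : ContinuousOn (fun τ : ℝ => ‖deriv (besselRatio u) (τ * Complex.I + 1 / 2)‖)
      (Set.Icc (-(2 * u)) (2 * u)) := by
    refine (((hd.deriv hopen).continuousOn).comp (by fun_prop) fun τ _ => ?_).norm
    simp
  obtain ⟨K, hK⟩ := isCompact_Icc.exists_bound_of_continuousOn hcont
  have hK0 : 0 ≤ K := (norm_nonneg _).trans (hK 0 ⟨by linarith, by linarith⟩)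
  refine ⟨K + (3 + 30 * u ^ (2 / 3 : ℝ)), by positivity, fun τ => ?_⟩
  have h1 : 1 ≤ (1 + |τ|) ^ (1 / 3 : ℝ) :=
    Real.one_le_rpow (by linarith [abs_nonneg τ]) (by norm_num)
  have hu3 : 0 ≤ u ^ (2 / 3 : ℝ) := by positivity
  rcases le_or_gt |τ| (2 * u) with h | h
  · have h2 := hK τ (abs_le.1 h)
    rw [Real.norm_of_nonneg (norm_nonneg _)] at h2
    nlinarith
  · have h2 := norm_deriv_besselRatio_le (ν := τ * Complex.I + 1 / 2) hu (by simp)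
      (by simpa using h.le)
    have h3 : (τ * Complex.I + 1 / 2 : ℂ).im = τ := by simp
    rw [h3] at h2
    have h4 : |τ| ^ (1 / 3 : ℝ) ≤ (1 + |τ|) ^ (1 / 3 : ℝ) :=
      Real.rpow_le_rpow (abs_nonneg τ) (by linarith) (by norm_num)
    have h5 : 30 * u ^ (2 / 3 : ℝ) * |τ| ^ (1 / 3 : ℝ) ≤
      30 * u ^ (2 / 3 : ℝ) * (1 + |τ|) ^ (1 / 3 : ℝ) := by gcongr
    nlinarith [mul_nonneg hK0 (zero_le_one.trans h1)]

theorem hasDerivAt_coeffRemainder (hε : 0 < ε) (hu : 0 < u) {s : ℂ} (hs : 0 ≤ s.re) :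
    HasDerivAt (coeffRemainder ε u)
      (-ε * ((deriv (besselRatio u) (s + 1 / 2) * ((ε + 1) * s + 1) -
          (ε + 1) * besselRatio u (s + 1 / 2)) / coeffDen ε u s ^ 2) *
          ((2 * s + 1) / ((ε + 1) * s + 1)) +
        -ε * (besselRatio u (s + 1 / 2) / coeffDen ε u s) *
          ((1 - ε) / ((ε + 1) * s + 1) ^ 2)) s := by
  have hs' : -(1 / 2) < s.re := by linarith
  have hD := coeffDen_ne_zero hε hu hs
  have hp : ((ε : ℂ) + 1) * s + 1 ≠ 0 := by
    have := (le_norm_mul_add_one hε hs).1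
    exact norm_pos_iff.1 (lt_of_lt_of_le (by positivity) this)
  have h1 := ((differentiableAt_besselRatio_add_half hu hs').div
    (hasDerivAt_coeffDen ε hu hs') hD).const_mul (-ε : ℂ)
  have h2 : HasDerivAt (fun s : ℂ => (2 * s + 1) / (((ε : ℂ) + 1) * s + 1))
      ((1 - ε) / ((ε + 1) * s + 1) ^ 2) s := by
    have h3 := (((hasDerivAt_id s).const_mul 2).add_const 1).div
      (((hasDerivAt_id s).const_mul ((ε : ℂ) + 1)).add_const 1) hp
    refine h3.congr_deriv ?_
    simp only [id]
    congr 1; ring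
  refine (h1.mul h2).congr_deriv ?_
  have hq : deriv (besselRatio u) (s + 1 / 2) * coeffDen ε u s - besselRatio u (s + 1 / 2) *
      ((ε + 1) + deriv (besselRatio u) (s + 1 / 2)) = deriv (besselRatio u) (s + 1 / 2) *
      ((ε + 1) * s + 1) - (ε + 1) * besselRatio u (s + 1 / 2) := by
    rw [coeffDen]; ring
  rw [hq]
  rfl

theorem exists_laplaceSymbol_coeffRemainder (hε : 0 < ε) (hu : 0 < u) :
    ∃ C, LaplaceSymbol (coeffRemainder ε u) C := by
  obtain ⟨c, hc, hden⟩ := exists_le_norm_coeffDen hε hu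
  obtain ⟨K, hK0, hK⟩ := exists_norm_deriv_besselRatio_le hu
  set C₁ := 2 * ε * u / c with hC₁
  set C₂ := 2 * ε * (2 * u ^ 2 + u * (2 + u)) / c with hC₂
  set C₃ := 2 * ε * (ε + 1) * (K + u) / c ^ 2 + 4 * ε * u * (1 + ε) / c with hC₃
  have p1 : 0 ≤ C₁ := by positivity
  have p2 : 0 ≤ C₂ := by positivity
  have p3 : 0 ≤ C₃ := by positivity
  refine ⟨C₁ + C₂ + C₃, fun s hs => (hasDerivAt_coeffRemainder hε hu hs).differentiableAt,
    fun s hs => ?_, fun s hs => ?_, fun τ => ?_⟩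
  · refine (norm_coeffRemainder_le hε hs).trans ?_
    calc 2 * ε * (‖besselRatio u (s + 1 / 2)‖ / ‖coeffDen ε u s‖)
        ≤ 2 * ε * (u / (c * (1 + ‖s‖))) := by
          gcongr
          · exact norm_besselRatio_add_half_le hu hs
          · exact hden s hs
      _ = C₁ / (1 + ‖s‖) := by rw [hC₁]; field_simp
      _ ≤ _ := by gcongr; linarith
  · have hs0 : 0 ≤ s.re := by linarith
    refine (norm_coeffRemainder_le hε hs0).trans ?_
    calc 2 * ε * (‖besselRatio u (s + 1 / 2)‖ / ‖coeffDen ε u s‖)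
        ≤ 2 * ε * ((2 * u ^ 2 + u * (2 + u)) / (1 + ‖s‖) / (c * (1 + ‖s‖))) := by
          gcongr
          · exact norm_besselRatio_add_half_le_div hu hs
          · exact hden s hs0
      _ = C₂ / (1 + ‖s‖) ^ 2 := by rw [hC₂]; field_simp
      _ ≤ _ := by gcongr; linarith
  · set s : ℂ := τ * Complex.I with hs
    have hre : 0 ≤ s.re := by simp [hs]
    have hns : ‖s‖ = |τ| := by simp [hs]
    rw [(hasDerivAt_coeffRemainder hε hu hre).deriv]
    obtain ⟨q1, q2⟩ := le_norm_mul_add_one hε hre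
    have hd := hden s hre
    have hq := norm_besselRatio_add_half_le hu hre
    have hQ := hK τ
    rw [← hs] at hQ
    rw [hns] at hd q1
    have hpos : 0 < ‖((ε : ℂ) + 1) * s + 1‖ := lt_of_lt_of_le (by positivity) q1
    have hp : ‖((ε : ℂ) + 1) * s + 1‖ ≤ (ε + 1) * (1 + |τ|) := by
      refine (norm_add_le _ _).trans ?_
      rw [norm_mul, hns, norm_one, ← Complex.ofReal_one, ← Complex.ofReal_add, Complex.norm_real,
        Real.norm_of_nonneg (by positivity)]
      linarith
    have hε1 : ‖(ε : ℂ) + 1‖ = ε + 1 := by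
      rw [← Complex.ofReal_one, ← Complex.ofReal_add, Complex.norm_real,
        Real.norm_of_nonneg (by positivity)]
    have hε2 : ‖1 - (ε : ℂ)‖ ≤ 1 + ε := by
      refine (norm_sub_le _ _).trans ?_
      rw [norm_one, Complex.norm_real, Real.norm_of_nonneg hε.le]
    set A := (1 + |τ|) ^ (1 / 3 : ℝ) with hA
    have hA1 : 1 ≤ A := Real.one_le_rpow (by linarith [abs_nonneg τ]) (by norm_num)
    have hw : ‖2 * s + 1‖ / ‖((ε : ℂ) + 1) * s + 1‖ ≤ 2 := by rwa [div_le_iff₀ hpos]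
    have t1 : ‖deriv (besselRatio u) (s + 1 / 2) * (((ε : ℂ) + 1) * s + 1) -
        (ε + 1) * besselRatio u (s + 1 / 2)‖ ≤ (ε + 1) * (K + u) * (A * (1 + |τ|)) := by
      refine (norm_sub_le _ _).trans ?_
      rw [norm_mul, norm_mul, hε1]
      have e1 : ‖deriv (besselRatio u) (s + 1 / 2)‖ * ‖((ε : ℂ) + 1) * s + 1‖ ≤
          K * A * ((ε + 1) * (1 + |τ|)) := by gcongr
      have e2 : (ε + 1) * ‖besselRatio u (s + 1 / 2)‖ ≤ (ε + 1) * u * (A * (1 + |τ|)) := by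
        have : 1 ≤ A * (1 + |τ|) := one_le_mul_of_one_le_of_one_le hA1 (by linarith [abs_nonneg τ])
        have e3 : (ε + 1) * ‖besselRatio u (s + 1 / 2)‖ ≤ (ε + 1) * u := by gcongr
        exact e3.trans (le_mul_of_one_le_right (by positivity) this)
      linarith
    -- The exponent: `q'` is of order `1/3`, the factor `(ε+1)s+1` adds `1`, and the squared
    -- denominator removes `2`. The result `-2/3` lies below `-1/2`, as square integrability
    -- requires.
    have hfin : A / (1 + |τ|) = (1 + |τ|) ^ (-(2 / 3) : ℝ) := by
      rw [hA, ← Real.rpow_sub_one (by positivity)]; norm_num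
    calc _ ≤ ε * ((ε + 1) * (K + u) * (A * (1 + |τ|)) / (c * (1 + |τ|)) ^ 2) * 2 +
          ε * (u / (c * (1 + |τ|))) * ((1 + ε) / ((1 + |τ|) / 2) ^ 2) := by
          refine (norm_add_le _ _).trans ?_
          simp only [norm_mul, norm_neg, norm_div, norm_pow, Complex.norm_real,
            Real.norm_of_nonneg hε.le] at t1 hw hε2 q1 hd hq ⊢
          gcongr
      _ = 2 * ε * (ε + 1) * (K + u) / c ^ 2 * (A / (1 + |τ|)) +
          4 * ε * u * (1 + ε) / c * (1 / (1 + |τ|) ^ 3) := by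
          field_simp; ring
      _ ≤ 2 * ε * (ε + 1) * (K + u) / c ^ 2 * (A / (1 + |τ|)) +
          4 * ε * u * (1 + ε) / c * (A / (1 + |τ|)) := by
          gcongr
          exact le_self_pow₀ (by linarith [abs_nonneg τ]) (by norm_num)
      _ = C₃ * (A / (1 + |τ|)) := by rw [hC₃]; ring
      _ ≤ _ := by
          rw [hfin]; gcongr; linarith

end

/-! ### The finite Mellin transform pair of the harmonic coefficients -/

theorem image_exp_neg_Ici : (fun y : ℝ => Real.exp (-y)) '' Set.Ici 0 = Set.Ioc 0 1 := by
  ext t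
  constructor
  · rintro ⟨y, hy, rfl⟩
    exact ⟨Real.exp_pos _, Real.exp_le_one_iff.2 (by simpa using hy)⟩
  · rintro ⟨h0, h1⟩
    exact ⟨-Real.log t, by simpa using Real.log_nonpos h0.le h1, by simp [Real.exp_log h0]⟩

theorem hasDerivWithinAt_exp_neg (y : ℝ) (s : Set ℝ) :
    HasDerivWithinAt (fun y : ℝ => Real.exp (-y)) (-Real.exp (-y)) s y := by
  simpa using (hasDerivAt_neg y).exp.hasDerivWithinAt

theorem injOn_exp_neg (s : Set ℝ) : Set.InjOn (fun y : ℝ => Real.exp (-y)) s :=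
  fun x _ y _ h => by simpa using h

/-- The substitution `t = exp (-y)`: the Jacobian and `t^(s-1)` combine to `exp (-s y)`. -/
theorem exp_neg_smul_cpow (g : ℝ → ℂ) (s : ℂ) (y : ℝ) :
    |-Real.exp (-y)| • (g (-Real.log (Real.exp (-y))) * (Real.exp (-y) : ℂ) ^ (s - 1)) =
      Complex.exp (-s * y) * g y := by
  have h : Complex.exp (-s * y) = Complex.exp (-y) * Complex.exp ((-y : ℂ) * (s - 1)) := by
    rw [← Complex.exp_add]
    ring_nf
  rw [abs_neg, abs_of_pos (Real.exp_pos _), Real.log_exp, neg_neg, Complex.real_smul, h,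
    Complex.cpow_def_of_ne_zero (by exact_mod_cast (Real.exp_pos _).ne'),
    ← Complex.ofReal_log (Real.exp_pos _).le, Real.log_exp]
  push_cast
  ring

theorem integrableOn_neg_log_mul_cpow_iff (g : ℝ → ℂ) (s : ℂ) :
    IntegrableOn (fun t : ℝ => g (-Real.log t) * (t : ℂ) ^ (s - 1)) (Set.Ioc 0 1) ↔
      IntegrableOn (fun y : ℝ => Complex.exp (-s * y) * g y) (Set.Ici 0) := by
  rw [← image_exp_neg_Ici, integrableOn_image_iff_integrableOn_abs_deriv_smul measurableSet_Ici
    (fun y _ => hasDerivWithinAt_exp_neg y _) (injOn_exp_neg _)]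
  simp only [exp_neg_smul_cpow]

theorem integral_neg_log_mul_cpow (g : ℝ → ℂ) (s : ℂ) :
    ∫ t in Set.Ioc (0 : ℝ) 1, g (-Real.log t) * (t : ℂ) ^ (s - 1) =
      ∫ y in Set.Ici (0 : ℝ), Complex.exp (-s * y) * g y := by
  rw [← image_exp_neg_Ici, integral_image_eq_integral_abs_deriv_smul measurableSet_Ici
    (fun y _ => hasDerivWithinAt_exp_neg y _) (injOn_exp_neg _)]
  simp only [exp_neg_smul_cpow]

theorem ofReal_cpow_neg_eq_exp {t : ℝ} (ht : 0 < t) (s : ℂ) :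
    (t : ℂ) ^ (-s) = Complex.exp (s * (-Real.log t : ℝ)) := by
  rw [Complex.cpow_def_of_ne_zero (by exact_mod_cast ht.ne'), ← Complex.ofReal_log ht.le]
  push_cast
  ring_nf

theorem integrable_inv_add_mul_I_sq {b σ : ℝ} (hb : 0 < σ + b) :
    Integrable fun τ : ℝ => ((σ + τ * Complex.I + b : ℂ) ^ 2)⁻¹ := by
  have hne : ∀ τ : ℝ, (σ + τ * Complex.I + b : ℂ) ^ 2 ≠ 0 := fun τ => by
    refine pow_ne_zero 2 fun h => ?_
    have := congrArg Complex.re h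
    simp at this; linarith
  refine (integrable_inv_one_add_sq.const_mul (1 + 1 / (σ + b) ^ 2)).mono'
    (Continuous.aestronglyMeasurable (by fun_prop (disch := exact hne _)))
    (ae_of_all _ fun τ => ?_)
  rw [norm_inv, norm_pow, ← Complex.normSq_eq_norm_sq, Complex.normSq_apply]
  have e1 : (σ + τ * Complex.I + b : ℂ).re = σ + b := by simp
  have e2 : (σ + τ * Complex.I + b : ℂ).im = τ := by simp
  rw [e1, e2, ← div_eq_mul_inv, ← one_div, div_le_div_iff₀
    (add_pos_of_pos_of_nonneg (mul_pos hb hb) (mul_self_nonneg τ)) (by positivity)]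
  have : (1 + 1 / (σ + b) ^ 2) * ((σ + b) * (σ + b) + τ * τ) =
    1 + τ ^ 2 + (σ + b) ^ 2 + τ ^ 2 / (σ + b) ^ 2 := by field_simp; ring
  rw [this]
  have : 0 ≤ τ ^ 2 / (σ + b) ^ 2 := by positivity
  nlinarith [sq_nonneg (σ + b)]

/-- The inverse Mellin transform of `(s + b)⁻²`. -/
theorem integral_cpow_div_add_sq {b σ t : ℝ} (hb : 0 < σ + b) (ht : 0 < t) (ht1 : t < 1) :
    ∫ τ : ℝ, (t : ℂ) ^ (-((σ : ℂ) + τ * Complex.I)) / (σ + τ * Complex.I + b) ^ 2 =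
      2 * Real.pi * (-Real.log t * t ^ b : ℝ) := by
  set f₀ : ℝ → ℂ := Set.indicator (Set.Ioc 0 1) (fun t => (t : ℂ) ^ (b : ℂ)) with hf₀
  set f : ℝ → ℂ := fun t => Real.log t • f₀ t with hf
  -- Multiplication by `log t` is differentiation of the Mellin transform in `s`, and the transform
  -- of `t^b` on `(0, 1]` is `1/(s+b)`.
  have hmel : ∀ s : ℂ, 0 < s.re + b → MellinConvergent f s ∧ mellin f s = -1 / (s + b) ^ 2 := by
    intro s hs
    have hloc : LocallyIntegrableOn f₀ (Set.Ioi 0) := by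
      have h0 : LocallyIntegrableOn (fun t : ℝ => (t : ℂ) ^ (b : ℂ)) (Set.Ioi 0) :=
        ContinuousOn.locallyIntegrableOn (fun t ht =>
          (Complex.continuousAt_ofReal_cpow_const _ _ (Or.inr (ne_of_gt ht))).continuousWithinAt)
          measurableSet_Ioi
      exact h0.mono ((Complex.measurable_ofReal.pow_const _).indicator
        measurableSet_Ioc).aestronglyMeasurable
        (ae_of_all _ fun x => norm_indicator_le_norm_self _ _)
    have htop : f₀ =O[atTop] fun x : ℝ => x ^ (-(s.re + 1)) := by
      refine Asymptotics.IsBigO.of_bound 1 ?_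
      filter_upwards [eventually_gt_atTop 1] with x hx
      rw [hf₀, Set.indicator_of_notMem (fun h => by linarith [h.2]), norm_zero]
      positivity
    have hbot : f₀ =O[𝓝[>] 0] fun x : ℝ => x ^ (-(-b)) := by
      refine Asymptotics.IsBigO.of_bound 1 ?_
      filter_upwards [Ioc_mem_nhdsGT zero_lt_one] with x hx
      rw [hf₀, Set.indicator_of_mem hx, Complex.norm_cpow_eq_rpow_re_of_pos hx.1]
      simp [abs_of_pos (Real.rpow_pos_of_pos hx.1 b)]
    obtain ⟨h1, h2⟩ := mellin_hasDerivAt_of_isBigO_rpow (s := s) hloc htop (by linarith) hbot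
      (by linarith)
    refine ⟨h1, h2.unique ?_⟩
    have hne : s + b ≠ 0 := fun h => by
      have := congrArg Complex.re h
      simp at this; linarith
    have h3 : HasDerivAt (fun s : ℂ => 1 / (s + b)) (-1 / (s + b) ^ 2) s := by
      simpa using ((hasDerivAt_id s).add_const (b : ℂ)).fun_inv hne
    refine h3.congr_of_eventuallyEq ?_
    have hopen : IsOpen {s : ℂ | 0 < s.re + b} :=
      isOpen_lt continuous_const (Complex.continuous_re.add continuous_const)
    filter_upwards [hopen.mem_nhds hs] with z hz
    exact (hasMellin_cpow_Ioc (b : ℂ) (by simpa using hz)).2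
  have hline : ∀ τ : ℝ, mellin f (σ + τ * Complex.I) = -1 / (σ + τ * Complex.I + b) ^ 2 :=
    fun τ => (hmel _ (by simpa using hb)).2
  have hσ : ((σ : ℂ)).re + b = σ + b := by simp
  have hvert : Complex.VerticalIntegrable (mellin f) σ := by
    rw [Complex.VerticalIntegrable]
    simp_rw [hline]
    simp_rw [neg_div, one_div]
    exact (integrable_inv_add_mul_I_sq hb).neg
  have hcont : ContinuousAt f t := by
    have h1 : ContinuousAt (fun t : ℝ => Real.log t • (t : ℂ) ^ (b : ℂ)) t := by
      refine (Real.continuousAt_log ht.ne').smul ?_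
      exact (Complex.continuousAt_ofReal_cpow_const _ _ (Or.inr ht.ne'))
    refine h1.congr ?_
    filter_upwards [Ioo_mem_nhds ht ht1] with x hx
    have hx' : x ∈ Set.Ioc (0 : ℝ) 1 := ⟨hx.1, hx.2.le⟩
    simp only [hf, hf₀, Set.indicator_of_mem hx']
  have h := mellinInv_mellin_eq σ f ht (hmel σ (by simpa using hb)).1 hvert hcont
  rw [mellinInv] at h
  simp_rw [hline] at h
  have hft : f t = ((Real.log t * t ^ b : ℝ) : ℂ) := by
    have ht' : t ∈ Set.Ioc (0 : ℝ) 1 := ⟨ht, ht1.le⟩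
    simp only [hf, hf₀, Set.indicator_of_mem ht']
    rw [Complex.real_smul, Complex.ofReal_mul, Complex.ofReal_cpow ht.le]
  rw [hft] at h
  have hpi : (Real.pi : ℂ) ≠ 0 := by exact_mod_cast Real.pi_ne_zero
  have e : ∫ τ : ℝ, (t : ℂ) ^ (-((σ : ℂ) + τ * Complex.I)) / (σ + τ * Complex.I + b) ^ 2 =
      -∫ τ : ℝ, (t : ℂ) ^ (-((σ : ℂ) + τ * Complex.I)) • (-1 / (σ + τ * Complex.I + b) ^ 2) := by
    rw [← integral_neg]
    congr 1
    ext τ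
    rw [smul_eq_mul]
    ring
  rw [e]
  generalize (∫ τ : ℝ, (t : ℂ) ^ (-((σ : ℂ) + τ * Complex.I)) •
    (-1 / (σ + τ * Complex.I + b : ℂ) ^ 2)) = J at *
  rw [Complex.real_smul] at h
  push_cast at h ⊢
  rw [neg_mul, ← h]
  field_simp

/-- The function `1/(s+b)` is not integrable on a vertical line. One integration by parts, with
boundary terms of order `1/T`, reduces to `(s+b)⁻²` and costs a division by `-log t > 0`. -/
theorem tendsto_integral_cpow_div_add {b σ t : ℝ} (hb : 0 < σ + b) (ht : 0 < t) (ht1 : t < 1) :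
    Tendsto (fun T : ℝ => ∫ τ in (-T)..T,
        (t : ℂ) ^ (-((σ : ℂ) + τ * Complex.I)) / (σ + τ * Complex.I + b))
      atTop (𝓝 (2 * Real.pi * (t ^ b : ℝ))) := by
  set L : ℝ := -Real.log t with hL
  have hL0 : 0 < L := neg_pos.2 (Real.log_neg ht ht1)
  have hLc : (L : ℂ) ≠ 0 := by exact_mod_cast hL0.ne'
  set E : ℝ → ℂ := fun τ => (t : ℂ) ^ (-((σ : ℂ) + τ * Complex.I)) with hE
  set p : ℝ → ℂ := fun τ => σ + τ * Complex.I + b with hp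
  have hEexp : ∀ τ, E τ = Complex.exp ((σ + τ * Complex.I) * L) :=
    fun τ => ofReal_cpow_neg_eq_exp ht _
  have hEn : ∀ τ, ‖E τ‖ = Real.exp (σ * L) := fun τ => by rw [hEexp, norm_exp_add_mul_I]
  have hpre : ∀ τ, (p τ).re = σ + b := fun τ => by simp [hp]
  have hpne : ∀ τ, p τ ≠ 0 := fun τ h => by
    have := hpre τ
    rw [h] at this
    simp at this; linarith
  have hEd : ∀ τ, HasDerivAt E (E τ * (Complex.I * L)) τ := fun τ => by
    have h1 : HasDerivAt (fun τ : ℝ => Complex.exp ((σ + τ * Complex.I) * L))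
        (Complex.exp ((σ + τ * Complex.I) * L) * (Complex.I * L)) τ :=
      (((hasDerivAt_ofReal_mul_I τ).const_add (σ : ℂ)).mul_const (L : ℂ)).cexp
    rw [hEexp]
    exact h1.congr_of_eventuallyEq (Eventually.of_forall hEexp)
  have hpd : ∀ τ, HasDerivAt p Complex.I τ := fun τ =>
    ((hasDerivAt_ofReal_mul_I τ).const_add (σ : ℂ)).add_const (b : ℂ)
  have hEc : Continuous E := continuous_iff_continuousAt.2 fun τ => (hEd τ).continuousAt
  have hpc : Continuous p := continuous_iff_continuousAt.2 fun τ => (hpd τ).continuousAt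
  have c1 : Continuous fun τ => E τ / p τ := hEc.div hpc hpne
  have c2 : Continuous fun τ => E τ / p τ ^ 2 := hEc.div (hpc.pow 2) fun τ => pow_ne_zero 2 (hpne τ)
  have hparts : ∀ T : ℝ, ∫ τ in (-T)..T, E τ / p τ = (E T / p T - E (-T) / p (-T)) / (Complex.I * L)
      + (∫ τ in (-T)..T, E τ / p τ ^ 2) / L := fun T => by
    have h1 : ∫ τ in (-T)..T, (Complex.I * L * (E τ / p τ) - Complex.I * (E τ / p τ ^ 2)) =
        E T / p T - E (-T) / p (-T) := by
      refine intervalIntegral.integral_eq_sub_of_hasDerivAt (f := fun τ => E τ / p τ)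
        (fun τ _ => ?_) (Continuous.intervalIntegrable (by fun_prop) _ _)
      refine ((hEd τ).div (hpd τ) (hpne τ)).congr_deriv ?_
      have := hpne τ
      field_simp
    rw [intervalIntegral.integral_sub ((c1.const_mul _).intervalIntegrable _ _)
      ((c2.const_mul _).intervalIntegrable _ _), intervalIntegral.integral_const_mul,
      intervalIntegral.integral_const_mul] at h1
    rw [← h1]
    field_simp
    ring
  have hbd : Tendsto (fun τ => E τ / p τ) (cocompact ℝ) (𝓝 0) := by
    refine squeeze_zero_norm' (a := fun τ => Real.exp (σ * L) / |τ|) ?_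
      (tendsto_const_nhds.div_atTop (tendsto_norm_cocompact_atTop (E := ℝ)))
    filter_upwards [(tendsto_norm_cocompact_atTop (E := ℝ)).eventually_gt_atTop 0] with τ hτ
    rw [Real.norm_eq_abs] at hτ
    have : |τ| ≤ ‖p τ‖ := by
      have := Complex.abs_im_le_norm (p τ)
      simpa [hp] using this
    rw [norm_div, hEn]
    gcongr
  have hint : Integrable fun τ => E τ / p τ ^ 2 :=
    (integrable_inv_add_mul_I_sq hb).bdd_mul hEc.aestronglyMeasurable
      (ae_of_all _ fun τ => (hEn τ).le)
  have hlim := intervalIntegral_tendsto_integral hint tendsto_neg_atTop_atBot tendsto_id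
  rw [integral_cpow_div_add_sq hb ht ht1] at hlim
  have hb1 : Tendsto (fun T => E T / p T) atTop (𝓝 0) := hbd.mono_left atTop_le_cocompact
  have hb2 : Tendsto (fun T => E (-T) / p (-T)) atTop (𝓝 0) :=
    (hbd.mono_left atBot_le_cocompact).comp tendsto_neg_atTop_atBot
  have h := ((hb1.sub hb2).div_const (Complex.I * L)).add (hlim.div_const (L : ℂ))
  refine (h.congr fun T => (hparts T).symm).trans (le_of_eq (congrArg 𝓝 ?_))
  rw [← hL, sub_self, zero_div, zero_add]
  push_cast
  field_simp

theorem conj_coeffRemainder (ε u : ℝ) (s : ℂ) :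
    (starRingEnd ℂ) (coeffRemainder ε u s) = coeffRemainder ε u ((starRingEnd ℂ) s) := by
  simp [coeffRemainder, coeffDen, conj_besselRatio, map_ofNat]

/-- The inverse Mellin transform of the harmonic coefficients. -/
noncomputable def coeffGenFun (ε u : ℝ) : GenFun where
  atom := (ε - 1) / (ε + 1)
  density t := ε * (ε - 1) / (ε + 1) ^ 2 * t ^ (1 / (ε + 1)) +
    (inverseLaplace (coeffRemainder ε u) (-Real.log t)).re

section

variable {ε u : ℝ}

theorem ofReal_density_coeffGenFun {t : ℝ} (ht : 0 < t) :
    ((coeffGenFun ε u).density t : ℂ) =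
      (ε * (ε - 1) / (ε + 1) ^ 2 : ℝ) * (t : ℂ) ^ ((1 / (ε + 1) : ℝ) : ℂ) +
        inverseLaplace (coeffRemainder ε u) (-Real.log t) := by
  have h := Complex.conj_eq_iff_re.1 (LaplaceSymbol.conj_inverseLaplace
    (fun s _ => conj_coeffRemainder ε u s) (-Real.log t))
  rw [coeffGenFun, Complex.ofReal_add, h, Complex.ofReal_mul, Complex.ofReal_cpow ht.le]

/-- The power of `t` has transform `1/(s+b)`, and the other summand reproduces the remainder by the
Laplace inversion formula. The integral over `y ≥ 0` is the full one, since the inverse transform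
vanishes for `y ≤ 0`. -/
theorem isFiniteMellinTransform_coeffGenFun (hε : 0 < ε) (hu : 0 < u) :
    IsFiniteMellinTransform (coeffGenFun ε u) (harmonicCoeff ε u) := by
  obtain ⟨C, hC⟩ := exists_laplaceSymbol_coeffRemainder hε hu
  intro s hs
  set a : ℂ := ((ε * (ε - 1) / (ε + 1) ^ 2 : ℝ) : ℂ) with ha
  set b : ℝ := 1 / (ε + 1) with hb
  have hb0 : 0 < b := by positivity
  set h := inverseLaplace (coeffRemainder ε u) with hh
  have hcongr : ∀ t ∈ Set.Ioc (0 : ℝ) 1,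
      ((coeffGenFun ε u).density t : ℂ) * (t : ℂ) ^ (s - 1) =
        a * ((t : ℂ) ^ (b : ℂ) * (t : ℂ) ^ (s - 1)) +
          h (-Real.log t) * (t : ℂ) ^ (s - 1) := fun t ht => by
    rw [ofReal_density_coeffGenFun ht.1]
    ring
  obtain ⟨m1, m2⟩ := hasMellin_cpow_Ioc (b : ℂ) (s := s) (by simp; linarith)
  have hind : ∀ t : ℝ, (t : ℂ) ^ (s - 1) •
      Set.indicator (Set.Ioc (0 : ℝ) 1) (fun t : ℝ => (t : ℂ) ^ (b : ℂ)) t =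
      Set.indicator (Set.Ioc (0 : ℝ) 1) (fun t : ℝ => (t : ℂ) ^ (b : ℂ) * (t : ℂ) ^ (s - 1)) t :=
    fun t => by
      by_cases ht : t ∈ Set.Ioc (0 : ℝ) 1
      · simp only [Set.indicator_of_mem ht, smul_eq_mul, mul_comm]
      · simp only [Set.indicator_of_notMem ht, smul_zero]
  have hsub : Set.Ioi (0 : ℝ) ∩ Set.Ioc 0 1 = Set.Ioc 0 1 :=
    Set.inter_eq_right.2 fun t ht => ht.1
  rw [MellinConvergent] at m1
  rw [mellin] at m2
  simp_rw [hind] at m1 m2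
  rw [integrableOn_indicator_iff measurableSet_Ioc, Set.inter_comm, hsub] at m1
  rw [setIntegral_indicator measurableSet_Ioc, hsub] at m2
  have n1 : IntegrableOn (fun t : ℝ => h (-Real.log t) * (t : ℂ) ^ (s - 1)) (Set.Ioc 0 1) :=
    (integrableOn_neg_log_mul_cpow_iff h s).2
      (hC.integrable_exp_neg_mul_inverseLaplace hs).integrableOn
  have n2 : ∫ t in Set.Ioc (0 : ℝ) 1, h (-Real.log t) * (t : ℂ) ^ (s - 1) =
      coeffRemainder ε u s := by
    rw [integral_neg_log_mul_cpow, hC.eq_laplace hs]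
    refine setIntegral_eq_integral_of_forall_compl_eq_zero fun y hy => ?_
    rw [hh, hC.inverseLaplace_eq_zero_of_nonpos (le_of_not_ge hy), mul_zero]
  refine ⟨IntegrableOn.congr_fun ((m1.const_mul a).add n1) (fun t ht => (hcongr t ht).symm)
    measurableSet_Ioc, ?_⟩
  rw [setIntegral_congr_fun measurableSet_Ioc hcongr, integral_add (m1.const_mul a) n1,
    integral_const_mul, m2, n2, harmonicCoeff_eq_add_coeffRemainder hε hu hs, coeffGenFun]
  ring

theorem isInverseMellinTransform_coeffGenFun (hε : 0 < ε) (hu : 0 < u) :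
    IsInverseMellinTransform (coeffGenFun ε u) (harmonicCoeff ε u) := by
  obtain ⟨C, hC⟩ := exists_laplaceSymbol_coeffRemainder hε hu
  intro σ hσ
  set a : ℂ := ((ε * (ε - 1) / (ε + 1) ^ 2 : ℝ) : ℂ) with ha
  set b : ℝ := 1 / (ε + 1) with hb
  have hb0 : 0 < b := by positivity
  set h := inverseLaplace (coeffRemainder ε u) with hh
  have hM : ∀ τ : ℝ, harmonicCoeff ε u (σ + τ * Complex.I) = ((coeffGenFun ε u).atom : ℂ) +
      a / (σ + τ * Complex.I + b) + coeffRemainder ε u (σ + τ * Complex.I) := fun τ =>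
    harmonicCoeff_eq_add_coeffRemainder hε hu (by simpa using hσ.le)
  have hne : ∀ τ : ℝ, (σ + τ * Complex.I + b : ℂ) ≠ 0 := fun τ h => by
    have := congrArg Complex.re h
    simp at this; linarith
  constructor
  · have h1 : Tendsto (fun τ : ℝ => a / (σ + τ * Complex.I + b) +
        coeffRemainder ε u (σ + τ * Complex.I)) (cocompact ℝ) (𝓝 0) := by
      refine squeeze_zero_norm' (a := fun τ => (‖a‖ + C) / |τ|) ?_
        (tendsto_const_nhds.div_atTop (tendsto_norm_cocompact_atTop (E := ℝ)))
      filter_upwards [(tendsto_norm_cocompact_atTop (E := ℝ)).eventually_gt_atTop 0] with τ hτ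
      rw [Real.norm_eq_abs] at hτ
      have e1 : |τ| ≤ ‖(σ + τ * Complex.I + b : ℂ)‖ := by
        simpa using Complex.abs_im_le_norm (σ + τ * Complex.I + b : ℂ)
      have e2 := hC.norm_le (σ + τ * Complex.I) (by simpa using hσ.le)
      have e3 := abs_le_norm_add_mul_I σ τ
      have hC0 := hC.nonneg
      calc _ ≤ ‖a‖ / |τ| + C / |τ| := by
            refine (norm_add_le _ _).trans (add_le_add ?_ (e2.trans ?_))
            · rw [norm_div]; gcongr
            · gcongr; linarith
        _ = _ := by ring
    have h2 := h1.const_add ((coeffGenFun ε u).atom : ℂ)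
    rw [add_zero] at h2
    refine h2.congr fun τ => ?_
    rw [hM]
    ring
  · intro t ht ht1
    set L : ℝ := -Real.log t with hL
    have p1 := (tendsto_integral_cpow_div_add (b := b) (σ := σ) (by linarith) ht ht1).const_mul a
    have p2 := hC.tendsto_segmentIntegral hσ.le L
    have p3 := (p1.add p2).const_mul (1 / (2 * Real.pi) : ℂ)
    have hpi : (Real.pi : ℂ) ≠ 0 := by exact_mod_cast Real.pi_ne_zero
    have hlim : (1 / (2 * Real.pi) : ℂ) * (a * (2 * Real.pi * (t ^ b : ℝ)) +
        2 * Real.pi * inverseLaplace (coeffRemainder ε u) L) =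
        ((coeffGenFun ε u).density t : ℂ) := by
      rw [ofReal_density_coeffGenFun ht, ← Complex.ofReal_cpow ht.le]
      rw [← ha, ← hb, ← hL]
      field_simp
    rw [hlim] at p3
    refine p3.congr fun T => ?_
    congr 1
    rw [segmentIntegral, ← intervalIntegral.integral_const_mul, ← intervalIntegral.integral_add]
    · refine intervalIntegral.integral_congr fun τ _ => ?_
      rw [hM, ofReal_cpow_neg_eq_exp ht]
      ring
    · simp_rw [ofReal_cpow_neg_eq_exp ht]
      exact Continuous.intervalIntegrable (by fun_prop (disch := exact hne _)) _ _
    · exact ((hC.continuous_line hσ.le).mul (by fun_prop)).intervalIntegrable _ _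

theorem isFiniteMellinPair_coeffGenFun (hε : 0 < ε) (hu : 0 < u) :
    IsFiniteMellinPair (coeffGenFun ε u) (harmonicCoeff ε u) :=
  ⟨isFiniteMellinTransform_coeffGenFun hε hu, isInverseMellinTransform_coeffGenFun hε hu⟩

end

/-! ### Legendre polynomials -/

section

open Polynomial

/-- In Rodrigues' formula the `n`-th derivative at `x` is `n!` times a Taylor coefficient, that is,
a coefficient of `((X + x)² - 1)^n`. -/
theorem eval_legendreP (n : ℕ) (x : ℝ) :
    (legendreP n).eval x = 1 / 2 ^ n * ((X ^ 2 + C (2 * x) * X + C (x ^ 2 - 1)) ^ n).coeff n := by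
  have h1 : (derivative^[n] ((X ^ 2 - 1 : ℝ[X]) ^ n)).eval x =
      (n.factorial : ℝ) * (hasseDeriv n ((X ^ 2 - 1 : ℝ[X]) ^ n)).eval x := by
    rw [← factorial_smul_hasseDeriv]
    simp
  have h2 : taylor x ((X ^ 2 - 1 : ℝ[X]) ^ n) = (X ^ 2 + C (2 * x) * X + C (x ^ 2 - 1)) ^ n := by
    rw [taylor_pow]
    congr 1
    simp only [map_sub, taylor_pow, taylor_X, taylor_one, C_mul, C_pow, C_1]
    have : (C 2 : ℝ[X]) = 2 := rfl
    rw [this]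
    ring
  rw [legendreP, eval_mul, eval_C, h1, ← taylor_coeff, h2]
  have : (n.factorial : ℝ) ≠ 0 := by positivity
  field_simp

/-- The polynomial `(ρ X²/2 + x X - ρ/2)ⁿ`, whose middle coefficient is `P_n(x)` if
`x² + ρ² = 1`. -/
noncomputable def laplacePoly (x ρ : ℝ) (n : ℕ) : ℝ[X] :=
  (C (ρ / 2) * X ^ 2 + C x * X - C (ρ / 2)) ^ n

/-- For `ρ ≠ 0` the scaling `X ↦ ρ X` makes the two quadratic polynomials proportional, because `x²
- 1 = -ρ²`. For `ρ = 0` both sides are powers of `x`. -/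
theorem coeff_laplacePoly {x ρ : ℝ} (h : x ^ 2 + ρ ^ 2 = 1) (n : ℕ) :
    (laplacePoly x ρ n).coeff n = (legendreP n).eval x := by
  rw [eval_legendreP]
  rcases eq_or_ne ρ 0 with rfl | hρ
  · have h1 : (X ^ 2 + C (2 * x) * X + C (x ^ 2 - 1) : ℝ[X]) = X * (X + C (2 * x)) := by
      have : x ^ 2 - 1 = 0 := by linarith
      rw [this, C_0]
      ring
    have h2 : laplacePoly x 0 n = C (x ^ n) * X ^ n := by
      simp [laplacePoly, mul_pow]
    rw [h1, h2, mul_pow, coeff_C_mul_X_pow, if_pos rfl, coeff_X_pow_mul', if_pos le_rfl,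
      Nat.sub_self, coeff_zero_eq_eval_zero]
    simp [mul_pow]
  · have h1 : ((X ^ 2 + C (2 * x) * X + C (x ^ 2 - 1) : ℝ[X]) ^ n).comp (C ρ * X) =
        C ((2 * ρ) ^ n) * laplacePoly x ρ n := by
      rw [laplacePoly, C_pow, ← mul_pow, pow_comp]
      congr 1
      have e : x ^ 2 - 1 = -(ρ ^ 2) := by linarith
      have e2 : (C ρ : ℝ[X]) = 2 * C (ρ / 2) := by
        rw [show (2 : ℝ[X]) = C 2 from rfl, ← C_mul]
        congr 1; ring
      rw [e]
      simp only [add_comp, mul_comp, X_comp, C_comp, pow_comp, C_mul, C_neg, C_pow, neg_comp]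
      rw [show (C 2 : ℝ[X]) = 2 from rfl, e2]
      ring
    have h2 := congrArg (fun p => p.coeff n) h1
    simp only [comp_C_mul_X_coeff, coeff_C_mul] at h2
    have h3 : ρ ^ n ≠ 0 := pow_ne_zero _ hρ
    rw [mul_pow] at h2
    have h4 : ((X ^ 2 + C (2 * x) * X + C (x ^ 2 - 1) : ℝ[X]) ^ n).coeff n =
        2 ^ n * (laplacePoly x ρ n).coeff n := by
      apply mul_right_cancel₀ h3
      rw [h2]; ring
    rw [h4]
    field_simp

theorem pow_eq_sum_laplacePoly (x ρ : ℝ) (n : ℕ) {ζ : ℂ} (hζ : ζ ≠ 0) :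
    (x + ρ * ((ζ - ζ⁻¹) / 2)) ^ n =
      ∑ k ∈ Finset.range (2 * n + 1), ((laplacePoly x ρ n).coeff k : ℂ) * ζ ^ ((k : ℤ) - n) := by
  have hdeg : (laplacePoly x ρ n).natDegree < 2 * n + 1 := by
    have h1 : (C (ρ / 2) * X ^ 2 + C x * X - C (ρ / 2) : ℝ[X]).natDegree ≤ 2 := by compute_degree
    have := natDegree_pow_le_of_le n h1
    rw [laplacePoly]; omega
  have h1 : aeval ζ (laplacePoly x ρ n) = ζ ^ n * (x + ρ * ((ζ - ζ⁻¹) / 2)) ^ n := by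
    rw [laplacePoly, map_pow, ← mul_pow]
    congr 1
    simp
    field_simp
    ring
  have h2 : (x + ρ * ((ζ - ζ⁻¹) / 2) : ℂ) ^ n = aeval ζ (laplacePoly x ρ n) / ζ ^ n := by
    rw [h1]; field_simp
  rw [h2, aeval_eq_sum_range' hdeg, Finset.sum_div]
  refine Finset.sum_congr rfl fun k _ => ?_
  rw [zpow_sub₀ hζ, zpow_natCast, zpow_natCast, Complex.real_smul, mul_div_assoc]

end

/-- Since `|k - n| ≤ n < n + 1`, the only exponent divisible by `n + 1` is `0`. Hence `n + 1` points
suffice to extract the constant term of the Laurent polynomial exactly. -/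
theorem sum_zpow_rootOfUnity {n k : ℕ} (hk : k < 2 * n + 1) (v : ℂ) {η : ℂ}
    (hη : IsPrimitiveRoot η (n + 1)) :
    ∑ j ∈ Finset.range (n + 1), (v * η ^ j) ^ ((k : ℤ) - n) = if k = n then (n + 1 : ℂ) else 0 := by
  split_ifs with h
  · subst h; simp
  · have hη0 : η ≠ 0 := hη.ne_zero (by omega)
    set z := η ^ ((k : ℤ) - n) with hz
    have h1 : ∀ j : ℕ, (v * η ^ j) ^ ((k : ℤ) - n) = v ^ ((k : ℤ) - n) * z ^ j := fun j => by
      rw [mul_zpow, hz, ← zpow_natCast, ← zpow_natCast, ← zpow_mul, ← zpow_mul, mul_comm (j : ℤ)]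
    have hz1 : z ≠ 1 := by
      intro h1
      have h2 := (hη.zpow_eq_one_iff_dvd _).1 h1
      obtain ⟨m, hm⟩ := h2
      push_cast at hm
      rcases lt_trichotomy m 0 with hm0 | hm0 | hm0
      · nlinarith
      · subst hm0; omega
      · nlinarith
    have hz2 : z ^ (n + 1) = 1 := by
      rw [hz, ← zpow_natCast, ← zpow_mul, mul_comm, zpow_mul, zpow_natCast, hη.pow_eq_one, one_zpow]
    simp_rw [h1]
    rw [← Finset.mul_sum, geom_sum_eq hz1, hz2]
    simp

/-- Laplace's formula for the Legendre polynomials, with an average over `n + 1` points. -/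
theorem legendreP_eq_average {x ρ : ℝ} (h : x ^ 2 + ρ ^ 2 = 1) (n : ℕ) {v : ℂ} (hv : v ≠ 0) {η : ℂ}
    (hη : IsPrimitiveRoot η (n + 1)) :
    (((legendreP n).eval x : ℝ) : ℂ) = 1 / (n + 1 : ℂ) * ∑ j ∈ Finset.range (n + 1),
      (x + ρ * ((v * η ^ j - (v * η ^ j)⁻¹) / 2)) ^ n := by
  have hη0 : η ≠ 0 := hη.ne_zero (by omega)
  have h1 : ∀ j : ℕ, v * η ^ j ≠ 0 := fun j => mul_ne_zero hv (pow_ne_zero _ hη0)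
  simp_rw [fun j => pow_eq_sum_laplacePoly x ρ n (h1 j)]
  rw [Finset.sum_comm]
  simp_rw [← Finset.mul_sum]
  have h2 : ∀ k ∈ Finset.range (2 * n + 1), ((laplacePoly x ρ n).coeff k : ℂ) *
      ∑ j ∈ Finset.range (n + 1), (v * η ^ j) ^ ((k : ℤ) - n) =
      if k = n then ((laplacePoly x ρ n).coeff k : ℂ) * (n + 1 : ℂ) else 0 := fun k hk => by
    rw [sum_zpow_rootOfUnity (Finset.mem_range.1 hk) v hη, mul_ite, mul_zero]
  rw [Finset.sum_congr rfl h2, Finset.sum_ite_eq', if_pos (by simp; omega), coeff_laplacePoly h]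
  have : (n + 1 : ℂ) ≠ 0 := by exact_mod_cast n.succ_ne_zero
  field_simp

/-- On the unit circle `(ζ - ζ⁻¹)/2` is `i Im ζ`, so the squared modulus is `x² + ρ² (Im ζ)²`. -/
theorem norm_laplace_le {x ρ : ℝ} (h : x ^ 2 + ρ ^ 2 = 1) {ζ : ℂ} (hζ : ‖ζ‖ = 1) :
    ‖(x + ρ * ((ζ - ζ⁻¹) / 2) : ℂ)‖ ≤ 1 := by
  rw [Complex.inv_eq_conj hζ, Complex.sub_conj]
  have e : (x + ρ * (((2 * ζ.im : ℝ) : ℂ) * Complex.I / 2) : ℂ) =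
      (x : ℂ) + ((ρ * ζ.im : ℝ) : ℂ) * Complex.I := by push_cast; ring
  rw [e, ← sq_le_one_iff₀ (norm_nonneg _), ← Complex.normSq_eq_norm_sq, Complex.normSq_add_mul_I]
  have h1 : ζ.im ^ 2 ≤ 1 := by
    have := Complex.abs_im_le_norm ζ
    rw [hζ] at this
    exact (sq_le_one_iff_abs_le_one _).2 this
  nlinarith [sq_nonneg ρ]

theorem abs_legendreP_le_one {x : ℝ} (hx : |x| ≤ 1) (n : ℕ) : |(legendreP n).eval x| ≤ 1 := by
  set ρ := Real.sqrt (1 - x ^ 2) with hρ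
  have h : x ^ 2 + ρ ^ 2 = 1 := by
    rw [hρ, Real.sq_sqrt (by have := (sq_le_one_iff_abs_le_one x).2 hx; linarith)]; ring
  have hη := Complex.isPrimitiveRoot_exp (n + 1) n.succ_ne_zero
  have h1 := legendreP_eq_average h n one_ne_zero hη
  rw [← Real.norm_eq_abs, ← Complex.norm_real, h1, norm_mul]
  have h2 : ‖(1 / (n + 1) : ℂ)‖ = 1 / (n + 1) := by
    rw [norm_div, norm_one, ← Nat.cast_succ, Complex.norm_natCast, Nat.cast_succ]
  have h3 : ‖∑ j ∈ Finset.range (n + 1), ((x : ℂ) + ρ * ((1 * Complex.exp (2 * Real.pi * Complex.I /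
      ((n + 1 : ℕ) : ℂ)) ^ j - (1 * Complex.exp (2 * Real.pi * Complex.I / ((n + 1 : ℕ) : ℂ)) ^ j)⁻¹)
        / 2)) ^ n‖ ≤ n + 1 := by
    refine (norm_sum_le _ _).trans ?_
    calc _ ≤ ∑ j ∈ Finset.range (n + 1), (1 : ℝ) := by
          refine Finset.sum_le_sum fun j _ => ?_
          rw [norm_pow]
          refine pow_le_one₀ (norm_nonneg _) (norm_laplace_le h ?_)
          rw [one_mul, norm_pow, hη.norm'_eq_one n.succ_ne_zero, one_pow]
      _ = _ := by simp
  rw [h2]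
  calc _ ≤ 1 / ((n : ℝ) + 1) * (n + 1) := by gcongr
    _ = 1 := by field_simp

/-- The mean value property for nonnegative powers; the inversion `ζ ↦ ζ⁻¹` of the circle for the
others. -/
theorem circleAverage_zpow (m : ℤ) :
    Real.circleAverage (fun ζ : ℂ => ζ ^ m) 0 1 = if m = 0 then 1 else 0 := by
  have key : ∀ k : ℕ, Real.circleAverage (fun ζ : ℂ => ζ ^ k) 0 1 = 0 ^ k := fun k =>
    DiffContOnCl.circleAverage (f := fun ζ : ℂ => ζ ^ k)
      (Differentiable.diffContOnCl (by fun_prop))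
  rcases Int.eq_nat_or_neg m with ⟨k, rfl | rfl⟩
  · simp_rw [zpow_natCast]
    rw [key]
    rcases eq_or_ne k 0 with rfl | h <;> simp [*]
  · have h : (fun ζ : ℂ => ζ ^ (-(k : ℤ))) = fun ζ => (fun z : ℂ => z ^ k) ζ⁻¹ := by
      ext ζ; simp
    rw [h, Real.circleAverage_zero_one_congr_inv (f := fun z : ℂ => z ^ k), key]
    rcases eq_or_ne k 0 with rfl | h <;> simp [*]

/-- Laplace's formula for the Legendre polynomials. -/
theorem legendreP_eq_circleAverage {x ρ : ℝ} (h : x ^ 2 + ρ ^ 2 = 1) (n : ℕ) :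
    (((legendreP n).eval x : ℝ) : ℂ) =
      Real.circleAverage (fun ζ : ℂ => (x + ρ * ((ζ - ζ⁻¹) / 2)) ^ n) 0 1 := by
  have h1 : Set.EqOn (fun ζ : ℂ => (x + ρ * ((ζ - ζ⁻¹) / 2)) ^ n) (∑ k ∈ Finset.range (2 * n + 1),
      fun ζ : ℂ => ((laplacePoly x ρ n).coeff k : ℂ) * ζ ^ ((k : ℤ) - n))
      (Metric.sphere (0 : ℂ) |1|) := fun ζ hζ => by
    rw [Finset.sum_apply]
    refine pow_eq_sum_laplacePoly x ρ n fun h0 => ?_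
    simp [h0] at hζ
  have hc : ∀ (m : ℤ) (c : ℂ), CircleIntegrable (fun ζ : ℂ => c * ζ ^ m) 0 1 := fun m c => by
    refine ContinuousOn.circleIntegrable zero_le_one fun ζ hζ => ?_
    have h0 : ζ ≠ 0 := fun h0 => by simp [h0] at hζ
    exact (continuousAt_const.mul (continuousAt_zpow₀ _ _ (Or.inl h0))).continuousWithinAt
  rw [Real.circleAverage_congr_sphere h1, Real.circleAverage_sum fun k _ => hc _ _]
  have h2 : ∀ k : ℕ, Real.circleAverage (fun ζ : ℂ => ((laplacePoly x ρ n).coeff k : ℂ) *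
      ζ ^ ((k : ℤ) - n)) 0 1 = if k = n then ((laplacePoly x ρ n).coeff k : ℂ) else 0 := fun k => by
    have := Real.circleAverage_fun_smul (a := ((laplacePoly x ρ n).coeff k : ℂ))
      (f := fun ζ : ℂ => ζ ^ ((k : ℤ) - n)) (c := 0) (R := 1)
    simp only [smul_eq_mul] at this
    rw [this, circleAverage_zpow]
    simp [sub_eq_zero]
  simp_rw [h2]
  rw [Finset.sum_ite_eq', if_pos (by simp; omega), coeff_laplacePoly h]

theorem circleAverage_inv_one_add_mul {q : ℝ} (hq : |q| < 1) :
    Real.circleAverage (fun ζ : ℂ => (1 + q * ζ)⁻¹) 0 1 = 1 := by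
  have h : DiffContOnCl ℂ (fun ζ : ℂ => (1 + q * ζ)⁻¹) (Metric.ball 0 |1|) := by
    refine DifferentiableOn.diffContOnCl_ball (U := Metric.closedBall 0 1) (fun ζ hζ => ?_) (by simp)
    have h0 : (1 + q * ζ : ℂ) ≠ 0 := fun h0 => by
      have h1 : (q : ℂ) * ζ = -1 := by linear_combination h0
      have h2 := congrArg norm h1
      rw [norm_mul, norm_neg, norm_one, Complex.norm_real, Real.norm_eq_abs] at h2
      have h3 : ‖ζ‖ ≤ 1 := by simpa using hζ
      nlinarith [abs_nonneg q, norm_nonneg ζ]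
    have h1 : DifferentiableAt ℂ (fun ζ : ℂ => 1 + q * ζ) ζ := by fun_prop
    exact (h1.fun_inv h0).differentiableWithinAt
  rw [h.circleAverage]
  simp

theorem circleAverage_inv_add {A B : ℝ} (hA : 0 < A) :
    Real.circleAverage (fun ζ : ℂ => (A + B * ((ζ - ζ⁻¹) / 2))⁻¹) 0 1 =
      ((1 / Real.sqrt (A ^ 2 + B ^ 2) : ℝ) : ℂ) := by
  set S := Real.sqrt (A ^ 2 + B ^ 2) with hS
  have hSA : A ≤ S := Real.le_sqrt_of_sq_le (by nlinarith [sq_nonneg B])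
  have hS2 : S ^ 2 = A ^ 2 + B ^ 2 := Real.sq_sqrt (by positivity)
  have hS0 : 0 < S := by linarith
  -- With this `q` one has `A + B(ζ - ζ⁻¹)/2 = (S+A)/2 · (1 + qζ)(1 - qζ⁻¹)` and `|q| < 1`. Partial
  -- fractions then leave two terms, in `ζ` and in `ζ⁻¹`, each of mean `1`.
  set q := B / (S + A) with hq
  have hBq : B = q * (S + A) := by rw [hq]; field_simp
  have hSB : |B| ≤ S := Real.abs_le_sqrt (by nlinarith [sq_nonneg A])
  have hq1 : |q| < 1 := by
    rw [hq, abs_div, abs_of_pos (by linarith : 0 < S + A), div_lt_one (by linarith)]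
    linarith
  have hAq : 2 * A = (S + A) * (1 - q ^ 2) := by
    rw [hq]; field_simp; nlinarith
  have hq2 : (S + A) * (1 + q ^ 2) = 2 * S := by linarith
  have hq1' : |-q| < 1 := by rwa [abs_neg]
  have hne : ∀ (p : ℝ), |p| < 1 → ∀ ζ : ℂ, ‖ζ‖ = 1 → (1 + p * ζ : ℂ) ≠ 0 := fun p hp ζ hζ h0 => by
    have h2 := congrArg norm (show (p : ℂ) * ζ = -1 by linear_combination h0)
    rw [norm_mul, norm_neg, norm_one, Complex.norm_real, Real.norm_eq_abs, hζ] at h2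
    linarith
  have hint : ∀ (p : ℝ), |p| < 1 → CircleIntegrable (fun ζ : ℂ => (1 + p * ζ)⁻¹) 0 1 :=
    fun p hp => ContinuousOn.circleIntegrable zero_le_one fun ζ hζ => by
      have h1 : ContinuousAt (fun ζ : ℂ => 1 + p * ζ) ζ := by fun_prop
      exact (h1.inv₀ (hne p hp ζ (by simpa using hζ))).continuousWithinAt
  have hint' : CircleIntegrable (fun ζ : ℂ => (1 + ((-q : ℝ) : ℂ) * ζ⁻¹)⁻¹) 0 1 :=
    ContinuousOn.circleIntegrable zero_le_one fun ζ hζ => by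
      have hζ1 : ‖ζ‖ = 1 := by simpa using hζ
      have hζ0 : ζ ≠ 0 := fun h => by simp [h] at hζ1
      have h1 : ContinuousAt (fun ζ : ℂ => 1 + ((-q : ℝ) : ℂ) * ζ⁻¹) ζ :=
        continuousAt_const.add (continuousAt_const.mul (continuousAt_inv₀ hζ0))
      exact (h1.inv₀ (hne _ hq1' _ (by rw [norm_inv, hζ1, inv_one]))).continuousWithinAt
  have hpartial : Set.EqOn (fun ζ : ℂ => (A + B * ((ζ - ζ⁻¹) / 2))⁻¹)
      (((1 / S : ℝ) : ℂ) • ((fun ζ : ℂ => (1 + q * ζ)⁻¹) +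
        ((fun ζ : ℂ => (1 + ((-q : ℝ) : ℂ) * ζ⁻¹)⁻¹) + fun _ => (-1 : ℂ)))) (Metric.sphere 0 |1|) :=
    fun ζ hζ => by
      have hζ1 : ‖ζ‖ = 1 := by simpa using hζ
      have hζ0 : ζ ≠ 0 := fun h => by simp [h] at hζ1
      have n1 := hne q hq1 ζ hζ1
      have n2 := hne (-q) hq1' ζ⁻¹ (by rw [norm_inv, hζ1, inv_one])
      have n3 : (S : ℂ) ≠ 0 := by exact_mod_cast hS0.ne'
      have e1 : (2 * A : ℂ) = (S + A) * (1 - q ^ 2) := by exact_mod_cast hAq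
      have e2 : (B : ℂ) = q * (S + A) := by exact_mod_cast hBq
      have e3 : ((S : ℂ) + A) * (1 + q ^ 2) = 2 * S := by exact_mod_cast hq2
      have hSA0 : (S + A : ℂ) ≠ 0 := by
        have : S + A ≠ 0 := by linarith
        exact_mod_cast this
      have e4 : (A + B * ((ζ - ζ⁻¹) / 2) : ℂ) =
          (S + A) / 2 * ((1 + q * ζ) * (1 + ((-q : ℝ) : ℂ) * ζ⁻¹)) := by
        push_cast
        have : ζ * ζ⁻¹ = 1 := mul_inv_cancel₀ hζ0
        linear_combination (1 / 2 : ℂ) * e1 + (ζ - ζ⁻¹) / 2 * e2 + (S + A) / 2 * q ^ 2 * this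
      simp only [Pi.smul_apply, Pi.add_apply, smul_eq_mul]
      rw [e4]
      have e5 : (1 + q * ζ : ℂ)⁻¹ + ((1 + ((-q : ℝ) : ℂ) * ζ⁻¹)⁻¹ + -1) =
          (1 + q ^ 2) / ((1 + q * ζ) * (1 + ((-q : ℝ) : ℂ) * ζ⁻¹)) := by
        rw [inv_eq_one_div, inv_eq_one_div, eq_div_iff (mul_ne_zero n1 n2)]
        have e6 : (1 / (1 + q * ζ) + (1 / (1 + ((-q : ℝ) : ℂ) * ζ⁻¹) + -1)) *
            ((1 + q * ζ) * (1 + ((-q : ℝ) : ℂ) * ζ⁻¹)) = (1 + ((-q : ℝ) : ℂ) * ζ⁻¹) + (1 + q * ζ) -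
            (1 + q * ζ) * (1 + ((-q : ℝ) : ℂ) * ζ⁻¹) := by
          generalize (1 + q * ζ : ℂ) = a at *
          generalize (1 + ((-q : ℝ) : ℂ) * ζ⁻¹) = b at *
          field_simp
          ring
        rw [e6]
        push_cast
        have : ζ * ζ⁻¹ = 1 := mul_inv_cancel₀ hζ0
        linear_combination (q : ℂ) ^ 2 * this
      rw [e5]
      push_cast
      have n4 : (1 + q ^ 2 : ℂ) ≠ 0 := fun h => by rw [h, mul_zero] at e3; simp [n3] at e3
      generalize (1 + q * ζ : ℂ) = a at *
      push_cast at n2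
      generalize (1 + -(q : ℂ) * ζ⁻¹) = b at *
      field_simp
      linear_combination -e3
  rw [Real.circleAverage_congr_sphere hpartial, Real.circleAverage_smul, Real.circleAverage_add
    (hint q hq1) (hint'.add (circleIntegrable_const _ _ _)), Real.circleAverage_add hint'
    (circleIntegrable_const _ _ _), circleAverage_inv_one_add_mul hq1,
    Real.circleAverage_zero_one_congr_inv (f := fun ζ : ℂ => (1 + ((-q : ℝ) : ℂ) * ζ)⁻¹),
    circleAverage_inv_one_add_mul hq1', Real.circleAverage_const]
  simp

/-- The generating function of the Legendre polynomials. -/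
theorem hasSum_legendreP {y r x : ℝ} (hy : |y| ≤ 1) (hr : 0 ≤ r) (hrx : r < x) :
    HasSum (fun n : ℕ => r ^ n / x ^ (n + 1) * (legendreP n).eval y)
      (1 / Real.sqrt (x ^ 2 - 2 * x * r * y + r ^ 2)) := by
  set ρ := Real.sqrt (1 - y ^ 2) with hρ
  have h : y ^ 2 + ρ ^ 2 = 1 := by
    rw [hρ, Real.sq_sqrt (by have := (sq_le_one_iff_abs_le_one y).2 hy; linarith)]; ring
  have hx : 0 < x := by linarith
  have hxc : (x : ℂ) ≠ 0 := by exact_mod_cast hx.ne'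
  have hA : 0 < x - r * y := by nlinarith [(abs_le.1 hy).2]
  have hsq : x ^ 2 - 2 * x * r * y + r ^ 2 = (x - r * y) ^ 2 + (-(r * ρ)) ^ 2 := by
    linear_combination -(r ^ 2) * h
  rw [hsq]
  rw [← Complex.hasSum_ofReal, ← circleAverage_inv_add hA]
  set c : ℂ → ℂ := fun ζ => y + ρ * ((ζ - ζ⁻¹) / 2) with hc
  have hterm : ∀ n : ℕ, ((r ^ n / x ^ (n + 1) * (legendreP n).eval y : ℝ) : ℂ) =
      Real.circleAverage (fun ζ : ℂ => (r / x) ^ n / x * c ζ ^ n) 0 1 := fun n => by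
    have := Real.circleAverage_fun_smul (a := ((r / x) ^ n / x : ℂ))
      (f := fun ζ : ℂ => c ζ ^ n) (c := 0) (R := 1)
    simp only [smul_eq_mul] at this
    rw [this, ← legendreP_eq_circleAverage h, div_pow]
    push_cast
    field_simp
    ring
  simp_rw [hterm, Real.circleAverage_def]
  refine HasSum.const_smul _ ?_
  have hζ : ∀ θ : ℝ, ‖circleMap 0 1 θ‖ = 1 := fun θ => by simp
  have hζ0 : ∀ θ : ℝ, circleMap 0 1 θ ≠ 0 := fun θ h0 => by have := hζ θ; simp [h0] at this
  have hcn : ∀ θ : ℝ, ‖c (circleMap 0 1 θ)‖ ≤ 1 := fun θ => norm_laplace_le h (hζ θ)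
  have hrx0 : 0 ≤ r / x := by positivity
  have hrx1 : r / x < 1 := (div_lt_one hx).2 hrx
  have hnr : ‖(r / x : ℂ)‖ = r / x := by
    rw [← Complex.ofReal_div, Complex.norm_real, Real.norm_of_nonneg hrx0]
  -- In Laplace's formula the series becomes geometric under the integral, dominated by `(r/x)^n /
  -- x`. Its sum is `(A + B(ζ - ζ⁻¹)/2)⁻¹` with `A = x - r y` and `B = -rρ`.
  refine intervalIntegral.hasSum_integral_of_dominated_convergence
    (fun n _ => (r / x) ^ n / x) (fun n => ?_) (fun n => ?_) ?_ ?_ ?_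
  · refine Continuous.aestronglyMeasurable ?_
    have : Continuous fun θ => (circleMap 0 1 θ)⁻¹ := (continuous_circleMap 0 1).inv₀ hζ0
    exact continuous_const.mul ((continuous_const.add (continuous_const.mul
      (((continuous_circleMap 0 1).sub this).div_const 2))).pow n)
  · refine ae_of_all _ fun θ _ => ?_
    rw [norm_mul, norm_div, norm_pow, norm_pow, hnr, Complex.norm_real, Real.norm_of_nonneg hx.le]
    exact mul_le_of_le_one_right (by positivity) (pow_le_one₀ (norm_nonneg _) (hcn θ))
  · exact ae_of_all _ fun θ _ => (summable_geometric_of_lt_one hrx0 hrx1).div_const x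
  · exact intervalIntegrable_const
  · refine ae_of_all _ fun θ _ => ?_
    have hlt : ‖(r / x : ℂ) * c (circleMap 0 1 θ)‖ < 1 := by
      rw [norm_mul, hnr]
      exact lt_of_le_of_lt (mul_le_of_le_one_right hrx0 (hcn θ)) hrx1
    have h1 := (hasSum_geometric_of_norm_lt_one hlt).div_const (x : ℂ)
    have e : (1 - (r / x : ℂ) * c (circleMap 0 1 θ))⁻¹ / x =
        (((x - r * y : ℝ) : ℂ) + ((-(r * ρ) : ℝ) : ℂ) *
          ((circleMap 0 1 θ - (circleMap 0 1 θ)⁻¹) / 2))⁻¹ := by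
      rw [div_eq_mul_inv, ← mul_inv, hc]
      congr 1
      push_cast
      field_simp
      ring
    rw [e] at h1
    refine h1.congr_fun fun n => ?_
    rw [mul_pow]; ring

/-! ### Zonal harmonics -/

/-- A harmonic function `Y` on space, homogeneous of degree `n`, with its first two derivatives. The
trace of the second derivative is taken in the orthonormal basis `b`. -/
structure IsHarmonicForm (b : OrthonormalBasis (Fin 3) ℝ Space) (n : ℕ) (Y : Space → ℝ)
    (Y' : Space → Space →L[ℝ] ℝ) (Y'' : Space → Space →L[ℝ] Space →L[ℝ] ℝ) : Prop where
  hasFDerivAt : ∀ r, HasFDerivAt Y (Y' r) r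
  hasFDerivAt' : ∀ r, HasFDerivAt Y' (Y'' r) r
  continuous : Continuous Y''
  norm_le : ∀ r, ‖Y r‖ ≤ ‖r‖ ^ n
  norm_le' : ∀ r, ‖Y' r‖ ≤ n * ‖r‖ ^ (n - 1)
  norm_le'' : ∀ r, ‖Y'' r‖ ≤ n ^ 2 * ‖r‖ ^ (n - 2)
  euler : ∀ r, Y' r r = n * Y r
  trace : ∀ r, ∑ i, Y'' r (b i) (b i) = 0

variable {b : OrthonormalBasis (Fin 3) ℝ Space}

/-- The Laplacian of `ω^n` is `n(n-1) ω^(n-2)` times the sum of the squares of the coefficients of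
`ω`, which vanishes for a null form. For `n ≤ 1` the coefficient `n(n-1)` is zero, so the truncated
exponents do no harm. -/
theorem isHarmonicForm_re_pow {ω : Space →L[ℝ] ℂ} (hω : ‖ω‖ ≤ 1) (hnull : ∑ i, ω (b i) ^ 2 = 0)
    (n : ℕ) : IsHarmonicForm b n (fun r => (ω r ^ n).re)
      (fun r => Complex.reCLM.comp ((n * ω r ^ (n - 1) : ℂ) • ω))
      (fun r => (ContinuousLinearMap.compL ℝ Space ℂ ℝ Complex.reCLM).comp
        ((n * ((n - 1 : ℕ) * ω r ^ (n - 1 - 1)) : ℂ) • ω.smulRight ω)) := by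
  have hpow : ∀ (m : ℕ) (r : Space), HasFDerivAt (fun r => ω r ^ m)
      ((m * ω r ^ (m - 1) : ℂ) • ω) r := fun m r => by
    have h := (ω.hasFDerivAt (x := r)).pow m
    refine h.congr_fderiv ?_
    ext v
    simp
  have hωr : ∀ r, ‖ω r‖ ≤ ‖r‖ := fun r =>
    (ω.le_opNorm r).trans (mul_le_of_le_one_left (norm_nonneg r) hω)
  have hp : ∀ (m : ℕ) (r : Space), ‖ω r ^ m‖ ≤ ‖r‖ ^ m := fun m r => by
    rw [norm_pow]
    exact pow_le_pow_left₀ (norm_nonneg _) (hωr r) m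
  have hre : ‖Complex.reCLM‖ ≤ 1 := Complex.reCLM_norm.le
  refine ⟨fun r => ?_, fun r => ?_, ?_, fun r => ?_, fun r => ?_, fun r => ?_, fun r => ?_,
    fun r => ?_⟩
  · exact Complex.reCLM.hasFDerivAt.comp r (hpow n r)
  · have h := ((hpow (n - 1) r).const_mul (n : ℂ)).smul_const ω
    have h2 := (ContinuousLinearMap.compL ℝ Space ℂ ℝ Complex.reCLM).hasFDerivAt.comp r h
    refine h2.congr_fderiv ?_
    ext v w
    simp [mul_assoc]
  · have h1 : Continuous fun r => (n * ((n - 1 : ℕ) * ω r ^ (n - 1 - 1)) : ℂ) := by fun_prop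
    exact continuous_const.clm_comp (h1.smul continuous_const)
  · exact (Complex.abs_re_le_norm _).trans (hp n r)
  · refine (ContinuousLinearMap.opNorm_comp_le _ _).trans ?_
    refine (mul_le_of_le_one_left (norm_nonneg _) hre).trans ?_
    rw [norm_smul, norm_mul, Complex.norm_natCast]
    calc _ ≤ n * ‖r‖ ^ (n - 1) * 1 := by gcongr; exact hp _ r
      _ = _ := mul_one _
  · have hc : ‖ContinuousLinearMap.compL ℝ Space ℂ ℝ Complex.reCLM‖ ≤ 1 := by
      refine ContinuousLinearMap.opNorm_le_bound _ zero_le_one fun f => ?_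
      exact (ContinuousLinearMap.opNorm_comp_le _ _).trans
        (mul_le_mul_of_nonneg_right hre (norm_nonneg _))
    have hK : ‖ω.smulRight ω‖ ≤ 1 := by
      refine ContinuousLinearMap.opNorm_le_bound _ zero_le_one fun v => ?_
      rw [ContinuousLinearMap.smulRight_apply, norm_smul]
      have h1 : ‖ω v‖ ≤ 1 * ‖v‖ := ω.le_of_opNorm_le hω v
      calc _ ≤ 1 * ‖v‖ * 1 := by gcongr
        _ = _ := mul_one _
    refine (ContinuousLinearMap.opNorm_comp_le _ _).trans ?_
    refine (mul_le_of_le_one_left (norm_nonneg _) hc).trans ?_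
    rw [norm_smul, norm_mul, norm_mul, Complex.norm_natCast, Complex.norm_natCast]
    calc _ ≤ n * (n * ‖r‖ ^ (n - 1 - 1)) * 1 := by
          gcongr
          · omega
          · exact hp _ r
      _ = _ := by rw [Nat.sub_sub]; ring
  · have h1 : (n * ω r ^ (n - 1) : ℂ) * ω r = n * ω r ^ n := by
      rcases n with _ | n
      · simp
      · simp [pow_succ, mul_assoc]
    simp only [ContinuousLinearMap.comp_apply, smul_apply, smul_eq_mul,
      h1, Complex.reCLM_apply]
    rw [← Complex.ofReal_natCast, Complex.re_ofReal_mul]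
  · simp only [ContinuousLinearMap.comp_apply, smul_apply, smul_eq_mul,
      ContinuousLinearMap.compL_apply, ContinuousLinearMap.smulRight_apply, Complex.reCLM_apply]
    rw [← Complex.re_sum]
    have : ∀ i, (n * ((n - 1 : ℕ) * ω r ^ (n - 1 - 1)) : ℂ) * (ω (b i) * ω (b i)) =
        (n * ((n - 1 : ℕ) * ω r ^ (n - 1 - 1)) : ℂ) * ω (b i) ^ 2 := fun i => by ring
    simp_rw [this]
    rw [← Finset.mul_sum, hnull, mul_zero, Complex.zero_re]

/-- All the conditions are linear equations or norm bounds, and these pass to averages with the same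
constants. -/
theorem IsHarmonicForm.average {ι : Type*} {s : Finset ι} (hs : s.Nonempty) {n : ℕ}
    {Y : ι → Space → ℝ} {Y' : ι → Space → Space →L[ℝ] ℝ}
    {Y'' : ι → Space → Space →L[ℝ] Space →L[ℝ] ℝ}
    (h : ∀ j ∈ s, IsHarmonicForm b n (Y j) (Y' j) (Y'' j)) :
    IsHarmonicForm b n (fun r => (s.card : ℝ)⁻¹ • ∑ j ∈ s, Y j r)
      (fun r => (s.card : ℝ)⁻¹ • ∑ j ∈ s, Y' j r) (fun r => (s.card : ℝ)⁻¹ • ∑ j ∈ s, Y'' j r) := by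
  have hcard : (0 : ℝ) < s.card := by exact_mod_cast hs.card_pos
  have key : ∀ {V : Type} [NormedAddCommGroup V] [NormedSpace ℝ V] (f : ι → V) (C : ℝ),
      (∀ j ∈ s, ‖f j‖ ≤ C) → ‖(s.card : ℝ)⁻¹ • ∑ j ∈ s, f j‖ ≤ C := fun {V} _ _ f C hf => by
    rw [norm_smul, norm_inv, Real.norm_natCast, inv_mul_le_iff₀ hcard]
    exact (norm_sum_le_of_le s hf).trans (by simp)
  refine ⟨fun r => ?_, fun r => ?_, ?_, fun r => ?_, fun r => ?_, fun r => ?_, fun r => ?_,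
    fun r => ?_⟩
  · have h1 : HasFDerivAt (fun r => ∑ j ∈ s, Y j r) (∑ j ∈ s, Y' j r) r :=
      HasFDerivAt.fun_sum fun j hj => (h j hj).hasFDerivAt r
    exact h1.fun_const_smul _
  · have h1 : HasFDerivAt (fun r => ∑ j ∈ s, Y' j r) (∑ j ∈ s, Y'' j r) r :=
      HasFDerivAt.fun_sum fun j hj => (h j hj).hasFDerivAt' r
    exact h1.fun_const_smul _
  · have hc : ∀ {V : Type} [NormedAddCommGroup V] [NormedSpace ℝ V] (f : ι → Space → V),
        (∀ j ∈ s, Continuous (f j)) → Continuous fun r => (s.card : ℝ)⁻¹ • ∑ j ∈ s, f j r :=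
      fun f hf => continuous_const.smul (continuous_finsetSum s hf)
    exact hc Y'' fun j hj => (h j hj).continuous
  · exact key (fun j => Y j r) _ fun j hj => (h j hj).norm_le r
  · exact key (fun j => Y' j r) _ fun j hj => (h j hj).norm_le' r
  · exact key (fun j => Y'' j r) _ fun j hj => (h j hj).norm_le'' r
  · simp only [smul_apply, sum_apply, smul_eq_mul]
    rw [Finset.sum_congr rfl fun j hj => (h j hj).euler r, ← Finset.mul_sum]
    ring
  · simp only [smul_apply, sum_apply, smul_eq_mul]
    rw [← Finset.mul_sum, Finset.sum_comm, Finset.sum_congr rfl fun j hj => (h j hj).trace r]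
    simp

/-- The complex linear form `r₀ + i (r₁ cos φ + r₂ sin φ)` with `w = exp (i φ)`. -/
noncomputable def nullForm (b : OrthonormalBasis (Fin 3) ℝ Space) (w : ℂ) : Space →L[ℝ] ℂ :=
  Complex.ofRealCLM.comp (innerSL ℝ (b 0)) +
    Complex.I • Complex.ofRealCLM.comp (w.re • innerSL ℝ (b 1) + w.im • innerSL ℝ (b 2))

theorem nullForm_apply (w : ℂ) (r : Space) : nullForm b w r = (inner ℝ (b 0) r : ℝ) +
    ((w.re * inner ℝ (b 1) r + w.im * inner ℝ (b 2) r : ℝ) : ℂ) * Complex.I := by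
  simp [nullForm]
  ring

theorem norm_sq_eq_sum_inner (b : OrthonormalBasis (Fin 3) ℝ Space) (r : Space) :
    ‖r‖ ^ 2 = inner ℝ (b 0) r ^ 2 + inner ℝ (b 1) r ^ 2 + inner ℝ (b 2) r ^ 2 := by
  have := b.sum_sq_norm_inner_right r
  rw [Fin.sum_univ_three] at this
  simpa using this.symm

theorem norm_nullForm_le {w : ℂ} (hw : ‖w‖ = 1) : ‖nullForm b w‖ ≤ 1 := by
  refine ContinuousLinearMap.opNorm_le_bound _ zero_le_one fun r => ?_
  rw [one_mul, nullForm_apply, ← sq_le_sq₀ (norm_nonneg _) (norm_nonneg _),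
    ← Complex.normSq_eq_norm_sq, Complex.normSq_add_mul_I, norm_sq_eq_sum_inner b]
  have h : w.re ^ 2 + w.im ^ 2 = 1 := by
    have := Complex.normSq_eq_norm_sq w
    rw [hw, Complex.normSq_apply] at this
    linarith
  nlinarith [sq_nonneg (w.re * inner ℝ (b 2) r - w.im * inner ℝ (b 1) r)]

theorem sum_nullForm_sq {w : ℂ} (hw : ‖w‖ = 1) : ∑ i, nullForm b w (b i) ^ 2 = 0 := by
  have h : (w.re : ℂ) ^ 2 + (w.im : ℂ) ^ 2 = 1 := by
    have := Complex.normSq_eq_norm_sq w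
    rw [hw, Complex.normSq_apply] at this
    have h2 : w.re ^ 2 + w.im ^ 2 = 1 := by linarith
    exact_mod_cast h2
  have ho : ∀ i j, inner ℝ (b i) (b j) = if i = j then (1 : ℝ) else 0 :=
    fun i j => orthonormal_iff_ite.1 b.orthonormal i j
  rw [Fin.sum_univ_three]
  simp only [nullForm_apply, ho]
  simp [mul_pow]
  linear_combination -h

/-- Laplace's formula as an average over `n + 1` points presents `|r|^n P_n` as an average of
finitely many powers of null forms of norm at most `1`. This yields harmonicity and derivative
bounds polynomial in `n` together. -/
theorem exists_isHarmonicForm_zonal (b : OrthonormalBasis (Fin 3) ℝ Space) (n : ℕ) :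
    ∃ Y Y' Y'', IsHarmonicForm b n Y Y' Y'' ∧
      ∀ r, Y r = ‖r‖ ^ n * (legendreP n).eval (inner ℝ (b 0) r / ‖r‖) := by
  set η := Complex.exp (2 * Real.pi * Complex.I / ((n + 1 : ℕ) : ℂ)) with hη
  have hprim : IsPrimitiveRoot η (n + 1) := Complex.isPrimitiveRoot_exp (n + 1) n.succ_ne_zero
  have hη1 : ∀ j : ℕ, ‖η ^ j‖ = 1 := fun j => by
    rw [norm_pow, hprim.norm'_eq_one n.succ_ne_zero, one_pow]
  refine ⟨_, _, _, IsHarmonicForm.average (s := Finset.range (n + 1)) (by simp) fun j _ =>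
    isHarmonicForm_re_pow (ω := nullForm b (η ^ j)) (norm_nullForm_le (hη1 j))
      (sum_nullForm_sq (hη1 j)) n, fun r => ?_⟩
  rcases eq_or_ne r 0 with rfl | hr
  · rcases n with _ | n
    · simp [legendreP]
    · simp
  have hr0 : 0 < ‖r‖ := norm_pos_iff.2 hr
  set x := inner ℝ (b 0) r / ‖r‖ with hx
  set p := inner ℝ (b 1) r
  set q := inner ℝ (b 2) r
  set ρ := Real.sqrt (p ^ 2 + q ^ 2) / ‖r‖ with hρ
  have hρ2 : (‖r‖ * ρ) ^ 2 = p ^ 2 + q ^ 2 := by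
    rw [hρ, mul_div_cancel₀ _ hr0.ne', Real.sq_sqrt (by positivity)]
  have hxr : inner ℝ (b 0) r = ‖r‖ * x := by rw [hx]; field_simp
  have h1 : x ^ 2 + ρ ^ 2 = 1 := by
    have h2 := norm_sq_eq_sum_inner b r
    rw [hxr] at h2
    have h3 : ‖r‖ ^ 2 * (x ^ 2 + ρ ^ 2) = ‖r‖ ^ 2 * 1 := by
      linear_combination hρ2 - h2
    exact mul_left_cancel₀ (by positivity) h3
  obtain ⟨v, hv, hpq⟩ : ∃ v : ℂ, ‖v‖ = 1 ∧ (p + q * Complex.I : ℂ) = (‖r‖ * ρ : ℝ) * v := by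
    set z : ℂ := p + q * Complex.I with hz
    have hzn : ‖z‖ = ‖r‖ * ρ := by
      have hnn : 0 ≤ ‖r‖ * ρ := by positivity
      rw [← sq_eq_sq₀ (norm_nonneg _) hnn, hρ2, ← Complex.normSq_eq_norm_sq, hz,
        Complex.normSq_add_mul_I]
    refine ⟨Complex.exp (z.arg * Complex.I), Complex.norm_exp_ofReal_mul_I _, ?_⟩
    rw [← hzn, Complex.norm_mul_exp_arg_mul_I]
  have hv0 : v ≠ 0 := fun h => by simp [h] at hv
  -- For `ζ = i v⁻¹ w` on the unit circle, `(ζ - ζ⁻¹)/2 = i Re (v⁻¹ w)`. The rotation by `v` thus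
  -- aligns the points of the average with the component of `r` orthogonal to the axis.
  have hlap := legendreP_eq_average h1 n (v := Complex.I * v⁻¹)
    (mul_ne_zero Complex.I_ne_zero (inv_ne_zero hv0)) hprim
  have hterm : ∀ j : ℕ, nullForm b (η ^ j) r ^ n = (‖r‖ : ℂ) ^ n *
      (x + ρ * ((Complex.I * v⁻¹ * η ^ j - (Complex.I * v⁻¹ * η ^ j)⁻¹) / 2)) ^ n := fun j => by
    rw [← mul_pow]
    congr 1
    have hw := hη1 j
    set w := η ^ j
    have hw0 : w ≠ 0 := fun h => by simp [h] at hw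
    have hwinv : w⁻¹ = (starRingEnd ℂ) w := Complex.inv_eq_conj hw
    have hvinv : v⁻¹ = (starRingEnd ℂ) v := Complex.inv_eq_conj hv
    have hpq' : (p - q * Complex.I : ℂ) = (‖r‖ * ρ : ℝ) * v⁻¹ := by
      rw [hvinv]
      have := congrArg (starRingEnd ℂ) hpq
      simpa [sub_eq_add_neg] using this
    have hre : (w.re : ℂ) = (w + w⁻¹) / 2 := by rw [hwinv, Complex.add_conj]; push_cast; ring
    have him : (w.im : ℂ) * Complex.I = (w - w⁻¹) / 2 := by
      rw [hwinv, Complex.sub_conj]; push_cast; ring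
    have hI : (Complex.I * v⁻¹ * w)⁻¹ = -Complex.I * (v * w⁻¹) := by
      rw [mul_inv, mul_inv, inv_inv, Complex.inv_I]; ring
    have him' : (w.im : ℂ) = -Complex.I * ((w - w⁻¹) / 2) := by
      rw [← him]; linear_combination (w.im : ℂ) * Complex.I_sq
    rw [nullForm_apply, hI, hxr]
    change ((‖r‖ * x : ℝ) : ℂ) + ((w.re * p + w.im * q : ℝ) : ℂ) * Complex.I = _
    push_cast at hpq hpq' ⊢
    rw [hre, him']
    linear_combination (Complex.I * w / 2) * hpq' + (Complex.I * w⁻¹ / 2) * hpq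
  have hfin : ((((n + 1 : ℕ) : ℝ)⁻¹ • ∑ j ∈ Finset.range (n + 1), (nullForm b (η ^ j) r ^ n).re :
      ℝ) : ℂ) = ((‖r‖ ^ n * (legendreP n).eval x : ℝ) : ℂ) := by
    have h3 : ∑ j ∈ Finset.range (n + 1), nullForm b (η ^ j) r ^ n =
        ((‖r‖ ^ n * ((n + 1 : ℝ) * (legendreP n).eval x) : ℝ) : ℂ) := by
      simp_rw [hterm]
      rw [← Finset.mul_sum]
      push_cast
      rw [hlap]
      have : (n + 1 : ℂ) ≠ 0 := by exact_mod_cast n.succ_ne_zero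
      field_simp
    rw [← Complex.re_sum, h3, Complex.ofReal_re]
    have : (n + 1 : ℂ) ≠ 0 := by exact_mod_cast n.succ_ne_zero
    push_cast
    rw [smul_eq_mul]
    push_cast
    field_simp
  have := Complex.ofReal_injective hfin
  rwa [Finset.card_range]

/-! ### Second-order derivatives of series and products -/

section

theorem continuousOn_add_of_normed {X V : Type*} [TopologicalSpace X] [NormedAddCommGroup V]
    {p q : X → V} {s : Set X} (hp : ContinuousOn p s) (hq : ContinuousOn q s) :
    ContinuousOn (fun x => p x + q x) s :=
  hp.add hq

variable {E : Type*} [NormedAddCommGroup E] [InnerProductSpace ℝ E]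

theorem norm_real_smul {V : Type*} [NormedAddCommGroup V] [NormedSpace ℝ V] (c : ℝ) (v : V) :
    ‖c • v‖ = |c| * ‖v‖ :=
  norm_smul c v

theorem hasFDerivAt_tsum_continuousOn {V : Type*} [NormedAddCommGroup V] [NormedSpace ℝ V]
    [CompleteSpace V] {g : ℕ → E → V} {g' : ℕ → E → E →L[ℝ] V} {u : ℕ → ℝ} {s : Set E}
    (h : ∀ n, ∀ x ∈ s, HasFDerivAt (g n) (g' n x) x) (h' : ∀ n, ContinuousOn (g' n) s)
    (hs : IsOpen s) (hc : IsPreconnected s) (hu : Summable u)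
    (h0 : ∀ n, ∀ x ∈ s, ‖g n x‖ ≤ u n) (h1 : ∀ n, ∀ x ∈ s, ‖g' n x‖ ≤ u n) :
    (∀ x ∈ s, HasFDerivAt (fun x => ∑' n, g n x) (∑' n, g' n x) x) ∧
      ContinuousOn (fun x => ∑' n, g' n x) s :=
  ⟨fun x hx => hasFDerivAt_tsum_of_isPreconnected hu hs hc h h1 hx
      (.of_norm_bounded hu fun n => h0 n x hx) hx, continuousOn_tsum h' hu h1⟩

theorem tsum_clm_apply {V : Type*} [NormedAddCommGroup V] [NormedSpace ℝ V] [CompleteSpace V]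
    {T : ℕ → E →L[ℝ] V} {u : ℕ → ℝ} (hu : Summable u) (h : ∀ n, ‖T n‖ ≤ u n) (v : E) :
    (∑' n, T n) v = ∑' n, T n v :=
  (ContinuousLinearMap.apply ℝ V v).map_tsum (.of_norm_bounded hu h)

/-- `f'` and `f''` are the first two derivatives of `f` on `s`, and `f''` is continuous there. -/
structure HasJetOn (f : E → ℝ) (f' : E → E →L[ℝ] ℝ) (f'' : E → E →L[ℝ] E →L[ℝ] ℝ)
    (s : Set E) : Prop where
  hasFDerivAt : ∀ x ∈ s, HasFDerivAt f (f' x) x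
  hasFDerivAt' : ∀ x ∈ s, HasFDerivAt f' (f'' x) x
  continuousOn : ContinuousOn f'' s

/-- The real inner product as a bilinear map. -/
noncomputable def innerCLM (E : Type*) [NormedAddCommGroup E] [InnerProductSpace ℝ E] :
    E →L[ℝ] E →L[ℝ] ℝ :=
  innerSL ℝ

theorem innerCLM_apply (x y : E) : innerCLM E x y = inner ℝ x y := rfl

theorem norm_innerCLM_apply (x : E) : ‖innerCLM E x‖ = ‖x‖ := innerSL_apply_norm ℝ x

theorem norm_innerCLM_le : ‖innerCLM E‖ ≤ 1 :=
  ContinuousLinearMap.opNorm_le_bound _ zero_le_one fun x => by rw [norm_innerCLM_apply, one_mul]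

variable {f g : E → ℝ} {f' g' : E → E →L[ℝ] ℝ} {f'' g'' : E → E →L[ℝ] E →L[ℝ] ℝ} {s t : Set E}

theorem HasJetOn.mono (h : HasJetOn f f' f'' s) (ht : t ⊆ s) : HasJetOn f f' f'' t :=
  ⟨fun x hx => h.hasFDerivAt x (ht hx), fun x hx => h.hasFDerivAt' x (ht hx),
    h.continuousOn.mono ht⟩

theorem HasJetOn.contDiffOn (h : HasJetOn f f' f'' s) : ContDiffOn ℝ 2 f s := by
  have h1 : ContDiffOn ℝ 1 f' s := by
    rw [show (1 : WithTop ℕ∞) = 0 + 1 from rfl, contDiffOn_succ_iff_hasFDerivWithinAt (by simp)]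
    intro x hx
    refine ⟨s, by rw [Set.insert_eq_of_mem hx]; exact self_mem_nhdsWithin, ?_, f'',
      fun y hy => (h.hasFDerivAt' y hy).hasFDerivWithinAt, contDiffOn_zero.2 h.continuousOn⟩
    simp
  rw [show (2 : WithTop ℕ∞) = 1 + 1 from rfl, contDiffOn_succ_iff_hasFDerivWithinAt (by simp)]
  intro x hx
  exact ⟨s, by rw [Set.insert_eq_of_mem hx]; exact self_mem_nhdsWithin, by simp, f',
    fun y hy => (h.hasFDerivAt y hy).hasFDerivWithinAt, h1⟩

theorem HasJetOn.laplacian_eq [FiniteDimensional ℝ E] {ι : Type*} [Fintype ι]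
    (h : HasJetOn f f' f'' s) (hs : IsOpen s) (b : OrthonormalBasis ι ℝ E) {x : E} (hx : x ∈ s) :
    (Δ f) x = ∑ i, f'' x (b i) (b i) := by
  have h1 : fderiv ℝ f =ᶠ[𝓝 x] f' := by
    filter_upwards [hs.mem_nhds hx] with y hy using (h.hasFDerivAt y hy).fderiv
  have h2 : fderiv ℝ (fderiv ℝ f) x = f'' x := by
    rw [h1.fderiv_eq, (h.hasFDerivAt' x hx).fderiv]
  rw [laplacian_eq_iteratedFDeriv_orthonormalBasis f b]
  simp only [iteratedFDeriv_two_apply, h2]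
  simp

theorem HasJetOn.mul (hf : HasJetOn f f' f'' s) (hg : HasJetOn g g' g'' s) :
    HasJetOn (fun x => f x * g x) (fun x => f x • g' x + g x • f' x)
      (fun x => (f x • g'' x + (f' x).smulRight (g' x)) + (g x • f'' x + (g' x).smulRight (f' x)))
      s := by
  refine ⟨fun x hx => (hf.hasFDerivAt x hx).fun_mul (hg.hasFDerivAt x hx), fun x hx => ?_, ?_⟩
  · exact ((hf.hasFDerivAt x hx).fun_smul (hg.hasFDerivAt' x hx)).fun_add
      ((hg.hasFDerivAt x hx).fun_smul (hf.hasFDerivAt' x hx))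
  · have cf : ContinuousOn f s := fun x hx => (hf.hasFDerivAt x hx).continuousAt.continuousWithinAt
    have cg : ContinuousOn g s := fun x hx => (hg.hasFDerivAt x hx).continuousAt.continuousWithinAt
    have cf' : ContinuousOn f' s := fun x hx =>
      (hf.hasFDerivAt' x hx).continuousAt.continuousWithinAt
    have cg' : ContinuousOn g' s := fun x hx =>
      (hg.hasFDerivAt' x hx).continuousAt.continuousWithinAt
    have hR : ∀ {p q : E → E →L[ℝ] ℝ}, ContinuousOn p s → ContinuousOn q s →
        ContinuousOn (fun x => (p x).smulRight (q x)) s := fun {p q} hp hq =>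
      (((ContinuousLinearMap.smulRightL ℝ E (E →L[ℝ] ℝ)).continuous.comp_continuousOn hp).clm_apply
        hq)
    exact continuousOn_add_of_normed (V := E →L[ℝ] E →L[ℝ] ℝ)
      (continuousOn_add_of_normed (V := E →L[ℝ] E →L[ℝ] ℝ) (cf.smul hg.continuousOn) (hR cf' cg'))
      (continuousOn_add_of_normed (V := E →L[ℝ] E →L[ℝ] ℝ) (cg.smul hf.continuousOn) (hR cg' cf'))

theorem HasJetOn.const_mul (hf : HasJetOn f f' f'' s) (c : ℝ) :
    HasJetOn (fun x => c * f x) (fun x => c • f' x) (fun x => c • f'' x) s :=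
  ⟨fun x hx => (hf.hasFDerivAt x hx).const_mul c,
    fun x hx => (hf.hasFDerivAt' x hx).fun_const_smul c, hf.continuousOn.const_smul c⟩

theorem HasJetOn.tsum {f : ℕ → E → ℝ} {f' : ℕ → E → E →L[ℝ] ℝ}
    {f'' : ℕ → E → E →L[ℝ] E →L[ℝ] ℝ} {u : ℕ → ℝ} (h : ∀ n, HasJetOn (f n) (f' n) (f'' n) s)
    (hs : IsOpen s) (hc : IsPreconnected s) (hu : Summable u)
    (h0 : ∀ n, ∀ x ∈ s, ‖f n x‖ ≤ u n) (h1 : ∀ n, ∀ x ∈ s, ‖f' n x‖ ≤ u n)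
    (h2 : ∀ n, ∀ x ∈ s, ‖f'' n x‖ ≤ u n) :
    HasJetOn (fun x => ∑' n, f n x) (fun x => ∑' n, f' n x) (fun x => ∑' n, f'' n x) s := by
  obtain ⟨p, -⟩ := hasFDerivAt_tsum_continuousOn (fun n => (h n).hasFDerivAt)
    (fun n x hx => ((h n).hasFDerivAt' x hx).continuousAt.continuousWithinAt) hs hc hu h0 h1
  obtain ⟨q, q'⟩ := hasFDerivAt_tsum_continuousOn (V := E →L[ℝ] ℝ) (fun n => (h n).hasFDerivAt')
    (fun n => (h n).continuousOn) hs hc hu h1 h2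
  exact ⟨p, q, q'⟩

/-- A series of eigenfunctions of the Laplacian, with bounds on the first two derivatives. -/
theorem HasJetOn.contDiffOn_tsum_laplacian [FiniteDimensional ℝ E] {ι : Type*} [Fintype ι]
    (b : OrthonormalBasis ι ℝ E) {f : ℕ → E → ℝ} {f' : ℕ → E → E →L[ℝ] ℝ}
    {f'' : ℕ → E → E →L[ℝ] E →L[ℝ] ℝ} {u : ℕ → ℝ} (h : ∀ n, HasJetOn (f n) (f' n) (f'' n) s)
    (hs : IsOpen s) (hc : IsPreconnected s) (hu : Summable u)
    (h0 : ∀ n, ∀ x ∈ s, ‖f n x‖ ≤ u n) (h1 : ∀ n, ∀ x ∈ s, ‖f' n x‖ ≤ u n)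
    (h2 : ∀ n, ∀ x ∈ s, ‖f'' n x‖ ≤ u n) (k : ℝ)
    (hk : ∀ n, ∀ x ∈ s, ∑ i, f'' n x (b i) (b i) = k * f n x) :
    ContDiffOn ℝ 2 (fun x => ∑' n, f n x) s ∧
      ∀ x ∈ s, (Δ fun x => ∑' n, f n x) x = k * ∑' n, f n x := by
  have hj := HasJetOn.tsum h hs hc hu h0 h1 h2
  refine ⟨hj.contDiffOn, fun x hx => ?_⟩
  rw [hj.laplacian_eq hs b hx, ← tsum_mul_left]
  have hb : ∀ (n : ℕ) (v : E), ‖f'' n x v‖ ≤ u n * ‖v‖ := fun n v =>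
    (f'' n x).le_of_opNorm_le (h2 n x hx) v
  have e : ∀ v w : E, (∑' n, f'' n x) v w = ∑' n, f'' n x v w := fun v w => by
    rw [tsum_clm_apply (V := E →L[ℝ] ℝ) hu (fun n => h2 n x hx) v]
    exact tsum_clm_apply (hu.mul_right ‖v‖) (fun n => hb n v) w
  simp_rw [← hk _ x hx, e]
  refine (Summable.tsum_finsetSum fun i _ => ?_).symm
  refine .of_norm_bounded ((hu.mul_right ‖b i‖).mul_right ‖b i‖) fun n => ?_
  exact (f'' n x (b i)).le_of_opNorm_le (hb n (b i)) (b i)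

/-- The derivatives of a function of the squared norm. -/
theorem hasJetOn_norm_sq {φ φ₁ φ₂ : ℝ → ℝ} (h1 : ∀ ρ, 0 < ρ → HasDerivAt φ (φ₁ ρ) ρ)
    (h2 : ∀ ρ, 0 < ρ → HasDerivAt φ₁ (φ₂ ρ) ρ) (h3 : ContinuousOn φ₂ (Set.Ioi 0)) :
    HasJetOn (fun r : E => φ (‖r‖ ^ 2)) (fun r => (2 * φ₁ (‖r‖ ^ 2)) • innerCLM E r)
      (fun r => (2 * φ₁ (‖r‖ ^ 2)) • innerCLM E +
        ((4 * φ₂ (‖r‖ ^ 2)) • innerCLM E r).smulRight (innerCLM E r)) {0}ᶜ := by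
  have hpos : ∀ r ∈ ({0}ᶜ : Set E), 0 < ‖r‖ ^ 2 := fun r hr => by
    have : 0 < ‖r‖ := norm_pos_iff.2 hr
    positivity
  have hsq : ∀ r : E, HasFDerivAt (fun r : E => ‖r‖ ^ 2) ((2 : ℝ) • innerCLM E r) r := fun r => by
    refine (hasStrictFDerivAt_norm_sq r).hasFDerivAt.congr_fderiv ?_
    ext v
    simp [innerCLM_apply]
  have key : ∀ {ψ : ℝ → ℝ} {ψ₁ : ℝ} (r : E), HasDerivAt ψ ψ₁ (‖r‖ ^ 2) →
      HasFDerivAt (fun r : E => ψ (‖r‖ ^ 2)) ((2 * ψ₁) • innerCLM E r) r := fun {ψ ψ₁} r h => by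
    refine (h.comp_hasFDerivAt r (hsq r)).congr_fderiv ?_
    rw [smul_smul, mul_comm]
  refine ⟨fun r hr => key r (h1 _ (hpos r hr)), fun r hr => ?_, ?_⟩
  · have h := ((key r (h2 _ (hpos r hr))).const_mul 2).fun_smul (innerCLM E).hasFDerivAt
    refine h.congr_fderiv ?_
    rw [smul_smul]
    congr 3
    ring
  · have c1 : ContinuousOn (fun r : E => φ₁ (‖r‖ ^ 2)) {0}ᶜ := fun r hr =>
      (key r (h2 _ (hpos r hr))).continuousAt.continuousWithinAt
    have c2 : ContinuousOn (fun r : E => φ₂ (‖r‖ ^ 2)) {0}ᶜ :=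
      h3.comp (by fun_prop) fun r hr => hpos r hr
    have c3 : ContinuousOn (fun r : E => innerCLM E r) {0}ᶜ := (innerCLM E).continuous.continuousOn
    have c4 : ContinuousOn (fun r : E => (4 * φ₂ (‖r‖ ^ 2)) • innerCLM E r) {0}ᶜ :=
      (c2.const_mul 4 : ContinuousOn (fun r : E => 4 * φ₂ (‖r‖ ^ 2)) _).smul c3
    refine continuousOn_add_of_normed (V := E →L[ℝ] E →L[ℝ] ℝ)
      ((continuousOn_const.mul c1).smul continuousOn_const) ?_
    exact ((ContinuousLinearMap.smulRightL ℝ E (E →L[ℝ] ℝ)).continuous.comp_continuousOn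
      c4).clm_apply c3

end

theorem IsHarmonicForm.hasJetOn {b : OrthonormalBasis (Fin 3) ℝ Space} {n : ℕ} {Y : Space → ℝ}
    {Y' : Space → Space →L[ℝ] ℝ} {Y'' : Space → Space →L[ℝ] Space →L[ℝ] ℝ}
    (h : IsHarmonicForm b n Y Y' Y'') (s : Set Space) : HasJetOn Y Y' Y'' s :=
  ⟨fun x _ => h.hasFDerivAt x, fun x _ => h.hasFDerivAt' x, h.continuous.continuousOn⟩

/-- The product of a radial function and a harmonic form. -/
theorem IsHarmonicForm.exists_hasJetOn_radial_mul {b : OrthonormalBasis (Fin 3) ℝ Space} {n : ℕ}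
    {Y : Space → ℝ} {Y' : Space → Space →L[ℝ] ℝ} {Y'' : Space → Space →L[ℝ] Space →L[ℝ] ℝ}
    (h : IsHarmonicForm b n Y Y' Y'')
    {φ φ₁ φ₂ : ℝ → ℝ} (h1 : ∀ ρ, 0 < ρ → HasDerivAt φ (φ₁ ρ) ρ)
    (h2 : ∀ ρ, 0 < ρ → HasDerivAt φ₁ (φ₂ ρ) ρ) (h3 : ContinuousOn φ₂ (Set.Ioi 0)) {k : ℝ}
    (hφ : ∀ ρ, 0 < ρ → 4 * ρ * φ₂ ρ + (4 * n + 6) * φ₁ ρ = k * φ ρ) :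
    ∃ F' F'', HasJetOn (fun r => φ (‖r‖ ^ 2) * Y r) F' F'' {0}ᶜ ∧
      (∀ r, F' r r = (n * φ (‖r‖ ^ 2) + 2 * φ₁ (‖r‖ ^ 2) * ‖r‖ ^ 2) * Y r) ∧
      (∀ r, ‖F' r‖ ≤ |φ (‖r‖ ^ 2)| * (n * ‖r‖ ^ (n - 1)) +
        ‖r‖ ^ n * (2 * |φ₁ (‖r‖ ^ 2)| * ‖r‖)) ∧
      (∀ r, ‖F'' r‖ ≤ |φ (‖r‖ ^ 2)| * (n ^ 2 * ‖r‖ ^ (n - 2)) +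
        2 * ((2 * |φ₁ (‖r‖ ^ 2)| * ‖r‖) * (n * ‖r‖ ^ (n - 1))) +
        ‖r‖ ^ n * (2 * |φ₁ (‖r‖ ^ 2)| + 4 * |φ₂ (‖r‖ ^ 2)| * ‖r‖ ^ 2)) ∧
      ∀ r ∈ ({0}ᶜ : Set Space), ∑ i, F'' r (b i) (b i) = k * (φ (‖r‖ ^ 2) * Y r) := by
  have hr := hasJetOn_norm_sq (E := Space) h1 h2 h3
  have hf' : ∀ (c : ℝ) (r : Space), 0 ≤ c → ∀ p, ‖(c * p) • innerCLM Space r‖ = c * |p| * ‖r‖ :=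
    fun c r hc p => by
      rw [norm_smul, norm_innerCLM_apply, norm_mul, Real.norm_of_nonneg hc, Real.norm_eq_abs]
  have hns : ∀ (c : ℝ) (T : Space →L[ℝ] Space →L[ℝ] ℝ), ‖c • T‖ = |c| * ‖T‖ := fun c T =>
    norm_real_smul c T
  refine ⟨_, _, hr.mul (h.hasJetOn _), fun r => ?_, fun r => ?_, fun r => ?_, fun r hr0 => ?_⟩
  · simp only [add_apply, smul_apply, smul_eq_mul, innerCLM_apply, h.euler,
      real_inner_self_eq_norm_sq]
    ring
  · refine (norm_add_le _ _).trans ?_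
    rw [norm_smul, norm_smul, hf' 2 r zero_le_two]
    gcongr
    · exact (Real.norm_eq_abs _).le
    · exact h.norm_le' r
    · exact h.norm_le r
  · have e1 : ‖(2 * φ₁ (‖r‖ ^ 2)) • innerCLM Space +
        ((4 * φ₂ (‖r‖ ^ 2)) • innerCLM Space r).smulRight (innerCLM Space r)‖ ≤
        2 * |φ₁ (‖r‖ ^ 2)| + 4 * |φ₂ (‖r‖ ^ 2)| * ‖r‖ ^ 2 := by
      refine (norm_add_le (E := Space →L[ℝ] Space →L[ℝ] ℝ) _ _).trans ?_
      rw [ContinuousLinearMap.norm_smulRight_apply, hf' 4 r (by norm_num), norm_innerCLM_apply,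
        hns, abs_mul, abs_two]
      have := norm_innerCLM_le (E := Space)
      have h4 : 2 * |φ₁ (‖r‖ ^ 2)| * ‖innerCLM Space‖ ≤ 2 * |φ₁ (‖r‖ ^ 2)| :=
        mul_le_of_le_one_right (by positivity) this
      calc _ ≤ 2 * |φ₁ (‖r‖ ^ 2)| + 4 * |φ₂ (‖r‖ ^ 2)| * ‖r‖ * ‖r‖ := by gcongr
        _ = _ := by ring
    have e2 : ‖φ (‖r‖ ^ 2) • Y'' r + ((2 * φ₁ (‖r‖ ^ 2)) • innerCLM Space r).smulRight (Y' r)‖ ≤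
        |φ (‖r‖ ^ 2)| * (n ^ 2 * ‖r‖ ^ (n - 2)) +
          (2 * |φ₁ (‖r‖ ^ 2)| * ‖r‖) * (n * ‖r‖ ^ (n - 1)) := by
      refine (norm_add_le (E := Space →L[ℝ] Space →L[ℝ] ℝ) _ _).trans ?_
      rw [ContinuousLinearMap.norm_smulRight_apply, hf' 2 r zero_le_two, hns]
      gcongr
      · exact h.norm_le'' r
      · exact h.norm_le' r
    have e3 : ‖Y r • ((2 * φ₁ (‖r‖ ^ 2)) • innerCLM Space +
        ((4 * φ₂ (‖r‖ ^ 2)) • innerCLM Space r).smulRight (innerCLM Space r)) +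
        (Y' r).smulRight ((2 * φ₁ (‖r‖ ^ 2)) • innerCLM Space r)‖ ≤
        ‖r‖ ^ n * (2 * |φ₁ (‖r‖ ^ 2)| + 4 * |φ₂ (‖r‖ ^ 2)| * ‖r‖ ^ 2) +
          (n * ‖r‖ ^ (n - 1)) * (2 * |φ₁ (‖r‖ ^ 2)| * ‖r‖) := by
      refine (norm_add_le (E := Space →L[ℝ] Space →L[ℝ] ℝ) _ _).trans ?_
      rw [ContinuousLinearMap.norm_smulRight_apply, hf' 2 r zero_le_two, hns]
      gcongr
      · exact h.norm_le r
      · exact h.norm_le' r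
    refine (norm_add_le (E := Space →L[ℝ] Space →L[ℝ] ℝ) _ _).trans ((add_le_add e2 e3).trans (le_of_eq ?_))
    ring
  · have hpos : 0 < ‖r‖ ^ 2 := by
      have : 0 < ‖r‖ := norm_pos_iff.2 hr0
      positivity
    -- The trace of the second derivative is `(4ρφ'' + (4n + 6)φ') Y` with `ρ = |r|²`. The cross
    -- terms give `4nφ'` by Euler's identity, and the three dimensions give `6φ'`.
    have t1 : ∑ i, inner ℝ r (b i) * Y' r (b i) = n * Y r := by
      rw [← h.euler]
      nth_rewrite 4 [← b.sum_repr' r]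
      rw [map_sum]
      refine Finset.sum_congr rfl fun i _ => ?_
      rw [map_smul, smul_eq_mul, real_inner_comm]
    have t2 : ∑ i, inner ℝ r (b i) * inner ℝ r (b i) = ‖r‖ ^ 2 := by
      rw [norm_sq_eq_sum_inner b, Fin.sum_univ_three]
      simp only [real_inner_comm r]
      ring
    have t3 : ∑ i, inner ℝ (b i) (b i) = (3 : ℝ) := by
      simp [b.orthonormal.1]
    have t4 := h.trace r
    have hφr := hφ _ hpos
    simp only [add_apply, smul_apply, ContinuousLinearMap.smulRight_apply, smul_eq_mul,
      innerCLM_apply]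
    have : ∀ i, φ (‖r‖ ^ 2) * Y'' r (b i) (b i) +
        2 * φ₁ (‖r‖ ^ 2) * inner ℝ r (b i) * Y' r (b i) +
        (Y r * (2 * φ₁ (‖r‖ ^ 2) * inner ℝ (b i) (b i) +
          4 * φ₂ (‖r‖ ^ 2) * inner ℝ r (b i) * inner ℝ r (b i)) +
          Y' r (b i) * (2 * φ₁ (‖r‖ ^ 2) * inner ℝ r (b i))) =
        φ (‖r‖ ^ 2) * Y'' r (b i) (b i) + 4 * φ₁ (‖r‖ ^ 2) * (inner ℝ r (b i) * Y' r (b i)) +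
        (2 * φ₁ (‖r‖ ^ 2) * Y r) * inner ℝ (b i) (b i) +
        (4 * φ₂ (‖r‖ ^ 2) * Y r) * (inner ℝ r (b i) * inner ℝ r (b i)) := fun i => by ring
    simp_rw [this]
    rw [Finset.sum_add_distrib, Finset.sum_add_distrib, Finset.sum_add_distrib, ← Finset.mul_sum,
      ← Finset.mul_sum, ← Finset.mul_sum, ← Finset.mul_sum, t1, t2, t3, t4]
    linear_combination (Y r) * hφr

/-! ### Radial solutions in the exterior domain -/

/-- The function `∫ exp (ν t - x cosh t) dt`, for real `ν`. -/
noncomputable def besselReal (ν x : ℝ) : ℝ := (besselInt 0 ν x).re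

theorem ofReal_besselReal (ν x : ℝ) : (besselReal ν x : ℂ) = besselInt 0 ν x := by
  rw [besselReal, besselInt_zero_ofReal, Complex.ofReal_re]

theorem besselReal_pos (ν : ℝ) {x : ℝ} (hx : 0 < x) : 0 < besselReal ν x :=
  besselInt_zero_re_pos ν hx

theorem besselReal_recurrence (ν : ℝ) {x : ℝ} (hx : 0 < x) :
    x * (besselReal (ν + 1) x - besselReal (ν - 1) x) = 2 * ν * besselReal ν x := by
  have h := besselInt_zero_recurrence (ν : ℂ) hx
  rw [← Complex.ofReal_one, ← Complex.ofReal_add, ← Complex.ofReal_sub] at h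
  simp only [← ofReal_besselReal] at h
  exact_mod_cast h

theorem hasDerivAt_besselReal (ν : ℝ) {x : ℝ} (hx : 0 < x) :
    HasDerivAt (besselReal ν) (-besselReal (ν + 1) x + ν / x * besselReal ν x) x := by
  have h := hasDerivAt_re (hasDerivAt_besselInt_zero (ν : ℂ) hx)
  refine h.congr_deriv ?_
  have hr := besselReal_recurrence ν hx
  rw [← Complex.ofReal_one, ← Complex.ofReal_sub, ← ofReal_besselReal, ← ofReal_besselReal,
    ← Complex.ofReal_div]
  have e : besselReal (ν - 1) x = besselReal (ν + 1) x - 2 * ν / x * besselReal ν x := by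
    field_simp
    linarith
  norm_cast
  rw [e]
  ring

theorem besselReal_sub_one_le {ν x : ℝ} (hν : 1 / 2 ≤ ν) (hx : 0 < x) :
    besselReal (ν - 1) x ≤ besselReal ν x := by
  have h := norm_besselInt_sub_one_le (ν := (ν : ℂ)) (by simpa using hν) hx
  rw [← Complex.ofReal_one, ← Complex.ofReal_sub, ← ofReal_besselReal, ← ofReal_besselReal,
    Complex.norm_real, Complex.norm_real, Real.norm_of_nonneg (besselReal_pos _ hx).le,
    Real.norm_of_nonneg (besselReal_pos _ hx).le] at h
  exact h

/-- `ρ^(-ν/2) K_ν(κ √ρ)` up to a constant: the radial part of a decaying solution of the screened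
Poisson equation, as a function of `ρ = |r|²`. -/
noncomputable def outerRadial (κ ν ρ : ℝ) : ℝ := ρ ^ (-ν / 2) * besselReal ν (κ * Real.sqrt ρ)

section

variable {κ : ℝ}

theorem outerRadial_pos (hκ : 0 < κ) (ν : ℝ) {ρ : ℝ} (hρ : 0 < ρ) : 0 < outerRadial κ ν ρ :=
  mul_pos (Real.rpow_pos_of_pos hρ _) (besselReal_pos ν (mul_pos hκ (Real.sqrt_pos.2 hρ)))

theorem rpow_half_shift {ρ : ℝ} (hρ : 0 < ρ) (ν : ℝ) :
    ρ ^ (-(ν + 1) / 2) = ρ ^ (-ν / 2) / Real.sqrt ρ ∧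
      ρ ^ (-(ν - 1) / 2) = ρ ^ (-ν / 2) * Real.sqrt ρ := by
  constructor
  · rw [Real.sqrt_eq_rpow, ← Real.rpow_sub hρ]
    congr 1; ring
  · rw [Real.sqrt_eq_rpow, ← Real.rpow_add hρ]
    congr 1; ring

/-- As a function of the squared radius the family is closed under differentiation: the order goes
up by one. This is why the radial parts are taken in the variable `ρ = |r|²`. -/
theorem hasDerivAt_outerRadial (hκ : 0 < κ) (ν : ℝ) {ρ : ℝ} (hρ : 0 < ρ) :
    HasDerivAt (outerRadial κ ν) (-(κ / 2) * outerRadial κ (ν + 1) ρ) ρ := by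
  have hs : 0 < Real.sqrt ρ := Real.sqrt_pos.2 hρ
  have h1 : HasDerivAt (fun ρ : ℝ => ρ ^ (-ν / 2)) (-ν / 2 * ρ ^ (-ν / 2 - 1)) ρ :=
    Real.hasDerivAt_rpow_const (Or.inl hρ.ne')
  have h2 : HasDerivAt (fun ρ : ℝ => κ * Real.sqrt ρ) (κ * (1 / (2 * Real.sqrt ρ))) ρ :=
    (Real.hasDerivAt_sqrt hρ.ne').const_mul κ
  have h3 := (hasDerivAt_besselReal ν (mul_pos hκ hs)).comp ρ h2
  refine (h1.mul h3).congr_deriv ?_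
  rw [outerRadial, (rpow_half_shift hρ ν).1, Real.rpow_sub_one hρ.ne']
  have hsq : ρ = Real.sqrt ρ ^ 2 := (Real.sq_sqrt hρ.le).symm
  simp only [Function.comp]
  generalize besselReal ν (κ * Real.sqrt ρ) = B
  generalize besselReal (ν + 1) (κ * Real.sqrt ρ) = B'
  generalize ρ ^ (-ν / 2) = p
  generalize Real.sqrt ρ = q at *
  subst hsq
  field_simp
  ring

theorem outerRadial_recurrence (hκ : 0 < κ) (ν : ℝ) {ρ : ℝ} (hρ : 0 < ρ) :
    κ * (ρ * outerRadial κ (ν + 1) ρ - outerRadial κ (ν - 1) ρ) = 2 * ν * outerRadial κ ν ρ := by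
  have hs : 0 < Real.sqrt ρ := Real.sqrt_pos.2 hρ
  have h := besselReal_recurrence ν (mul_pos hκ hs)
  have hsq : ρ = Real.sqrt ρ ^ 2 := (Real.sq_sqrt hρ.le).symm
  rw [outerRadial, outerRadial, outerRadial, (rpow_half_shift hρ ν).1, (rpow_half_shift hρ ν).2]
  generalize besselReal ν (κ * Real.sqrt ρ) = B at *
  generalize besselReal (ν + 1) (κ * Real.sqrt ρ) = B' at *
  generalize besselReal (ν - 1) (κ * Real.sqrt ρ) = B'' at *
  generalize ρ ^ (-ν / 2) = p
  have e : ρ * (p / Real.sqrt ρ * B') = p * Real.sqrt ρ * B' := by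
    nth_rewrite 1 [hsq]
    field_simp
  rw [e]
  linear_combination p * h

theorem outerRadial_sub_one_le (hκ : 0 < κ) {ν : ℝ} (hν : 1 / 2 ≤ ν) {ρ : ℝ} (hρ : 0 < ρ) :
    outerRadial κ (ν - 1) ρ ≤ Real.sqrt ρ * outerRadial κ ν ρ := by
  have hs : 0 < Real.sqrt ρ := Real.sqrt_pos.2 hρ
  have h := besselReal_sub_one_le hν (mul_pos hκ hs)
  rw [outerRadial, outerRadial, (rpow_half_shift hρ ν).2]
  have : 0 < ρ ^ (-ν / 2) := Real.rpow_pos_of_pos hρ _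
  calc _ ≤ ρ ^ (-ν / 2) * Real.sqrt ρ * besselReal ν (κ * Real.sqrt ρ) := by gcongr
    _ = _ := by ring

/-- The recurrence expresses order `ν + 1` by the orders `ν` and `ν - 1`, and the latter is
controlled by order `ν`. Each radial derivative therefore costs only a factor growing linearly in
`ν`. -/
theorem outerRadial_add_one_le (hκ : 0 < κ) {ν : ℝ} (hν : 1 / 2 ≤ ν) {R ρ : ℝ} (hR : 0 < R)
    (hρ : R ^ 2 ≤ ρ) :
    κ / 2 * outerRadial κ (ν + 1) ρ ≤ (ν / R ^ 2 + κ / (2 * R)) * outerRadial κ ν ρ := by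
  have hρ0 : 0 < ρ := lt_of_lt_of_le (by positivity) hρ
  have h1 := outerRadial_recurrence hκ ν hρ0
  have h2 := outerRadial_sub_one_le hκ hν hρ0
  have hφ := outerRadial_pos hκ ν hρ0
  have hs : 0 < Real.sqrt ρ := Real.sqrt_pos.2 hρ0
  have hRs : R ≤ Real.sqrt ρ := Real.le_sqrt_of_sq_le hρ
  have hsq : ρ = Real.sqrt ρ ^ 2 := (Real.sq_sqrt hρ0.le).symm
  have e : κ / 2 * outerRadial κ (ν + 1) ρ =
      (ν * outerRadial κ ν ρ + κ / 2 * outerRadial κ (ν - 1) ρ) / ρ := by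
    rw [eq_div_iff hρ0.ne']
    linear_combination h1 / 2
  rw [e]
  have e2 : κ / 2 * outerRadial κ (ν - 1) ρ / ρ ≤ κ / (2 * R) * outerRadial κ ν ρ := by
    calc _ ≤ κ / 2 * (Real.sqrt ρ * outerRadial κ ν ρ) / ρ := by gcongr
      _ = κ / (2 * Real.sqrt ρ) * outerRadial κ ν ρ := by
          have e3 : Real.sqrt ρ / ρ = 1 / Real.sqrt ρ := by
            nth_rewrite 2 [hsq]
            field_simp
          calc _ = κ / 2 * outerRadial κ ν ρ * (Real.sqrt ρ / ρ) := by ring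
            _ = _ := by rw [e3]; field_simp
      _ ≤ _ := by gcongr
  have e3 : ν * outerRadial κ ν ρ / ρ ≤ ν / R ^ 2 * outerRadial κ ν ρ := by
    calc ν * outerRadial κ ν ρ / ρ = ν / ρ * outerRadial κ ν ρ := by ring
      _ ≤ _ := by gcongr
  rw [add_div, add_mul]
  exact add_le_add e3 e2

/-- The sign of the derivative is that of `c φ_ν - (κ/2) φ_{ν-1}`: negative for `c = 0`, and
nonnegative on `ρ ≤ R²` for `c = κR/2` if `ν ≥ 1/2`. These are the two values used. -/
theorem hasDerivAt_rpow_mul_outerRadial (hκ : 0 < κ) (ν c : ℝ) {ρ : ℝ} (hρ : 0 < ρ) :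
    HasDerivAt (fun ρ => ρ ^ (ν + c) * outerRadial κ ν ρ)
      (ρ ^ (ν + c - 1) * (c * outerRadial κ ν ρ - κ / 2 * outerRadial κ (ν - 1) ρ)) ρ := by
  have h1 : HasDerivAt (fun ρ : ℝ => ρ ^ (ν + c)) ((ν + c) * ρ ^ (ν + c - 1)) ρ :=
    Real.hasDerivAt_rpow_const (Or.inl hρ.ne')
  refine (h1.mul (hasDerivAt_outerRadial hκ ν hρ)).congr_deriv ?_
  have h2 := outerRadial_recurrence hκ ν hρ
  have h3 : ρ ^ (ν + c) = ρ ^ (ν + c - 1) * ρ := by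
    rw [← Real.rpow_add_one hρ.ne']; congr 1; ring
  rw [h3]
  linear_combination (-(ρ ^ (ν + c - 1)) / 2) * h2

theorem outerRadial_le_of_le (hκ : 0 < κ) (ν : ℝ) {ρ₀ ρ : ℝ} (hρ₀ : 0 < ρ₀) (hρ : ρ₀ ≤ ρ) :
    ρ ^ ν * outerRadial κ ν ρ ≤ ρ₀ ^ ν * outerRadial κ ν ρ₀ := by
  have h : AntitoneOn (fun ρ => ρ ^ (ν + 0) * outerRadial κ ν ρ) (Set.Ioi 0) := by
    refine antitoneOn_of_hasDerivAt_nonpos (convex_Ioi 0) (fun x hx => hasDerivAt_rpow_mul_outerRadial hκ ν 0 hx)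
      fun x hx => ?_
    have h1 := outerRadial_pos hκ (ν - 1) hx
    have h2 : 0 < x ^ (ν + 0 - 1) := Real.rpow_pos_of_pos hx _
    have h3 : 0 ≤ x ^ (ν + 0 - 1) * (κ / 2 * outerRadial κ (ν - 1) x) := by positivity
    linarith
  simpa using h hρ₀ (lt_of_lt_of_le hρ₀ hρ) hρ

/-- Continuation from the sphere inwards. Besides the factor `ρ^(-ν)`, the loss is a power with
exponent `κR/2`, independent of `ν` and so of the degree. -/
theorem outerRadial_le_of_ge (hκ : 0 < κ) {ν : ℝ} (hν : 1 / 2 ≤ ν) {R ρ : ℝ} (hR : 0 < R)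
    (hρ : 0 < ρ) (hρR : ρ ≤ R ^ 2) :
    ρ ^ (ν + κ * R / 2) * outerRadial κ ν ρ ≤
      (R ^ 2) ^ (ν + κ * R / 2) * outerRadial κ ν (R ^ 2) := by
  have h : MonotoneOn (fun ρ => ρ ^ (ν + κ * R / 2) * outerRadial κ ν ρ) (Set.Icc ρ (R ^ 2)) := by
    refine monotoneOn_of_deriv_nonneg (convex_Icc _ _) (fun x hx =>
      (hasDerivAt_rpow_mul_outerRadial hκ ν _
        (lt_of_lt_of_le hρ hx.1)).continuousAt.continuousWithinAt) (fun x hx => ?_) fun x hx => ?_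
    · rw [interior_Icc] at hx
      exact (hasDerivAt_rpow_mul_outerRadial hκ ν _
        (hρ.trans hx.1)).differentiableAt.differentiableWithinAt
    · rw [interior_Icc] at hx
      have hx0 : 0 < x := hρ.trans hx.1
      rw [(hasDerivAt_rpow_mul_outerRadial hκ ν _ hx0).deriv]
      have h1 := outerRadial_sub_one_le hκ hν hx0
      have h2 := outerRadial_pos hκ ν hx0
      have h3 : Real.sqrt x ≤ R := Real.sqrt_le_iff.2 ⟨hR.le, hx.2.le⟩
      have h4 : outerRadial κ (ν - 1) x ≤ R * outerRadial κ ν x := h1.trans (by gcongr)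
      have h5 : κ / 2 * outerRadial κ (ν - 1) x ≤ κ / 2 * (R * outerRadial κ ν x) := by gcongr
      have h6 : 0 < x ^ (ν + κ * R / 2 - 1) := Real.rpow_pos_of_pos hx0 _
      exact mul_nonneg h6.le (by linarith)
  exact h ⟨le_rfl, hρR⟩ ⟨hρR, le_rfl⟩ hρR

end

/-! ### Series of exterior and interior solutions -/

theorem mul_pow_sub_one_le {t₀ t : ℝ} (h₀ : 0 < t₀) (h : t₀ ≤ t) (n : ℕ) :
    (n : ℝ) * t ^ (n - 1) ≤ n * (1 / t₀ * t ^ n) := by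
  rcases n with _ | n
  · simp
  · have ht : 0 < t := h₀.trans_le h
    gcongr
    rw [Nat.add_sub_cancel, pow_succ, one_div, ← div_eq_inv_mul, le_div_iff₀ h₀]
    exact mul_le_mul_of_nonneg_left h (by positivity)

theorem sq_mul_pow_sub_two_le {t₀ t : ℝ} (h₀ : 0 < t₀) (h : t₀ ≤ t) (n : ℕ) :
    (n : ℝ) ^ 2 * t ^ (n - 2) ≤ n ^ 2 * ((1 / t₀ + 1 / t₀ ^ 2) * t ^ n) := by
  have ht : 0 < t := h₀.trans_le h
  rcases n with _ | _ | n
  · simp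
  · gcongr
    have h1 : 1 ≤ 1 / t₀ * t := by rw [one_div, ← div_eq_inv_mul, one_le_div h₀]; exact h
    have h2 : 0 ≤ 1 / t₀ ^ 2 * t := by positivity
    simp only [zero_add, pow_one]
    norm_num
    rw [add_mul]
    norm_num at h1 h2
    linarith
  · gcongr
    have h1 : t ^ n ≤ 1 / t₀ ^ 2 * t ^ (n + 2) := by
      rw [one_div, ← div_eq_inv_mul, le_div_iff₀ (by positivity), pow_add]
      gcongr
    have h2 : 0 ≤ 1 / t₀ * t ^ (n + 2) := by positivity
    have e : n + 1 + 1 - 2 = n := by omega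
    rw [e, add_mul]
    linarith

theorem sq_rpow_add_half {t : ℝ} (ht : 0 ≤ t) (n : ℕ) :
    (t ^ 2) ^ ((n : ℝ) + 1 / 2) = t ^ (2 * n + 1) := by
  rw [← Real.rpow_natCast, ← Real.rpow_mul ht, ← Real.rpow_natCast]
  congr 1
  push_cast
  ring

theorem summable_sq_mul_geometric {q : ℝ} (h0 : 0 ≤ q) (h1 : q < 1) :
    Summable fun n : ℕ => ((n : ℝ) + 1) ^ 2 * q ^ n := by
  have hq : ‖q‖ < 1 := by rwa [Real.norm_of_nonneg h0]
  have s2 := summable_pow_mul_geometric_of_norm_lt_one 2 hq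
  have s1 := summable_pow_mul_geometric_of_norm_lt_one 1 hq
  have s0 := summable_geometric_of_norm_lt_one hq
  refine ((s2.add (s1.mul_left 2)).add s0).congr fun n => ?_
  ring

/-- In the application `t = |r|`, `p = φ`, `d = |φ'|`, `q = |r|^n`, `a = n |r|^(n-1)` and `m = n +
1`, where `φ` is the radial factor. -/
theorem first_radial_bound {t T p d K₀ A m q a : ℝ} (ht : 0 ≤ t) (htT : t ≤ T) (hp : 0 ≤ p)
    (_hd0 : 0 ≤ d) (hd : d ≤ K₀ * m * p) (hm : 1 ≤ m) (hK : 0 ≤ K₀) (hA : 0 ≤ A) (hq : 0 ≤ q)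
    (ha : a ≤ m * (A * q)) :
    p * a + q * (2 * d * t) ≤ (A + 2 * K₀ * T) * m ^ 2 * (p * q) := by
  have hT : 0 ≤ T := ht.trans htT
  have hmm : m ≤ m ^ 2 := by nlinarith
  have hm0 : 0 ≤ m := by linarith
  calc _ ≤ p * (m * (A * q)) + q * (2 * (K₀ * m * p) * T) := by gcongr
    _ = (A + 2 * K₀ * T) * m * (p * q) := by ring
    _ ≤ _ := by gcongr

/-- As before, with `e = |φ''|` and `a₂ = n² |r|^(n-2)`. -/
theorem second_radial_bound {t T p d e K₀ A A₂ m q a a₂ : ℝ} (ht : 0 ≤ t) (htT : t ≤ T)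
    (hp : 0 ≤ p) (_hd0 : 0 ≤ d) (hd : d ≤ K₀ * m * p) (he : e ≤ 2 * K₀ ^ 2 * m ^ 2 * p)
    (hm : 1 ≤ m) (hK : 0 ≤ K₀) (_hA : 0 ≤ A) (hq : 0 ≤ q) (ha0 : 0 ≤ a) (ha : a ≤ m * (A * q))
    (ha₂ : a₂ ≤ m ^ 2 * (A₂ * q)) :
    p * a₂ + 2 * (2 * d * t * a) + q * (2 * d + 4 * e * t ^ 2) ≤
      (A₂ + 4 * K₀ * T * A + 2 * K₀ + 8 * K₀ ^ 2 * T ^ 2) * m ^ 2 * (p * q) := by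
  have hT : 0 ≤ T := ht.trans htT
  have hmm : m ≤ m ^ 2 := by nlinarith
  have hm0 : 0 ≤ m := by linarith
  have h1 : p * a₂ ≤ p * (m ^ 2 * (A₂ * q)) := by gcongr
  have h2 : 2 * d * t * a ≤ 2 * (K₀ * m * p) * T * (m * (A * q)) := by gcongr
  have h3 : d ≤ K₀ * m ^ 2 * p := hd.trans (by gcongr)
  have h4 : e * t ^ 2 ≤ 2 * K₀ ^ 2 * m ^ 2 * p * T ^ 2 := by gcongr
  have h5 : q * (2 * d + 4 * e * t ^ 2) ≤
      q * (2 * (K₀ * m ^ 2 * p) + 4 * (2 * K₀ ^ 2 * m ^ 2 * p * T ^ 2)) :=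
    mul_le_mul_of_nonneg_left (by linarith) hq
  linarith

section

variable {b : OrthonormalBasis (Fin 3) ℝ Space} {Y : ℕ → Space → ℝ}
  {Y' : ℕ → Space → Space →L[ℝ] ℝ} {Y'' : ℕ → Space → Space →L[ℝ] Space →L[ℝ] ℝ}
  {κ r₀ R₁ C : ℝ} {c : ℕ → ℝ}

/-- A bound of the coefficients at the single radius `R₁` propagates outwards, since `ρ^ν φ_ν`
decreases. -/
theorem norm_outer_term_le (hκ : 0 < κ) (hR₁ : 0 < R₁)
    (hc : ∀ n : ℕ, |c n| * outerRadial κ (n + 1 / 2) (R₁ ^ 2) ≤ C * (r₀ ^ n / R₁ ^ (2 * n + 1)))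
    (n : ℕ) {t : ℝ} (ht : R₁ ≤ t) :
    |c n| * (outerRadial κ (n + 1 / 2) (t ^ 2) * t ^ n) ≤ C * (r₀ ^ n / t ^ (n + 1)) := by
  have ht0 : 0 < t := hR₁.trans_le ht
  have h1 := outerRadial_le_of_le hκ ((n : ℝ) + 1 / 2) (pow_pos hR₁ 2)
    (pow_le_pow_left₀ hR₁.le ht 2)
  rw [sq_rpow_add_half ht0.le, sq_rpow_add_half hR₁.le] at h1
  have h2 : outerRadial κ (n + 1 / 2) (t ^ 2) ≤
      R₁ ^ (2 * n + 1) * outerRadial κ (n + 1 / 2) (R₁ ^ 2) / t ^ (2 * n + 1) := by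
    rw [le_div_iff₀ (by positivity), mul_comm]
    exact h1
  calc _ ≤ |c n| * (R₁ ^ (2 * n + 1) * outerRadial κ (n + 1 / 2) (R₁ ^ 2) /
        t ^ (2 * n + 1) * t ^ n) := by gcongr
    _ = |c n| * outerRadial κ (n + 1 / 2) (R₁ ^ 2) * (R₁ ^ (2 * n + 1) /
        t ^ (2 * n + 1) * t ^ n) := by ring
    _ ≤ C * (r₀ ^ n / R₁ ^ (2 * n + 1)) * (R₁ ^ (2 * n + 1) / t ^ (2 * n + 1) * t ^ n) := by
        exact mul_le_mul_of_nonneg_right (hc n) (by positivity)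
    _ = C * (r₀ ^ n / t ^ (n + 1)) := by
        have : t ^ (2 * n + 1) = t ^ (n + 1) * t ^ n := by rw [← pow_add]; congr 1; ring
        rw [this]
        field_simp

set_option maxHeartbeats 1600000 in
/-- The series of decaying solutions of the screened Poisson equation. -/
theorem outer_series (hY : ∀ n, IsHarmonicForm b n (Y n) (Y' n) (Y'' n)) (hκ : 0 < κ)
    (hr₀ : 0 ≤ r₀) (hR₁ : r₀ < R₁)
    (hc : ∀ n : ℕ, |c n| * outerRadial κ (n + 1 / 2) (R₁ ^ 2) ≤ C * (r₀ ^ n / R₁ ^ (2 * n + 1)))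
    {x : Space} (hx : R₁ < ‖x‖) :
    ContDiffAt ℝ 2 (fun r => ∑' n : ℕ, c n * (outerRadial κ (n + 1 / 2) (‖r‖ ^ 2) * Y n r)) x ∧
    (Δ fun r => ∑' n : ℕ, c n * (outerRadial κ (n + 1 / 2) (‖r‖ ^ 2) * Y n r)) x =
      κ ^ 2 * ∑' n : ℕ, c n * (outerRadial κ (n + 1 / 2) (‖x‖ ^ 2) * Y n x) ∧
    ∃ D : Space →L[ℝ] ℝ,
      HasFDerivAt (fun r => ∑' n : ℕ, c n * (outerRadial κ (n + 1 / 2) (‖r‖ ^ 2) * Y n r)) D x ∧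
      HasSum (fun n : ℕ => c n * ((n * outerRadial κ (n + 1 / 2) (‖x‖ ^ 2) +
        2 * (-(κ / 2) * outerRadial κ (n + 1 / 2 + 1) (‖x‖ ^ 2)) * ‖x‖ ^ 2) * Y n x)) (D x) := by
  have hR0 : 0 < R₁ := hr₀.trans_lt hR₁
  have hφ2 : ∀ n : ℕ, ∀ ρ, 0 < ρ → HasDerivAt
      (fun ρ => -(κ / 2) * outerRadial κ ((n : ℝ) + 1 / 2 + 1) ρ)
      (-(κ / 2) * (-(κ / 2) * outerRadial κ ((n : ℝ) + 1 / 2 + 1 + 1) ρ)) ρ := fun n ρ hρ =>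
    (hasDerivAt_outerRadial hκ _ hρ).const_mul _
  have hcont : ∀ n : ℕ, ContinuousOn
      (fun ρ => -(κ / 2) * (-(κ / 2) * outerRadial κ ((n : ℝ) + 1 / 2 + 1 + 1) ρ)) (Set.Ioi 0) :=
    fun n ρ hρ => (((hasDerivAt_outerRadial hκ _ hρ).const_mul _).const_mul
      _).continuousAt.continuousWithinAt
  have hode : ∀ n : ℕ, ∀ ρ, 0 < ρ →
      4 * ρ * (-(κ / 2) * (-(κ / 2) * outerRadial κ ((n : ℝ) + 1 / 2 + 1 + 1) ρ)) +
        (4 * n + 6) * (-(κ / 2) * outerRadial κ ((n : ℝ) + 1 / 2 + 1) ρ) =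
      κ ^ 2 * outerRadial κ ((n : ℝ) + 1 / 2) ρ := fun n ρ hρ => by
    have h := outerRadial_recurrence hκ ((n : ℝ) + 1 / 2 + 1) hρ
    rw [add_sub_cancel_right] at h
    linear_combination κ * h
  choose F' F'' hjet heul hF' hF'' htr using fun n : ℕ =>
    (hY n).exists_hasJetOn_radial_mul (φ := outerRadial κ ((n : ℝ) + 1 / 2))
      (fun ρ hρ => hasDerivAt_outerRadial hκ _ hρ) (hφ2 n) (hcont n) (hode n)
  set T := ‖x‖ + 1 with hT
  -- A convex neighbourhood of `x` on which `R₁ < |r| ≤ T`, so that all the bounds are uniform in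
  -- `r`.
  set s : Set Space := Metric.ball x (min (‖x‖ - R₁) 1) with hs
  have hmem : ∀ r ∈ s, R₁ < ‖r‖ ∧ ‖r‖ ≤ T := fun r hr => by
    rw [hs, Metric.mem_ball, dist_eq_norm, lt_min_iff] at hr
    have h1 := norm_sub_norm_le x r
    have h2 := norm_sub_norm_le r x
    rw [norm_sub_rev] at h1
    constructor <;> linarith [hr.1, hr.2]
  have hxs : x ∈ s := Metric.mem_ball_self (lt_min (by linarith) one_pos)
  have hs0 : s ⊆ {0}ᶜ := fun r hr h => by
    have := (hmem r hr).1
    rw [Set.mem_singleton_iff.1 h, norm_zero] at this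
    linarith
  set K₀ := 1 / R₁ ^ 2 + κ / R₁ with hK₀
  set A := 1 / R₁ with hA
  set A₂ := 1 / R₁ + 1 / R₁ ^ 2 with hA₂
  set K := 1 + (A + 2 * K₀ * T) + (A₂ + 4 * K₀ * T * A + 2 * K₀ + 8 * K₀ ^ 2 * T ^ 2) with hK
  have pK₀ : 0 ≤ K₀ := by positivity
  have pA : 0 ≤ A := by positivity
  have pA₂ : 0 ≤ A₂ := by positivity
  have pT : 0 ≤ T := by positivity
  have pC : 0 ≤ C := by
    have h := (mul_nonneg (abs_nonneg (c 0)) (outerRadial_pos hκ _ (pow_pos hR0 2)).le).trans (hc 0)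
    have h2 : 0 < r₀ ^ 0 / R₁ ^ (2 * 0 + 1) := by simpa using hR0
    exact nonneg_of_mul_nonneg_left h h2
  have g1 : 0 ≤ A + 2 * K₀ * T := by positivity
  have g2 : 0 ≤ A₂ + 4 * K₀ * T * A + 2 * K₀ + 8 * K₀ ^ 2 * T ^ 2 := by positivity
  have pK1 : 1 ≤ K := by linarith
  have pKa : A + 2 * K₀ * T ≤ K := by linarith
  have pKb : A₂ + 4 * K₀ * T * A + 2 * K₀ + 8 * K₀ ^ 2 * T ^ 2 ≤ K := by linarith
  have pK : 0 ≤ K := by linarith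
  have hrad : ∀ n : ℕ, ∀ r ∈ s, 0 < outerRadial κ ((n : ℝ) + 1 / 2) (‖r‖ ^ 2) ∧
      |-(κ / 2) * outerRadial κ ((n : ℝ) + 1 / 2 + 1) (‖r‖ ^ 2)| ≤
        K₀ * (n + 1) * outerRadial κ ((n : ℝ) + 1 / 2) (‖r‖ ^ 2) ∧
      |-(κ / 2) * (-(κ / 2) * outerRadial κ ((n : ℝ) + 1 / 2 + 1 + 1) (‖r‖ ^ 2))| ≤
        2 * K₀ ^ 2 * (n + 1) ^ 2 * outerRadial κ ((n : ℝ) + 1 / 2) (‖r‖ ^ 2) := fun n r hr => by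
    have hr1 : R₁ ^ 2 ≤ ‖r‖ ^ 2 := pow_le_pow_left₀ hR0.le (hmem r hr).1.le 2
    have hρ : 0 < ‖r‖ ^ 2 := lt_of_lt_of_le (by positivity) hr1
    have p0 := outerRadial_pos hκ ((n : ℝ) + 1 / 2) hρ
    have p1 := outerRadial_pos hκ ((n : ℝ) + 1 / 2 + 1) hρ
    have p2 := outerRadial_pos hκ ((n : ℝ) + 1 / 2 + 1 + 1) hρ
    have hn : (0 : ℝ) ≤ n := n.cast_nonneg
    have q1 := outerRadial_add_one_le hκ (ν := (n : ℝ) + 1 / 2) (by linarith) hR0 hr1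
    have q2 := outerRadial_add_one_le hκ (ν := (n : ℝ) + 1 / 2 + 1) (by linarith) hR0 hr1
    have e1 : κ / (2 * R₁) ≤ κ / R₁ := by gcongr; linarith
    have e0 : 0 ≤ κ / R₁ * n := by positivity
    have e0' : 0 ≤ 1 / R₁ ^ 2 * n := by positivity
    have e0'' : 0 < 1 / R₁ ^ 2 := by positivity
    have e0c : 0 < κ / R₁ := by positivity
    have e2 : ((n : ℝ) + 1 / 2) / R₁ ^ 2 + κ / (2 * R₁) ≤ K₀ * (n + 1) := by
      rw [hK₀, div_eq_mul_one_div ((n : ℝ) + 1 / 2)]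
      nlinarith
    have e3 : ((n : ℝ) + 1 / 2 + 1) / R₁ ^ 2 + κ / (2 * R₁) ≤ 2 * K₀ * (n + 1) := by
      rw [hK₀, div_eq_mul_one_div ((n : ℝ) + 1 / 2 + 1)]
      nlinarith
    have f1 : κ / 2 * outerRadial κ ((n : ℝ) + 1 / 2 + 1) (‖r‖ ^ 2) ≤
        K₀ * (n + 1) * outerRadial κ ((n : ℝ) + 1 / 2) (‖r‖ ^ 2) := q1.trans (by gcongr)
    refine ⟨p0, ?_, ?_⟩
    · rw [abs_mul, abs_neg, abs_of_pos (by positivity : 0 < κ / 2), abs_of_pos p1]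
      exact f1
    · rw [abs_mul, abs_mul, abs_neg, abs_of_pos (by positivity : 0 < κ / 2), abs_of_pos p2]
      calc _ ≤ κ / 2 * (2 * K₀ * (n + 1) * outerRadial κ ((n : ℝ) + 1 / 2 + 1) (‖r‖ ^ 2)) := by
            exact mul_le_mul_of_nonneg_left (q2.trans (by gcongr)) (by positivity)
        _ = 2 * K₀ * (n + 1) * (κ / 2 * outerRadial κ ((n : ℝ) + 1 / 2 + 1) (‖r‖ ^ 2)) := by ring
        _ ≤ 2 * K₀ * (n + 1) * (K₀ * (n + 1) * outerRadial κ ((n : ℝ) + 1 / 2) (‖r‖ ^ 2)) := by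
            gcongr
        _ = _ := by ring
  set u : ℕ → ℝ := fun n => K * (C / R₁) * (((n : ℝ) + 1) ^ 2 * (r₀ / R₁) ^ n) with hu
  have hsum : Summable u :=
    (summable_sq_mul_geometric (by positivity) ((div_lt_one hR0).2 hR₁)).mul_left _
  have hterm : ∀ n : ℕ, ∀ r ∈ s,
      |c n| * (outerRadial κ (n + 1 / 2) (‖r‖ ^ 2) * ‖r‖ ^ n) ≤ C / R₁ * (r₀ / R₁) ^ n :=
    fun n r hr => by
      refine (norm_outer_term_le hκ hR0 hc n (hmem r hr).1.le).trans ?_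
      calc C * (r₀ ^ n / ‖r‖ ^ (n + 1)) ≤ C * (r₀ ^ n / R₁ ^ (n + 1)) := by
            gcongr
            exact (hmem r hr).1.le
        _ = _ := by rw [div_pow, pow_succ]; field_simp
  have hbound : ∀ n : ℕ, ∀ r ∈ s, ∀ k z : ℝ, k ≤ K →
      z ≤ k * ((n : ℝ) + 1) ^ 2 * (outerRadial κ (n + 1 / 2) (‖r‖ ^ 2) * ‖r‖ ^ n) →
      |c n| * z ≤ u n := fun n r hr k z hk hz => by
    have p0 := (hrad n r hr).1
    calc |c n| * z ≤ |c n| * (K * ((n : ℝ) + 1) ^ 2 *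
          (outerRadial κ (n + 1 / 2) (‖r‖ ^ 2) * ‖r‖ ^ n)) := by
          gcongr
          exact hz.trans (by gcongr)
      _ = K * ((n : ℝ) + 1) ^ 2 *
          (|c n| * (outerRadial κ (n + 1 / 2) (‖r‖ ^ 2) * ‖r‖ ^ n)) := by ring
      _ ≤ K * ((n : ℝ) + 1) ^ 2 * (C / R₁ * (r₀ / R₁) ^ n) := by
          exact mul_le_mul_of_nonneg_left (hterm n r hr) (by positivity)
      _ = u n := by rw [hu]; ring
  have hcs : ∀ (a : ℝ) (T : Space →L[ℝ] ℝ), ‖a • T‖ = |a| * ‖T‖ := fun a T => norm_real_smul a T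
  have hcs2 : ∀ (a : ℝ) (T : Space →L[ℝ] Space →L[ℝ] ℝ), ‖a • T‖ = |a| * ‖T‖ :=
    fun a T => norm_real_smul a T
  have b0 : ∀ n : ℕ, ∀ r ∈ s, ‖c n * (outerRadial κ (n + 1 / 2) (‖r‖ ^ 2) * Y n r)‖ ≤ u n :=
    fun n r hr => by
      have p0 := (hrad n r hr).1
      rw [norm_mul, Real.norm_eq_abs]
      refine hbound n r hr 1 _ pK1 ?_
      rw [norm_mul, Real.norm_of_nonneg p0.le, one_mul]
      refine (mul_le_mul_of_nonneg_left ((hY n).norm_le r) p0.le).trans ?_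
      refine le_mul_of_one_le_left (by positivity) (one_le_pow₀ ?_)
      linarith [(n.cast_nonneg : (0 : ℝ) ≤ n)]
  have b1 : ∀ n : ℕ, ∀ r ∈ s, ‖c n • F' n r‖ ≤ u n := fun n r hr => by
    obtain ⟨p0, p1, p2⟩ := hrad n r hr
    rw [hcs]
    refine hbound n r hr (A + 2 * K₀ * T) _ pKa ((hF' n r).trans ?_)
    rw [abs_of_pos p0]
    exact first_radial_bound (norm_nonneg r) (hmem r hr).2 p0.le (abs_nonneg _) p1
      (by linarith [(n.cast_nonneg : (0 : ℝ) ≤ n)]) pK₀ pA (by positivity)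
      ((mul_pow_sub_one_le hR0 (hmem r hr).1.le n).trans
        (mul_le_mul_of_nonneg_right (by linarith) (by positivity)))
  have b2 : ∀ n : ℕ, ∀ r ∈ s, ‖c n • F'' n r‖ ≤ u n := fun n r hr => by
    obtain ⟨p0, p1, p2⟩ := hrad n r hr
    rw [hcs2]
    refine hbound n r hr (A₂ + 4 * K₀ * T * A + 2 * K₀ + 8 * K₀ ^ 2 * T ^ 2) _ pKb
      ((hF'' n r).trans ?_)
    rw [abs_of_pos p0]
    have hn : (0 : ℝ) ≤ n := n.cast_nonneg
    exact second_radial_bound (norm_nonneg r) (hmem r hr).2 p0.le (abs_nonneg _) p1 p2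
      (by linarith) pK₀ pA (by positivity) (by positivity)
      ((mul_pow_sub_one_le hR0 (hmem r hr).1.le n).trans
        (mul_le_mul_of_nonneg_right (by linarith) (by positivity)))
      ((sq_mul_pow_sub_two_le hR0 (hmem r hr).1.le n).trans
        (mul_le_mul_of_nonneg_right (by nlinarith) (by positivity)))
  have hjet' : ∀ n, HasJetOn (fun r => c n * (outerRadial κ ((n : ℝ) + 1 / 2) (‖r‖ ^ 2) * Y n r))
      (fun r => c n • F' n r) (fun r => c n • F'' n r) s :=
    fun n => ((hjet n).mono hs0).const_mul (c n)
  have hpre : IsPreconnected s := (convex_ball _ _).isPreconnected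
  have htr' : ∀ n, ∀ r ∈ s, ∑ i, (c n • F'' n r) (b i) (b i) =
      κ ^ 2 * (c n * (outerRadial κ ((n : ℝ) + 1 / 2) (‖r‖ ^ 2) * Y n r)) := fun n r hr => by
    simp only [smul_apply, smul_eq_mul]
    rw [← Finset.mul_sum, htr n r (hs0 hr)]
    ring
  obtain ⟨k1, k2⟩ := HasJetOn.contDiffOn_tsum_laplacian b hjet' Metric.isOpen_ball hpre hsum
    b0 b1 b2 (κ ^ 2) htr'
  refine ⟨k1.contDiffAt (Metric.isOpen_ball.mem_nhds hxs), k2 x hxs, ∑' n, c n • F' n x,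
    (HasJetOn.tsum hjet' Metric.isOpen_ball hpre hsum b0 b1 b2).hasFDerivAt x hxs, ?_⟩
  have hS : Summable fun n => c n • F' n x := .of_norm_bounded hsum fun n => b1 n x hxs
  have h := (ContinuousLinearMap.apply ℝ ℝ x).hasSum hS.hasSum
  refine h.congr_fun fun n => ?_
  simp [heul]

/-- The series of harmonic forms inside the ball of convergence. -/
theorem inner_series (hY : ∀ n, IsHarmonicForm b n (Y n) (Y' n) (Y'' n)) {T q : ℝ} {a : ℕ → ℝ}
    (hT : 0 < T) (hq : 0 ≤ q) (hqT : q * T < 1) (ha : ∀ n, |a n| ≤ C * q ^ n)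
    {x : Space} (hx : ‖x‖ < T) :
    ContDiffAt ℝ 2 (fun r => ∑' n, a n * Y n r) x ∧ (Δ fun r => ∑' n, a n * Y n r) x = 0 ∧
    ∃ D : Space →L[ℝ] ℝ, HasFDerivAt (fun r => ∑' n, a n * Y n r) D x ∧
      HasSum (fun n : ℕ => a n * (n * Y n x)) (D x) := by
  set s : Set Space := Metric.ball 0 T with hs
  have hmem : ∀ r ∈ s, ‖r‖ ≤ T := fun r hr => (mem_ball_zero_iff.1 hr).le
  have hxs : x ∈ s := mem_ball_zero_iff.2 hx
  have pC : 0 ≤ C := by simpa using (abs_nonneg _).trans (ha 0)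
  set K := 1 + 1 / T + (1 / T + 1 / T ^ 2) with hK
  have g1 : 0 ≤ 1 / T := by positivity
  have g2 : 0 ≤ 1 / T + 1 / T ^ 2 := by positivity
  have hK1 : 1 ≤ K := by linarith
  set u : ℕ → ℝ := fun n => K * C * (((n : ℝ) + 1) ^ 2 * (q * T) ^ n) with hu
  have hsum : Summable u := (summable_sq_mul_geometric (by positivity) hqT).mul_left _
  have hbound : ∀ (n : ℕ) (k m z : ℝ), k ≤ K → m ≤ ((n : ℝ) + 1) ^ 2 → 0 ≤ m →
      z ≤ m * (k * T ^ n) → |a n| * z ≤ u n := fun n k m z hk hm hm0 hz => by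
    calc |a n| * z ≤ |a n| * (((n : ℝ) + 1) ^ 2 * (K * T ^ n)) := by
          refine mul_le_mul_of_nonneg_left (hz.trans ?_) (abs_nonneg _)
          calc m * (k * T ^ n) ≤ m * (K * T ^ n) := by gcongr
            _ ≤ _ := by gcongr
      _ ≤ C * q ^ n * (((n : ℝ) + 1) ^ 2 * (K * T ^ n)) :=
          mul_le_mul_of_nonneg_right (ha n) (by positivity)
      _ = u n := by simp only [hu, mul_pow]; ring
  have hcs : ∀ (a : ℝ) (T : Space →L[ℝ] ℝ), ‖a • T‖ = |a| * ‖T‖ := fun a T => norm_real_smul a T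
  have hcs2 : ∀ (a : ℝ) (T : Space →L[ℝ] Space →L[ℝ] ℝ), ‖a • T‖ = |a| * ‖T‖ :=
    fun a T => norm_real_smul a T
  have hn : ∀ n : ℕ, (0 : ℝ) ≤ n := fun n => n.cast_nonneg
  have b0 : ∀ n : ℕ, ∀ r ∈ s, ‖a n * Y n r‖ ≤ u n := fun n r hr => by
    rw [norm_mul, Real.norm_eq_abs]
    refine hbound n 1 1 _ hK1 (by nlinarith [hn n]) zero_le_one (((hY n).norm_le r).trans ?_)
    rw [one_mul, one_mul]
    exact pow_le_pow_left₀ (norm_nonneg r) (hmem r hr) n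
  have b1 : ∀ n : ℕ, ∀ r ∈ s, ‖a n • Y' n r‖ ≤ u n := fun n r hr => by
    rw [hcs]
    refine hbound n (1 / T) n _ (by linarith) (by nlinarith [hn n]) (hn n)
      (((hY n).norm_le' r).trans (le_trans ?_ (mul_pow_sub_one_le hT le_rfl n)))
    exact mul_le_mul_of_nonneg_left (pow_le_pow_left₀ (norm_nonneg r) (hmem r hr) _) (hn n)
  have b2 : ∀ n : ℕ, ∀ r ∈ s, ‖a n • Y'' n r‖ ≤ u n := fun n r hr => by
    rw [hcs2]
    refine hbound n (1 / T + 1 / T ^ 2) (n ^ 2) _ (by linarith) (by nlinarith [hn n]) (by positivity)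
      (((hY n).norm_le'' r).trans (le_trans ?_ (sq_mul_pow_sub_two_le hT le_rfl n)))
    exact mul_le_mul_of_nonneg_left (pow_le_pow_left₀ (norm_nonneg r) (hmem r hr) _) (by positivity)
  have hjet' : ∀ n, HasJetOn (fun r => a n * Y n r) (fun r => a n • Y' n r)
      (fun r => a n • Y'' n r) s := fun n => ((hY n).hasJetOn s).const_mul (a n)
  have hpre : IsPreconnected s := (convex_ball _ _).isPreconnected
  have htr' : ∀ n, ∀ r ∈ s, ∑ i, (a n • Y'' n r) (b i) (b i) = 0 * (a n * Y n r) := fun n r _ => by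
    simp only [smul_apply, smul_eq_mul]
    rw [← Finset.mul_sum, (hY n).trace]
    ring
  obtain ⟨k1, k2⟩ := HasJetOn.contDiffOn_tsum_laplacian b hjet' Metric.isOpen_ball hpre hsum
    b0 b1 b2 0 htr'
  refine ⟨k1.contDiffAt (Metric.isOpen_ball.mem_nhds hxs), (k2 x hxs).trans (zero_mul _),
    ∑' n, a n • Y' n x,
    (HasJetOn.tsum hjet' Metric.isOpen_ball hpre hsum b0 b1 b2).hasFDerivAt x hxs, ?_⟩
  have hS : Summable fun n => a n • Y' n x := .of_norm_bounded hsum fun n => b1 n x hxs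
  have h := (ContinuousLinearMap.apply ℝ ℝ x).hasSum hS.hasSum
  refine h.congr_fun fun n => ?_
  simp [(hY n).euler]

/-- Summing the geometric bound with one factor `1/|x|` kept apart gives the decay at infinity. -/
theorem outer_series_norm_le (hY : ∀ n, IsHarmonicForm b n (Y n) (Y' n) (Y'' n)) (hκ : 0 < κ)
    (hr₀ : 0 ≤ r₀) (hR₁ : r₀ < R₁)
    (hc : ∀ n : ℕ, |c n| * outerRadial κ (n + 1 / 2) (R₁ ^ 2) ≤ C * (r₀ ^ n / R₁ ^ (2 * n + 1)))
    {x : Space} (hx : R₁ ≤ ‖x‖) :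
    ‖∑' n : ℕ, c n * (outerRadial κ (n + 1 / 2) (‖x‖ ^ 2) * Y n x)‖ ≤
      C * (1 - r₀ / R₁)⁻¹ * ‖x‖⁻¹ := by
  have hR0 : 0 < R₁ := hr₀.trans_lt hR₁
  have hx0 : 0 < ‖x‖ := hR0.trans_le hx
  have hq : r₀ / R₁ < 1 := (div_lt_one hR0).2 hR₁
  have pC : 0 ≤ C := by
    have h := (mul_nonneg (abs_nonneg (c 0)) (outerRadial_pos hκ _ (pow_pos hR0 2)).le).trans (hc 0)
    have h2 : 0 < r₀ ^ 0 / R₁ ^ (2 * 0 + 1) := by simpa using hR0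
    exact nonneg_of_mul_nonneg_left h h2
  have hS : HasSum (fun n : ℕ => C * ‖x‖⁻¹ * (r₀ / R₁) ^ n) (C * ‖x‖⁻¹ * (1 - r₀ / R₁)⁻¹) :=
    (hasSum_geometric_of_lt_one (by positivity) hq).mul_left _
  refine (tsum_of_norm_bounded hS fun n => ?_).trans (le_of_eq (by ring))
  have p0 := outerRadial_pos hκ ((n : ℝ) + 1 / 2) (pow_pos hx0 2)
  rw [norm_mul, norm_mul, Real.norm_of_nonneg p0.le, Real.norm_eq_abs (c n)]
  calc _ ≤ |c n| * (outerRadial κ (n + 1 / 2) (‖x‖ ^ 2) * ‖x‖ ^ n) := by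
        gcongr
        exact (hY n).norm_le x
    _ ≤ C * (r₀ ^ n / ‖x‖ ^ (n + 1)) := norm_outer_term_le hκ hR0 hc n hx
    _ = C * ‖x‖⁻¹ * (r₀ / ‖x‖) ^ n := by rw [div_pow, pow_succ]; field_simp
    _ ≤ _ := by gcongr

end

/-! ### Existence of a solution -/

theorem exists_orthonormalBasis_zero_eq {e : Space} (he : ‖e‖ = 1) :
    ∃ b : OrthonormalBasis (Fin 3) ℝ Space, b 0 = e := by
  have hv : Orthonormal ℝ (({0} : Set (Fin 3)).domRestrict fun _ => e) := by
    rw [orthonormal_iff_ite]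
    rintro ⟨i, hi⟩ ⟨j, hj⟩
    have hij : i = j := hi.trans hj.symm
    subst hij
    simp [Set.domRestrict, he]
  obtain ⟨b, hb⟩ := hv.exists_orthonormalBasis_extension_of_card_eq (by simp)
  exact ⟨b, hb 0 rfl⟩

theorem abs_inner_div_norm_le {e : Space} (he : ‖e‖ = 1) (r : Space) : |inner ℝ e r / ‖r‖| ≤ 1 := by
  rw [abs_div, abs_norm]
  refine div_le_one_of_le₀ ?_ (norm_nonneg r)
  simpa [he] using abs_real_inner_le_norm e r

theorem norm_sub_smul_eq_sqrt {e : Space} (he : ‖e‖ = 1) (r : Space) (x : ℝ) :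
    ‖r - x • e‖ = Real.sqrt (x ^ 2 - 2 * x * ‖r‖ * (inner ℝ e r / ‖r‖) + ‖r‖ ^ 2) := by
  have h : ‖r‖ * (inner ℝ e r / ‖r‖) = inner ℝ e r := by
    rcases eq_or_ne r 0 with rfl | hr
    · simp
    · rw [mul_div_cancel₀ _ (norm_ne_zero_iff.2 hr)]
  have hin : inner ℝ r (x • e) = x * inner ℝ e r := by rw [inner_smul_right, real_inner_comm]
  rw [mul_assoc, h, ← Real.sqrt_sq (norm_nonneg (r - x • e)), norm_sub_sq_real, hin, norm_smul, he,
    mul_one, Real.norm_eq_abs, sq_abs]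
  ring_nf

/-- The expansion of the potential of a point on a line through the centre, at a point closer to
the centre. -/
theorem hasSum_inv_norm_sub_smul {e : Space} (he : ‖e‖ = 1) {r : Space} {x : ℝ} (hx : ‖r‖ < x) :
    HasSum (fun n : ℕ => ‖r‖ ^ n / x ^ (n + 1) * (legendreP n).eval (inner ℝ e r / ‖r‖))
      (1 / ‖r - x • e‖) := by
  rw [norm_sub_smul_eq_sqrt he]
  exact hasSum_legendreP (abs_inner_div_norm_le he r) (norm_nonneg r) hx

/-- The expansion of the potential of a point on a line through the centre, at a point farther from
the centre. -/
theorem hasSum_inv_norm_smul_sub {e v : Space} (he : ‖e‖ = 1) (hv : ‖v‖ = 1) {x t : ℝ} (hx : 0 ≤ x)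
    (ht : x < t) :
    HasSum (fun n : ℕ => x ^ n / t ^ (n + 1) * (legendreP n).eval (inner ℝ e v))
      (1 / ‖t • v - x • e‖) := by
  have ht0 : 0 < t := hx.trans_lt ht
  have hn : ‖t • v‖ = t := by rw [norm_smul, hv, mul_one, Real.norm_of_nonneg ht0.le]
  have hy : |inner ℝ e v| ≤ 1 := by simpa [hv] using abs_inner_div_norm_le he v
  have h := hasSum_legendreP hy hx ht
  rw [norm_sub_smul_eq_sqrt he, hn, inner_smul_right, mul_div_cancel_left₀ _ ht0.ne']
  convert h using 3
  ring

/-- The radial derivative of the potential of a point on a line through the centre. -/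
theorem exists_hasDerivAt_inv_norm_smul_sub {e v : Space} (he : ‖e‖ = 1) (hv : ‖v‖ = 1) {x t : ℝ}
    (hx : 0 ≤ x) (ht : x < t) :
    ∃ d, HasDerivAt (fun t : ℝ => 1 / ‖t • v - x • e‖) d t ∧
      HasSum (fun n : ℕ => -((n + 1) * (x ^ n / t ^ (n + 2)) * (legendreP n).eval (inner ℝ e v)))
        d := by
  -- An intermediate radius makes the differentiated series uniformly convergent on `t > t₀`.
  obtain ⟨t₀, h1, h2⟩ := exists_between ht
  have h0 : 0 < t₀ := hx.trans_lt h1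
  have hy : |inner ℝ e v| ≤ 1 := by simpa [hv] using abs_inner_div_norm_le he v
  set u : ℕ → ℝ := fun n => 1 / t₀ ^ 2 * (((n : ℝ) + 1) ^ 2 * (x / t₀) ^ n) with hu
  have hsum : Summable u :=
    (summable_sq_mul_geometric (by positivity) ((div_lt_one h0).2 h1)).mul_left _
  have hd : ∀ n : ℕ, ∀ y ∈ Set.Ioi t₀, HasDerivAt
      (fun t : ℝ => x ^ n / t ^ (n + 1) * (legendreP n).eval (inner ℝ e v))
      (-((n + 1) * (x ^ n / y ^ (n + 2)) * (legendreP n).eval (inner ℝ e v))) y := fun n y hy => by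
    have hy0 : 0 < y := h0.trans hy
    refine ((((hasDerivAt_pow (n + 1) y).inv (pow_ne_zero _ hy0.ne')).const_mul
      (x ^ n)).mul_const _).congr_deriv ?_
    rw [Nat.add_sub_cancel]
    push_cast
    field_simp
    ring
  have hb : ∀ n : ℕ, ∀ y ∈ Set.Ioi t₀,
      ‖-((n + 1) * (x ^ n / y ^ (n + 2)) * (legendreP n).eval (inner ℝ e v))‖ ≤ u n :=
    fun n y hyt => by
      have hy0 : 0 < y := h0.trans hyt
      rw [norm_neg, norm_mul, norm_mul, Real.norm_of_nonneg (by positivity : (0 : ℝ) ≤ n + 1),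
        Real.norm_of_nonneg (by positivity : 0 ≤ x ^ n / y ^ (n + 2)), Real.norm_eq_abs]
      calc _ ≤ ((n : ℝ) + 1) * (x ^ n / y ^ (n + 2)) * 1 := by
            gcongr
            exact abs_legendreP_le_one hy n
        _ ≤ ((n : ℝ) + 1) ^ 2 * (x ^ n / t₀ ^ (n + 2)) * 1 := by
            gcongr
            · nlinarith [(n.cast_nonneg : (0 : ℝ) ≤ n)]
            · exact le_of_lt hyt
        _ = u n := by simp only [hu, div_pow, pow_add]; field_simp
  have h := hasDerivAt_tsum_of_isPreconnected hsum isOpen_Ioi isPreconnected_Ioi hd hb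
    (Set.mem_Ioi.2 h2) (hasSum_inv_norm_smul_sub he hv hx ht).summable (Set.mem_Ioi.2 h2)
  refine ⟨_, h.congr_of_eventuallyEq ?_,
    (Summable.of_norm_bounded hsum fun n => hb n t h2).hasSum⟩
  filter_upwards [lt_mem_nhds ht] with y hy
  exact (hasSum_inv_norm_smul_sub he hv hx hy).tsum_eq.symm

/-- The data at integer degree that the matching uses. The relation for `M n` is the flux condition
in disguise, the last identity is the radial derivative of the exterior solution on the sphere, and
the bound on `M n` does not depend on `n`. -/
theorem exists_real_harmonicCoeff {ε κ R : ℝ} (hε : 0 < ε) (hκ : 0 < κ) (hR : 0 < R) :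
    ∃ M q : ℕ → ℝ, ∀ n : ℕ, harmonicCoeff ε (κ * R) n = M n ∧ 0 < q n ∧
      |M n| ≤ ε + 1 + κ * R ∧ M n * ((ε + 1) * n + 1 + q n) = (ε - 1) * (n + 1) - q n ∧
      n * outerRadial κ (n + 1 / 2) (R ^ 2) +
        2 * (-(κ / 2) * outerRadial κ (n + 1 / 2 + 1) (R ^ 2)) * R ^ 2 =
        -(n + 1 + q n) * outerRadial κ (n + 1 / 2) (R ^ 2) := by
  have hu : 0 < κ * R := by positivity
  refine ⟨fun n => (harmonicCoeff ε (κ * R) n).re,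
    fun n => (besselRatio (κ * R) ((n : ℂ) + 1 / 2)).re, fun n => ?_⟩
  have hν : (n : ℂ) + 1 / 2 = (((n : ℝ) + 1 / 2 : ℝ) : ℂ) := by push_cast; ring
  have hn : (0 : ℝ) ≤ n := n.cast_nonneg
  obtain ⟨q0, qi⟩ := besselRatio_ofReal hu ((n : ℝ) + 1 / 2)
  have hqn := norm_besselRatio_le hu (ν := (n : ℂ) + 1 / 2) (by simp)
  rw [← hν] at q0 qi
  obtain ⟨q, hq⟩ : ∃ q : ℝ, besselRatio (κ * R) ((n : ℂ) + 1 / 2) = q :=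
    ⟨_, (Complex.ext rfl (by simpa using qi))⟩
  have hq' : besselRatio (κ * R) (((n : ℝ) + 1 / 2 : ℝ) : ℂ) = q := by rw [← hν, hq]
  rw [hq, Complex.ofReal_re] at q0
  have hqu : q ≤ κ * R := by
    rw [hq, Complex.norm_real, Real.norm_of_nonneg q0.le] at hqn
    exact hqn
  have hden : 0 < (ε + 1) * n + 1 + q := by positivity
  have hM : harmonicCoeff ε (κ * R) n =
      ((((ε - 1) * (n + 1) - q) / ((ε + 1) * n + 1 + q) : ℝ) : ℂ) := by
    rw [harmonicCoeff_eq _ hu (by simp; linarith), coeffDen, hq]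
    push_cast
    rfl
  simp only [hq, Complex.ofReal_re]
  rw [hM, Complex.ofReal_re]
  refine ⟨rfl, q0, ?_, div_mul_cancel₀ _ hden.ne', ?_⟩
  · rw [abs_div, abs_of_pos hden, div_le_iff₀ hden, abs_le]
    constructor <;> nlinarith [mul_nonneg hε.le hn, mul_nonneg hu.le hn, mul_nonneg hε.le q0.le,
      mul_nonneg hu.le q0.le, mul_nonneg (mul_nonneg hε.le hn) hε.le,
      mul_nonneg (mul_nonneg hε.le hn) hu.le]
  · have hrec := outerRadial_recurrence hκ ((n : ℝ) + 1 / 2) (pow_pos hR 2)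
    have hqφ : q * outerRadial κ (n + 1 / 2) (R ^ 2) =
        κ * outerRadial κ (n + 1 / 2 - 1) (R ^ 2) := by
      have hB := besselReal_pos ((n : ℝ) + 1 / 2) hu
      have h1 : q * besselReal ((n : ℝ) + 1 / 2) (κ * R) =
          κ * R * besselReal ((n : ℝ) + 1 / 2 - 1) (κ * R) := by
        rw [besselRatio, div_eq_iff] at hq'
        · have h2 := ofReal_besselReal ((n : ℝ) + 1 / 2) (κ * R)
          have h3 := ofReal_besselReal ((n : ℝ) + 1 / 2 - 1) (κ * R)
          rw [← h2, ← Complex.ofReal_one, ← Complex.ofReal_sub, ← h3] at hq'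
          exact_mod_cast hq'.symm
        · rw [← ofReal_besselReal]
          exact_mod_cast hB.ne'
      rw [outerRadial, outerRadial, (rpow_half_shift (pow_pos hR 2) _).2, Real.sqrt_sq hR.le]
      linear_combination (R ^ 2) ^ (-((n : ℝ) + 1 / 2) / 2) * h1
    linear_combination -hrec + hqφ

theorem norm_kelvinPoint {R : ℝ} {rs : Space} (hrs : rs ≠ 0) : ‖kelvinPoint R rs‖ = R ^ 2 / ‖rs‖ := by
  have h0 : 0 < ‖rs‖ := norm_pos_iff.2 hrs
  rw [kelvinPoint, norm_smul, Real.norm_of_nonneg (by positivity)]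
  field_simp

theorem cos_angle_eq {rs : Space} (r : Space) :
    Real.cos (InnerProductGeometry.angle rs r) = inner ℝ (‖rs‖⁻¹ • rs) r / ‖r‖ := by
  rw [InnerProductGeometry.cos_angle, real_inner_smul_left, div_mul_eq_div_div]
  ring

theorem hasDerivAt_comp_smul_const {F : Space → ℝ} {D : Space →L[ℝ] ℝ} {t : ℝ} {v : Space}
    (h : HasFDerivAt F D (t • v)) : HasDerivAt (fun t : ℝ => F (t • v)) (D v) t :=
  (h.comp_hasDerivAt t ((hasDerivAt_id t).smul_const v)).congr_deriv (by simp)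

/-- The Green's function problem has a solution, whose reaction potential is the Kirkwood series. -/
theorem exists_isGreenSolution {εi εo κ R : ℝ} (hεi : 0 < εi) (hεo : 0 < εo) (hκ : 0 < κ)
    (hR : 0 < R) {rs : Space} (hrs : rs ≠ 0) (hrsR : ‖rs‖ < R) :
    ∃ Gi Go Φ : Space → ℝ, IsGreenSolution εi εo κ R rs Gi Go Φ ∧
      ∀ r ∈ Metric.closedBall (0 : Space) R, HasSum (kirkwoodTerm εi εo κ R rs r) (Φ r : ℂ) := by
  have hε : 0 < εi / εo := div_pos hεi hεo
  obtain ⟨M, q, hMq⟩ := exists_real_harmonicCoeff hε hκ hR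
  set p := ‖rs‖ with hp
  have hp0 : 0 < p := norm_pos_iff.2 hrs
  set e : Space := p⁻¹ • rs with he
  have he1 : ‖e‖ = 1 := by rw [he, norm_smul, norm_inv, norm_norm, inv_mul_cancel₀ hp0.ne']
  have hrse : rs = p • e := by rw [he, smul_inv_smul₀ hp0.ne']
  obtain ⟨b, hb⟩ := exists_orthonormalBasis_zero_eq he1
  choose Y Y' Y'' hY hYr using fun n : ℕ => exists_isHarmonicForm_zonal b n
  simp only [hb] at hYr
  set k := 1 / (4 * Real.pi * εi) with hk
  have hk0 : 0 < k := by positivity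
  set B := εi / εo + 1 + κ * R with hB
  have hB0 : 0 < B := by positivity
  set φ : ℕ → ℝ → ℝ := fun n => outerRadial κ (n + 1 / 2) with hφ
  have hφR : ∀ n, 0 < φ n (R ^ 2) := fun n => outerRadial_pos hκ _ (pow_pos hR 2)
  -- The `a n` are the Kirkwood coefficients. The `c n` are determined by continuity across the
  -- sphere, where the Coulomb term contributes the summand `1` in `1 + M n`.
  set a : ℕ → ℝ := fun n => k * (p ^ n / R ^ (2 * n + 1)) * M n with ha
  set c : ℕ → ℝ := fun n => k * (p ^ n / R ^ (2 * n + 1)) * (1 + M n) / φ n (R ^ 2) with hc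
  -- The exterior series converges for `|r| > R₁` with `R₁ < R`, and the interior one for `|r| < T`
  -- with `T > R`. Both are thus twice continuously differentiable across the sphere, which gives
  -- continuity up to it and the one-sided radial derivatives.
  obtain ⟨R₁, hpR₁, hR₁R⟩ := exists_between hrsR
  have hR₁0 : 0 < R₁ := hp0.trans hpR₁
  have hRT : R < R ^ 2 / p := by rw [lt_div_iff₀ hp0]; nlinarith
  obtain ⟨T, hRT, hTp⟩ := exists_between hRT
  have hT0 : 0 < T := hR.trans hRT
  have hqT : p / R ^ 2 * T < 1 := by
    rw [lt_div_iff₀ hp0] at hTp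
    rw [div_mul_eq_mul_div, div_lt_one (by positivity)]
    linarith
  -- coefficient bounds
  have ha_le : ∀ n, |a n| ≤ k * B / R * (p / R ^ 2) ^ n := fun n => by
    obtain ⟨-, -, hM, -⟩ := hMq n
    rw [ha, abs_mul, abs_of_pos (by positivity)]
    calc k * (p ^ n / R ^ (2 * n + 1)) * |M n| ≤ k * (p ^ n / R ^ (2 * n + 1)) * B := by gcongr
      _ = _ := by rw [div_pow, ← pow_mul, pow_succ]; field_simp
  have hc_le : ∀ n : ℕ, |c n| * outerRadial κ (n + 1 / 2) (R₁ ^ 2) ≤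
      k * (1 + B) * (R / R₁) ^ (κ * R) * (p ^ n / R₁ ^ (2 * n + 1)) := fun n => by
    obtain ⟨-, -, hM, -⟩ := hMq n
    have h := outerRadial_le_of_ge hκ (ν := (n : ℝ) + 1 / 2)
      (by linarith [(n.cast_nonneg : (0 : ℝ) ≤ n)]) hR (pow_pos hR₁0 2)
      (pow_le_pow_left₀ hR₁0.le hR₁R.le 2)
    have hpow : ∀ t : ℝ, 0 < t → (t ^ 2) ^ ((n : ℝ) + 1 / 2 + κ * R / 2) =
        t ^ (2 * n + 1) * t ^ (κ * R) := fun t ht => by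
      rw [Real.rpow_add (by positivity), sq_rpow_add_half ht.le, ← Real.rpow_natCast t 2,
        ← Real.rpow_mul ht.le]
      congr 2
      push_cast
      ring
    rw [hpow _ hR₁0, hpow _ hR] at h
    have w1 : 0 < R₁ ^ (κ * R) := Real.rpow_pos_of_pos hR₁0 _
    have w2 : 0 < R ^ (κ * R) := Real.rpow_pos_of_pos hR _
    have h1M : |1 + M n| ≤ 1 + B := (abs_add_le _ _).trans (by rw [abs_one]; gcongr)
    rw [hc, abs_div, abs_mul, abs_of_pos (hφR n), abs_of_pos (by positivity : 0 < k * _),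
      Real.div_rpow hR.le hR₁0.le]
    have h' : outerRadial κ (n + 1 / 2) (R₁ ^ 2) ≤ R ^ (2 * n + 1) * R ^ (κ * R) * φ n (R ^ 2) /
        (R₁ ^ (2 * n + 1) * R₁ ^ (κ * R)) := by
      rw [le_div_iff₀ (by positivity), mul_comm]
      exact h
    have := hφR n
    have := outerRadial_pos hκ ((n : ℝ) + 1 / 2) (pow_pos hR₁0 2)
    calc _ ≤ k * (p ^ n / R ^ (2 * n + 1)) * (1 + B) / φ n (R ^ 2) *
          (R ^ (2 * n + 1) * R ^ (κ * R) * φ n (R ^ 2) / (R₁ ^ (2 * n + 1) * R₁ ^ (κ * R))) := by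
          gcongr
      _ = _ := by field_simp
  set Φ : Space → ℝ := fun r => ∑' n, a n * Y n r with hΦ
  set Go : Space → ℝ := fun r => ∑' n : ℕ, c n * (outerRadial κ (n + 1 / 2) (‖r‖ ^ 2) * Y n r) with hGo
  have hin := fun (x : Space) (hx : ‖x‖ < T) => inner_series hY hT0 (by positivity) hqT ha_le hx
  have hout := fun (x : Space) (hx : R₁ < ‖x‖) => outer_series hY hκ hp0.le hpR₁ hc_le hx
  have hΦsum : ∀ r : Space, ‖r‖ < T → HasSum (fun n => a n * Y n r) (Φ r) := fun r hr => by
    refine Summable.hasSum (.of_norm_bounded ((summable_geometric_of_lt_one (by positivity)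
      hqT).mul_left (k * B / R)) fun n => ?_)
    rw [norm_mul, Real.norm_eq_abs, mul_pow, ← mul_assoc]
    exact mul_le_mul (ha_le n) (((hY n).norm_le r).trans (pow_le_pow_left₀ (norm_nonneg r) hr.le n))
      (norm_nonneg _) (by positivity)
  have hYsph : ∀ (n : ℕ) (v : Space), ‖v‖ = 1 → Y n (R • v) = R ^ n * (legendreP n).eval (inner ℝ e v) :=
    fun n v hv => by
      rw [hYr, norm_smul, hv, mul_one, Real.norm_of_nonneg hR.le, inner_smul_right,
        mul_div_cancel_left₀ _ hR.ne']
  have hnorm : ∀ v : Space, ‖v‖ = 1 → ‖R • v‖ = R := fun v hv => by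
    rw [norm_smul, hv, mul_one, Real.norm_of_nonneg hR.le]
  have hcoul : ∀ r, coulomb εi rs r = k * (1 / ‖r - p • e‖) := fun r => by
    rw [coulomb, ← hrse, hk, one_div_mul_one_div]
  refine ⟨fun r => coulomb εi rs r + Φ r, Go, Φ, ⟨fun r _ _ => rfl, fun x hx => ?_, ?_, ?_, ?_, ?_,
    ?_, ?_, ?_⟩, ?_⟩
  · have hxT : ‖x‖ < T := (mem_ball_zero_iff.1 hx).trans hRT
    refine ⟨(hin x hxT).1, ?_⟩
    have hopen : IsOpen {y : Space | ‖y‖ < T} := isOpen_lt continuous_norm continuous_const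
    filter_upwards [hopen.mem_nhds hxT] with y hy
    exact (hin y hy).2.1
  · exact fun x hx => (hin x ((mem_closedBall_zero_iff.1 hx).trans_lt
      hRT)).1.continuousAt.continuousWithinAt
  · exact fun x hx => (hout x (hR₁R.trans hx)).1.contDiffWithinAt
  · intro r hr
    rw [(hout r (hR₁R.trans hr)).2.1]
    ring
  · exact fun x hx => (hout x (hR₁R.trans_le hx)).1.continuousAt.continuousWithinAt
  · have hinv : Tendsto (fun r : Space => k * (1 + B) * (R / R₁) ^ (κ * R) * (1 - p / R₁)⁻¹ * ‖r‖⁻¹)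
        (Bornology.cobounded Space) (𝓝 0) := by
      simpa using (tendsto_inv_atTop_zero.comp tendsto_norm_cobounded_atTop).const_mul _
    refine squeeze_zero_norm' ?_ hinv
    filter_upwards [tendsto_norm_cobounded_atTop.eventually_ge_atTop R₁] with r hr
    exact outer_series_norm_le hY hκ hp0.le hpR₁ hc_le hr
  · intro r hr
    obtain ⟨v, hv, rfl⟩ : ∃ v : Space, ‖v‖ = 1 ∧ r = R • v := by
      have : ‖r‖ = R := mem_sphere_zero_iff_norm.1 hr
      refine ⟨R⁻¹ • r, ?_, (smul_inv_smul₀ hR.ne' r).symm⟩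
      rw [norm_smul, this, norm_inv, Real.norm_of_nonneg hR.le, inv_mul_cancel₀ hR.ne']
    have h1 := ((hasSum_inv_norm_smul_sub he1 hv hp0.le hrsR).mul_left k).add
      (hΦsum (R • v) ((hnorm v hv).trans_lt hRT))
    simp only [hcoul]
    rw [← h1.tsum_eq]
    refine tsum_congr fun n => ?_
    rw [hYsph n v hv, hnorm v hv, ha, hc]
    have := (hφR n).ne'
    have e2 : outerRadial κ ((n : ℝ) + 1 / 2) (R ^ 2) = φ n (R ^ 2) := rfl
    have e3 : R ^ (2 * n + 1) = R ^ (n + 1) * R ^ n := by rw [← pow_add]; congr 1; ring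
    simp only [e2, e3]
    field_simp
  · intro v hv
    obtain ⟨d₀, hd₀, hs₀⟩ := exists_hasDerivAt_inv_norm_smul_sub he1 hv hp0.le hrsR
    obtain ⟨-, -, D₁, hD₁, hs₁⟩ := hin (R • v) ((hnorm v hv).trans_lt hRT)
    obtain ⟨-, -, D₂, hD₂, hs₂⟩ := hout (R • v) ((hnorm v hv).symm ▸ hR₁R)
    refine ⟨k * d₀ + D₁ v, D₂ v, ?_, (hasDerivAt_comp_smul_const hD₂).hasDerivWithinAt, ?_⟩
    · have hG : (fun t : ℝ => coulomb εi rs (t • v) + Φ (t • v)) =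
          (fun t : ℝ => k * (1 / ‖t • v - p • e‖)) + fun t => Φ (t • v) :=
        funext fun t => by rw [hcoul]; rfl
      rw [hG]
      exact ((hd₀.const_mul k).add (hasDerivAt_comp_smul_const hD₁)).hasDerivWithinAt
    · rw [map_smul, smul_eq_mul] at hs₁ hs₂
      have h1 := ((hs₀.mul_left (k * R)).add hs₁).mul_left εi
      have h2 := hs₂.mul_left εo
      have h3 : εi * (k * R * d₀ + R * D₁ v) = εo * (R * D₂ v) := by
        rw [← h1.tsum_eq, ← h2.tsum_eq]
        refine tsum_congr fun n => ?_
        obtain ⟨-, -, -, hM, hw⟩ := hMq n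
        rw [hYsph n v hv, hnorm v hv, hw, ha, hc]
        have := (hφR n).ne'
        have e2 : outerRadial κ ((n : ℝ) + 1 / 2) (R ^ 2) = φ n (R ^ 2) := rfl
        have e3 : R ^ (2 * n + 1) = R ^ (n + 1) * R ^ n := by rw [← pow_add]; congr 1; ring
        have e4 : R ^ (n + 2) = R ^ (n + 1) * R := by rw [← pow_succ]
        -- The flux condition for a single degree, a rearrangement of the defining relation of `M
        -- n`.
        have hM' : εi * (n * M n - (n + 1)) = -(εo * ((1 + M n) * (n + 1 + q n))) := by
          have : εi = εi / εo * εo := (div_mul_cancel₀ _ hεo.ne').symm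
          rw [this]
          linear_combination εo * hM
        simp only [e2, e3, e4]
        have lhs : ∀ P : ℝ, εi * (k * R * -((n + 1) * (p ^ n / (R ^ (n + 1) * R)) * P) +
            k * (p ^ n / (R ^ (n + 1) * R ^ n)) * M n * (n * (R ^ n * P))) =
            k * p ^ n / R ^ (n + 1) * P * (εi * (n * M n - (n + 1))) := fun P => by
          field_simp
          ring
        rw [lhs, hM']
        field_simp
      refine mul_left_cancel₀ hR.ne' ?_
      linear_combination h3
  · intro r hr
    have h := Complex.hasSum_ofReal.2 (hΦsum r ((mem_closedBall_zero_iff.1 hr).trans_lt hRT))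
    refine h.congr_fun fun n => ?_
    have hcos : Real.cos (InnerProductGeometry.angle rs r) = inner ℝ e r / ‖r‖ := cos_angle_eq r
    rw [kirkwoodTerm, (hMq n).1, hcos, norm_kelvinPoint hrs, hYr, ← hp]
    generalize (legendreP n).eval (inner ℝ e r / ‖r‖) = P
    rw [← Complex.ofReal_mul, ← Complex.ofReal_mul, ha]
    congr 1
    have e3 : R ^ (2 * n + 1) = R ^ (n + 1) * R ^ n := by rw [← pow_add]; congr 1; ring
    simp only [e3, div_pow, ← pow_mul]
    have e4 : R ^ (2 * (n + 1)) = R ^ (n + 1) * R ^ n * R := by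
      rw [← pow_add, ← pow_succ]; congr 1; ring
    rw [e4, hk, pow_succ p]
    field_simp

/-! ### Maximum principles and uniqueness -/

/-- With a positive second derivative the point would also be a local minimum, so the function would
be locally constant and the second derivative zero. -/
theorem deriv_deriv_nonpos_of_isLocalMax {g : ℝ → ℝ} {x : ℝ} (hg : ContinuousAt g x)
    (h : IsLocalMax g x) : deriv (deriv g) x ≤ 0 := by
  by_contra! hpos
  have hmin := isLocalMin_of_deriv_deriv_pos hpos h.deriv_eq_zero hg
  have hc : g =ᶠ[𝓝 x] fun _ => g x := by
    filter_upwards [h, hmin] with y h1 h2 using le_antisymm h1 h2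
  have := hc.deriv.deriv_eq
  simp at this
  linarith

theorem nonneg_of_hasDerivWithinAt_Iic {f : ℝ → ℝ} {a R : ℝ} (h : HasDerivWithinAt f a (Set.Iic R) R)
    (hf : ∀ᶠ t in 𝓝[<] R, f t ≤ f R) : 0 ≤ a := by
  rw [hasDerivWithinAt_iff_tendsto_slope, Set.Iic_sdiff_right] at h
  refine ge_of_tendsto h ?_
  filter_upwards [hf, self_mem_nhdsWithin] with t h1 h2
  rw [slope_def_field]
  exact div_nonneg_of_nonpos (sub_nonpos.2 h1) (sub_nonpos.2 (le_of_lt h2))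

theorem nonpos_of_hasDerivWithinAt_Ici {f : ℝ → ℝ} {a R : ℝ} (h : HasDerivWithinAt f a (Set.Ici R) R)
    (hf : ∀ᶠ t in 𝓝[>] R, f t ≤ f R) : a ≤ 0 := by
  rw [hasDerivWithinAt_iff_tendsto_slope, Set.Ici_sdiff_left] at h
  refine le_of_tendsto h ?_
  filter_upwards [hf, self_mem_nhdsWithin] with t h1 h2
  rw [slope_def_field]
  exact div_nonpos_of_nonpos_of_nonneg (sub_nonpos.2 h1) (sub_nonneg.2 (le_of_lt h2))

section

variable {E : Type*} [NormedAddCommGroup E] [InnerProductSpace ℝ E] [FiniteDimensional ℝ E]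

theorem laplacian_nonpos_of_isLocalMax {f : E → ℝ} {x : E} (hf : ContDiffAt ℝ 2 f x)
    (h : IsLocalMax f x) : (Δ f) x ≤ 0 := by
  rw [laplacian_eq_iteratedFDeriv_stdOrthonormalBasis]
  refine Finset.sum_nonpos fun i _ => ?_
  set v := stdOrthonormalBasis ℝ E i
  have hline : ∀ t : ℝ, HasDerivAt (fun t : ℝ => x + t • v) v t := fun t => by
    simpa using ((hasDerivAt_id t).smul_const v).const_add x
  have hx : x + (0 : ℝ) • v = x := by simp
  have hlim : Tendsto (fun t : ℝ => x + t • v) (𝓝 0) (𝓝 x) := by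
    have := (hline 0).continuousAt.tendsto
    rwa [hx] at this
  have hf1 : ∀ᶠ y in 𝓝 x, DifferentiableAt ℝ f y := by
    filter_upwards [hf.eventually (by simp)] with y hy using hy.differentiableAt (by norm_num)
  have hf2 : DifferentiableAt ℝ (fderiv ℝ f) x :=
    (hf.fderiv_right (m := 1) (by norm_num)).differentiableAt (by norm_num)
  have hd : deriv (fun t : ℝ => f (x + t • v)) =ᶠ[𝓝 0] fun t => fderiv ℝ f (x + t • v) v := by
    filter_upwards [hlim.eventually hf1] with t ht
    exact (ht.hasFDerivAt.comp_hasDerivAt t (hline t)).deriv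
  have hdd : deriv (deriv fun t : ℝ => f (x + t • v)) 0 = fderiv ℝ (fderiv ℝ f) x v v := by
    rw [hd.deriv_eq]
    have h2 : HasFDerivAt (fderiv ℝ f) (fderiv ℝ (fderiv ℝ f) x) (x + (0 : ℝ) • v) := by
      rw [hx]
      exact hf2.hasFDerivAt
    exact ((ContinuousLinearMap.apply ℝ ℝ v).hasFDerivAt.comp_hasDerivAt (0 : ℝ)
      (h2.comp_hasDerivAt (0 : ℝ) (hline 0))).deriv
  have hmax : IsLocalMax (fun t : ℝ => f (x + t • v)) 0 := by
    have := hlim.eventually h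
    filter_upwards [this] with t ht
    rwa [hx]
  have hcont : ContinuousAt (fun t : ℝ => f (x + t • v)) 0 :=
    ContinuousAt.comp (by rw [hx]; exact hf.continuousAt) (hline 0).continuousAt
  rw [iteratedFDeriv_two_apply]
  simpa [hdd] using deriv_deriv_nonpos_of_isLocalMax hcont hmax

theorem laplacian_norm_sq (x : E) :
    (Δ fun r : E => ‖r‖ ^ 2) x = 2 * (Module.finrank ℝ E : ℝ) := by
  have hj : HasJetOn (fun r : E => ‖r‖ ^ 2) (fun r => (2 : ℝ) • innerCLM E r)
      (fun _ => (2 : ℝ) • innerCLM E) Set.univ :=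
    ⟨fun r _ => (hasStrictFDerivAt_norm_sq r).hasFDerivAt.congr_fderiv (by
      ext v
      simp [innerCLM_apply]), fun r _ => ((2 : ℝ) • innerCLM E).hasFDerivAt,
      continuousOn_const⟩
  rw [hj.laplacian_eq isOpen_univ (stdOrthonormalBasis ℝ E) (Set.mem_univ x)]
  simp [innerCLM_apply, mul_comm]

/-- The weak maximum principle for harmonic functions on a ball. -/
theorem le_of_harmonicOnNhd_ball [Nontrivial E] {w : E → ℝ} {R m : ℝ} (hR : 0 < R)
    (hw : HarmonicOnNhd w (Metric.ball 0 R)) (hc : ContinuousOn w (Metric.closedBall 0 R))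
    (hm : ∀ r ∈ Metric.sphere (0 : E) R, w r ≤ m) {r : E} (hr : r ∈ Metric.closedBall 0 R) :
    w r ≤ m := by
  have key : ∀ δ : ℝ, 0 < δ → w r ≤ m + δ * R ^ 2 := fun δ hδ => by
    -- The perturbation has positive Laplacian, which excludes an interior maximum; `δ` tends to `0`
    -- at the end.
    set f : E → ℝ := w + δ • fun r => ‖r‖ ^ 2 with hf
    have hfr : ∀ r, f r = w r + δ * ‖r‖ ^ 2 := fun r => rfl
    have hfc : ContinuousOn f (Metric.closedBall 0 R) := by
      refine hc.add (Continuous.continuousOn ?_)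
      exact (continuous_norm.pow 2).const_smul δ
    obtain ⟨x, hx, hmax⟩ := (isCompact_closedBall (0 : E) R).exists_isMaxOn ⟨r, hr⟩ hfc
    have hxR : x ∈ Metric.sphere (0 : E) R := by
      by_contra hxs
      have hxb : x ∈ Metric.ball (0 : E) R := by
        rw [mem_sphere_zero_iff_norm] at hxs
        rw [mem_closedBall_zero_iff] at hx
        exact mem_ball_zero_iff.2 (lt_of_le_of_ne hx hxs)
      have hwx := hw x hxb
      have hq : ContDiffAt ℝ 2 (fun r : E => ‖r‖ ^ 2) x := (contDiff_norm_sq ℝ).contDiffAt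
      have hq' : ContDiffAt ℝ 2 (δ • fun r : E => ‖r‖ ^ 2) x := hq.const_smul δ
      have h1 : (Δ f) x = δ * (2 * (Module.finrank ℝ E : ℝ)) := by
        rw [hf, hwx.1.laplacian_add hq', laplacian_smul δ hq, laplacian_norm_sq,
          hwx.2.self_of_nhds]
        simp
      have h2 := laplacian_nonpos_of_isLocalMax (f := f) (hwx.1.add hq')
        (hmax.isLocalMax (Metric.closedBall_mem_nhds_of_mem hxb))
      rw [h1] at h2
      have h3 : (0 : ℝ) < Module.finrank ℝ E := by exact_mod_cast Module.finrank_pos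
      have : 0 < δ * (2 * (Module.finrank ℝ E : ℝ)) := by positivity
      linarith
    have h1 : f r ≤ f x := hmax hr
    have h2 := hm x hxR
    rw [hfr, hfr, mem_sphere_zero_iff_norm.1 hxR] at h1
    nlinarith [sq_nonneg ‖r‖]
  refine le_of_forall_pos_le_add fun η hη => ?_
  have := key (η / R ^ 2) (by positivity)
  rwa [div_mul_cancel₀ _ (by positivity)] at this

/-- The maximum principle for subsolutions of the screened Poisson equation outside a ball. -/
theorem nonpos_of_laplacian_pos {g : E → ℝ} {R : ℝ}
    (hg : ∀ x : E, R < ‖x‖ → ContDiffAt ℝ 2 g x) (hc : ContinuousOn g {r : E | R ≤ ‖r‖})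
    (hΔ : ∀ x : E, R < ‖x‖ → 0 < g x → 0 < (Δ g) x)
    (hs : ∀ x : E, ‖x‖ = R → g x ≤ 0)
    (hlim : ∀ η > 0, ∀ᶠ x in Bornology.cobounded E, g x < η) {r : E} (hr : R ≤ ‖r‖) : g r ≤ 0 := by
  by_contra! hpos
  obtain ⟨T, hT⟩ : ∃ T, ∀ x : E, T ≤ ‖x‖ → g x < g r := by
    have := hlim _ hpos
    rw [← comap_norm_atTop, eventually_comap] at this
    obtain ⟨T, hT⟩ := this.exists_forall_of_atTop
    exact ⟨T, fun x hx => hT _ hx x rfl⟩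
  -- Outside the ball of radius `T` the function is below its value at `r`, so a maximum over this
  -- compact shell is a maximum over the whole exterior.
  set K : Set E := Metric.closedBall 0 (max T ‖r‖) ∩ {r : E | R ≤ ‖r‖} with hK
  have hKc : IsCompact K := (isCompact_closedBall _ _).inter_right
    (isClosed_le continuous_const continuous_norm)
  have hrK : r ∈ K := ⟨mem_closedBall_zero_iff.2 (le_max_right _ _), hr⟩
  obtain ⟨x, hx, hmax⟩ := hKc.exists_isMaxOn ⟨r, hrK⟩ (hc.mono Set.inter_subset_right)
  have hrx : g r ≤ g x := hmax hrK
  have hxR : R < ‖x‖ := by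
    refine lt_of_le_of_ne hx.2 fun h => ?_
    have := hs x h.symm
    linarith
  have hloc : IsLocalMax g x := by
    have hopen : IsOpen {y : E | R < ‖y‖} := isOpen_lt continuous_const continuous_norm
    filter_upwards [hopen.mem_nhds hxR] with y hy
    by_cases hyT : T ≤ ‖y‖
    · exact (hT y hyT).le.trans hrx
    · exact hmax ⟨mem_closedBall_zero_iff.2 ((not_le.1 hyT).le.trans (le_max_left _ _)), le_of_lt hy⟩
  have h1 := laplacian_nonpos_of_isLocalMax (hg x hxR) hloc
  have h2 := hΔ x hxR (hpos.trans_le hrx)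
  linarith

end

/-- The spherically symmetric decaying solution of the screened Poisson equation. -/
theorem laplacian_outerRadial_half {κ : ℝ} (hκ : 0 < κ) {x : Space} (hx : x ≠ 0) :
    ContDiffAt ℝ 2 (fun r : Space => outerRadial κ (1 / 2) (‖r‖ ^ 2)) x ∧
      (Δ fun r : Space => outerRadial κ (1 / 2) (‖r‖ ^ 2)) x =
        κ ^ 2 * outerRadial κ (1 / 2) (‖x‖ ^ 2) := by
  set b := EuclideanSpace.basisFun (Fin 3) ℝ
  obtain ⟨Y, Y', Y'', hY, hYr⟩ := exists_isHarmonicForm_zonal b 0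
  have hY1 : ∀ r, Y r = 1 := fun r => by rw [hYr]; simp [legendreP]
  obtain ⟨F', F'', hj, -, -, -, htr⟩ := hY.exists_hasJetOn_radial_mul
    (φ := outerRadial κ (1 / 2)) (k := κ ^ 2) (fun ρ hρ => hasDerivAt_outerRadial hκ _ hρ)
    (fun ρ hρ => (hasDerivAt_outerRadial hκ _ hρ).const_mul _)
    (fun ρ hρ => (((hasDerivAt_outerRadial hκ _ hρ).const_mul _).const_mul
      _).continuousAt.continuousWithinAt) (fun ρ hρ => by
    have h := outerRadial_recurrence hκ ((1 : ℝ) / 2 + 1) hρ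
    rw [add_sub_cancel_right] at h
    push_cast
    linear_combination κ * h)
  simp only [hY1, mul_one] at hj htr
  have hopen : IsOpen ({0}ᶜ : Set Space) := isOpen_compl_singleton
  exact ⟨hj.contDiffOn.contDiffAt (hopen.mem_nhds hx), (hj.laplacian_eq hopen b hx).trans (htr x hx)⟩

/-- A transmission problem without sources has no positive solution. -/
theorem nonpos_of_transmission {εi εo κ R : ℝ} (hεi : 0 < εi) (hεo : 0 < εo) (hκ : 0 < κ)
    (hR : 0 < R) {w v : Space → ℝ} (hw : HarmonicOnNhd w (Metric.ball 0 R))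
    (hwc : ContinuousOn w (Metric.closedBall 0 R))
    (hv : ∀ x : Space, R < ‖x‖ → ContDiffAt ℝ 2 v x)
    (hvΔ : ∀ x : Space, R < ‖x‖ → (Δ v) x = κ ^ 2 * v x)
    (hvc : ContinuousOn v {r : Space | R ≤ ‖r‖})
    (hv0 : Tendsto v (Bornology.cobounded Space) (𝓝 0))
    (hwv : ∀ x ∈ Metric.sphere (0 : Space) R, w x = v x)
    (hflux : ∀ ν : Space, ‖ν‖ = 1 → ∃ a b : ℝ,
      HasDerivWithinAt (fun t : ℝ => w (t • ν)) a (Set.Iic R) R ∧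
      HasDerivWithinAt (fun t : ℝ => v (t • ν)) b (Set.Ici R) R ∧ εi * a = εo * b)
    {r : Space} (hr : r ∈ Metric.closedBall 0 R) : w r ≤ 0 := by
  obtain ⟨x₀, hx₀, hmax⟩ := (isCompact_sphere (0 : Space) R).exists_isMaxOn
    (NormedSpace.sphere_nonempty.2 hR.le) (hwc.mono Metric.sphere_subset_closedBall)
  set m := w x₀ with hm
  have hball : ∀ y ∈ Metric.closedBall (0 : Space) R, w y ≤ m := fun y hy =>
    le_of_harmonicOnNhd_ball hR hw hwc (fun z hz => hmax hz) hy
  refine (hball r hr).trans ?_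
  by_contra! hpos
  have hx₀R : ‖x₀‖ = R := mem_sphere_zero_iff_norm.1 hx₀
  -- A barrier: `A φ` is the radial decaying solution with value `m` on the sphere. It lies above
  -- `v` outside and touches it at `x₀`, and its outward derivative is strictly negative.
  set φ := outerRadial κ (1 / 2) with hφ
  have hφ0 : ∀ x : Space, R ≤ ‖x‖ → 0 < φ (‖x‖ ^ 2) := fun x hx =>
    outerRadial_pos hκ _ (pow_pos (hR.trans_le hx) 2)
  have hφR : 0 < φ (R ^ 2) := outerRadial_pos hκ _ (pow_pos hR 2)
  set A := m / φ (R ^ 2) with hA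
  have hA0 : 0 < A := div_pos hpos hφR
  have hne : ∀ x : Space, R ≤ ‖x‖ → x ≠ 0 := fun x hx =>
    norm_pos_iff.1 (hR.trans_le hx)
  -- comparison with the radial solution
  have hcomp : ∀ x : Space, R ≤ ‖x‖ → v x ≤ A * φ (‖x‖ ^ 2) := fun x hx => by
    have hd : ∀ x : Space, R ≤ ‖x‖ → ContDiffAt ℝ 2 (A • fun r : Space => φ (‖r‖ ^ 2)) x :=
      fun x hx => (laplacian_outerRadial_half hκ (hne x hx)).1.const_smul A
    have := nonpos_of_laplacian_pos (g := v - A • fun r : Space => φ (‖r‖ ^ 2)) (R := R)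
      (fun x hx => (hv x hx).sub (hd x hx.le))
      (hvc.sub fun x hx => (hd x hx).continuousAt.continuousWithinAt) (fun x hx hgx => by
        rw [(hv x hx).laplacian_sub (hd x hx.le), hvΔ x hx,
          laplacian_smul A (laplacian_outerRadial_half hκ (hne x hx.le)).1,
          (laplacian_outerRadial_half hκ (hne x hx.le)).2]
        have h1 : 0 < κ ^ 2 * (v x - A * φ (‖x‖ ^ 2)) := mul_pos (pow_pos hκ 2) hgx
        rw [smul_eq_mul]
        linarith) (fun x hx => by
        have hxs : x ∈ Metric.sphere (0 : Space) R := mem_sphere_zero_iff_norm.2 hx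
        have h1 : v x ≤ m := (hwv x hxs) ▸ hmax hxs
        have h2 : A * φ (‖x‖ ^ 2) = m := by rw [hx, hA, div_mul_cancel₀ _ hφR.ne']
        change v x - A * φ (‖x‖ ^ 2) ≤ 0
        linarith) (fun η hη => by
        have hfar : ∀ᶠ x : Space in Bornology.cobounded Space, R ≤ ‖x‖ :=
          tendsto_norm_cobounded_atTop.eventually_ge_atTop R
        filter_upwards [hv0.eventually_lt_const hη, hfar] with x h1 h2
        have h3 := mul_pos hA0 (hφ0 x h2)
        change v x - A * φ (‖x‖ ^ 2) < η
        linarith) hx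
    exact sub_nonpos.1 this
  set ν : Space := R⁻¹ • x₀ with hν
  have hν1 : ‖ν‖ = 1 := by
    rw [hν, norm_smul, hx₀R, norm_inv, Real.norm_of_nonneg hR.le, inv_mul_cancel₀ hR.ne']
  have hRν : R • ν = x₀ := smul_inv_smul₀ hR.ne' x₀
  obtain ⟨a, b, ha, hb, hab⟩ := hflux ν hν1
  -- the inner derivative is nonnegative
  have hnorm : ∀ t : ℝ, 0 ≤ t → ‖t • ν‖ = t := fun t ht => by
    rw [norm_smul, hν1, mul_one, Real.norm_of_nonneg ht]
  have ha0 : 0 ≤ a := by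
    refine nonneg_of_hasDerivWithinAt_Iic ha ?_
    filter_upwards [Ioo_mem_nhdsLT hR] with t ht
    rw [hRν]
    exact hball _ (mem_closedBall_zero_iff.2 ((hnorm t ht.1.le).trans_le ht.2.le))
  have hb0 : b ≤ A * (-(κ / 2) * outerRadial κ (1 / 2 + 1) (R ^ 2) * (2 * R)) := by
    have hd : HasDerivAt (fun t : ℝ => A * φ (t ^ 2))
        (A * (-(κ / 2) * outerRadial κ (1 / 2 + 1) (R ^ 2) * (2 * R))) R := by
      have h2 : HasDerivAt (fun t : ℝ => t ^ 2) (2 * R) R := by simpa using hasDerivAt_pow 2 R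
      exact (HasDerivAt.comp (h₂ := φ) (h := fun t : ℝ => t ^ 2) R (hasDerivAt_outerRadial hκ (1 / 2) (pow_pos hR 2))
        h2).const_mul A
    have h := nonpos_of_hasDerivWithinAt_Ici (hb.sub hd.hasDerivWithinAt) ?_
    · exact sub_nonpos.1 h
    · filter_upwards [self_mem_nhdsWithin] with t ht
      have ht0 : 0 ≤ t := hR.le.trans (le_of_lt ht)
      have h1 := hcomp (t • ν) ((hnorm t ht0).symm ▸ le_of_lt ht)
      rw [hnorm t ht0] at h1
      have h2 : v (R • ν) = A * φ (R ^ 2) := by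
        rw [hRν, ← hwv x₀ hx₀, hA, div_mul_cancel₀ _ hφR.ne']
      change v (t • ν) - A * φ (t ^ 2) ≤ v (R • ν) - A * φ (R ^ 2)
      linarith
  have hneg : A * (-(κ / 2) * outerRadial κ (1 / 2 + 1) (R ^ 2) * (2 * R)) < 0 := by
    have := outerRadial_pos hκ (1 / 2 + 1) (pow_pos hR 2)
    have : 0 < A * (κ / 2 * outerRadial κ (1 / 2 + 1) (R ^ 2) * (2 * R)) := by positivity
    linarith
  have h1 : 0 ≤ εi * a := mul_nonneg hεi.le ha0
  have h2 : εo * b < 0 := mul_neg_of_pos_of_neg hεo (hb0.trans_lt hneg)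
  linarith

/-- The reaction potential of the Green's function problem is unique. -/
theorem IsGreenSolution.eq {εi εo κ R : ℝ} (hεi : 0 < εi) (hεo : 0 < εo) (hκ : 0 < κ) (hR : 0 < R)
    {rs : Space} (hrs : ‖rs‖ < R) {Gi Go Φ Gi' Go' Φ' : Space → ℝ}
    (h : IsGreenSolution εi εo κ R rs Gi Go Φ) (h' : IsGreenSolution εi εo κ R rs Gi' Go' Φ')
    {r : Space} (hr : r ∈ Metric.closedBall 0 R) : Φ r = Φ' r := by
  have key : ∀ {Gi Go Φ Gi' Go' Φ' : Space → ℝ}, IsGreenSolution εi εo κ R rs Gi Go Φ →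
      IsGreenSolution εi εo κ R rs Gi' Go' Φ' → Φ r ≤ Φ' r := fun {Gi Go Φ Gi' Go' Φ'} h h' => by
    have hopen : IsOpen {r : Space | R < ‖r‖} := isOpen_lt continuous_const continuous_norm
    have hne : ∀ x : Space, ‖rs‖ < ‖x‖ → x ≠ rs := fun x hx e => by simp [e] at hx
    have hdiff : ∀ x : Space, ‖rs‖ < ‖x‖ → ‖x‖ ≤ R → Gi x - Gi' x = Φ x - Φ' x := fun x hx hxR => by
      have hx' := mem_closedBall_zero_iff.2 hxR
      rw [h.inner_eq x hx' (hne x hx), h'.inner_eq x hx' (hne x hx), add_sub_add_left_eq_sub]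
    have hv : ∀ x : Space, R < ‖x‖ → ContDiffAt ℝ 2 Go x := fun x hx =>
      h.outer_contDiff.contDiffAt (hopen.mem_nhds hx)
    have hv' : ∀ x : Space, R < ‖x‖ → ContDiffAt ℝ 2 Go' x := fun x hx =>
      h'.outer_contDiff.contDiffAt (hopen.mem_nhds hx)
    refine sub_nonpos.1 (nonpos_of_transmission hεi hεo hκ hR (w := Φ - Φ') (v := Go - Go')
      (fun x hx => (h.inner_harmonic x hx).sub (h'.inner_harmonic x hx))
      (h.inner_continuous.sub h'.inner_continuous) (fun x hx => (hv x hx).sub (hv' x hx))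
      (fun x hx => ?_) (h.outer_continuous.sub h'.outer_continuous) ?_ (fun x hx => ?_)
      (fun ν hν => ?_) hr)
    · rw [(hv x hx).laplacian_sub (hv' x hx), Pi.sub_apply]
      linarith [h.outer_eq x hx, h'.outer_eq x hx]
    · have := h.outer_decay.sub h'.outer_decay
      rwa [sub_zero] at this
    · have hxR := mem_sphere_zero_iff_norm.1 hx
      rw [Pi.sub_apply, Pi.sub_apply, ← h.interface_eq x hx, ← h'.interface_eq x hx,
        hdiff x (hxR ▸ hrs) hxR.le]
    · obtain ⟨a, b, ha, hb, hab⟩ := h.interface_flux ν hν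
      obtain ⟨a', b', ha', hb', hab'⟩ := h'.interface_flux ν hν
      have hnorm : ∀ t : ℝ, 0 ≤ t → ‖t • ν‖ = t := fun t ht => by
        rw [norm_smul, hν, mul_one, Real.norm_of_nonneg ht]
      refine ⟨a - a', b - b', ?_, hb.sub hb', by linarith⟩
      refine (ha.sub ha').congr_of_eventuallyEq_of_mem ?_ Set.self_mem_Iic
      -- The Coulomb parts cancel only away from the source, and near the sphere one has `t > |rs|`.
      filter_upwards [mem_nhdsWithin_of_mem_nhds (Ioi_mem_nhds hrs), self_mem_nhdsWithin] with t h1 h2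
      have ht := hnorm t ((norm_nonneg rs).trans (le_of_lt h1))
      exact (hdiff (t • ν) (ht.symm ▸ h1) (ht.symm ▸ h2)).symm
  exact le_antisymm (key h h') (key h' h)

/-! ### The image charges -/

theorem image_div_Ioo {K : ℝ} (hK : 0 < K) : (fun t : ℝ => K / t) '' Set.Ioo 0 1 = Set.Ioi K := by
  ext x
  constructor
  · rintro ⟨t, ⟨h0, h1⟩, rfl⟩
    rw [Set.mem_Ioi, lt_div_iff₀ h0]
    nlinarith
  · intro hx
    have hx0 : 0 < x := hK.trans hx
    exact ⟨K / x, ⟨div_pos hK hx0, (div_lt_one hx0).2 hx⟩, by field_simp⟩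

/-- The real form of a finite Mellin transform at the nonnegative integers. -/
theorem IsFiniteMellinTransform.natCast {f : GenFun} {F : ℂ → ℂ} (h : IsFiniteMellinTransform f F)
    (n : ℕ) : IntegrableOn (fun t => f.density t / t * t ^ n) (Set.Ioc 0 1) ∧
      F n = (f.atom + ∫ t in Set.Ioc (0 : ℝ) 1, f.density t / t * t ^ n : ℝ) := by
  obtain ⟨h1, h2⟩ := h n (by simp)
  have e : ∀ t ∈ Set.Ioc (0 : ℝ) 1, (f.density t : ℂ) * (t : ℂ) ^ ((n : ℂ) - 1) =
      ((f.density t / t * t ^ n : ℝ) : ℂ) := fun t ht => by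
    have ht0 : (t : ℂ) ≠ 0 := by exact_mod_cast ht.1.ne'
    rw [Complex.cpow_sub _ _ ht0, Complex.cpow_natCast, Complex.cpow_one]
    push_cast
    ring
  constructor
  · exact (h1.congr_fun e measurableSet_Ioc).re
  · rw [h2, setIntegral_congr_fun measurableSet_Ioc e, integral_complex_ofReal]
    push_cast
    rfl

theorem kelvinPoint_eq_smul {R : ℝ} {rs : Space} (hrs : rs ≠ 0) :
    kelvinPoint R rs = ‖kelvinPoint R rs‖ • (‖rs‖⁻¹ • rs) := by
  have h0 : 0 < ‖rs‖ := norm_pos_iff.2 hrs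
  rw [norm_kelvinPoint hrs, kelvinPoint, smul_smul]
  congr 1
  field_simp

/-- The potential of a line of image charges whose density is given by a finite Mellin transform is
a series of Legendre polynomials. -/
theorem hasSum_mellin_legendreP {e r : Space} (he : ‖e‖ = 1) {K : ℝ} (hrK : ‖r‖ < K) {f : GenFun}
    {F : ℂ → ℂ} (hF : IsFiniteMellinTransform f F) :
    IntegrableOn (fun t : ℝ => f.density t / t * (1 / ‖t • r - K • e‖)) (Set.Ioc 0 1) ∧
    HasSum (fun n : ℕ => ‖r‖ ^ n / K ^ (n + 1) * (legendreP n).eval (inner ℝ e r / ‖r‖) *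
      ∫ t in Set.Ioc (0 : ℝ) 1, f.density t / t * t ^ n)
      (∫ t in Set.Ioc (0 : ℝ) 1, f.density t / t * (1 / ‖t • r - K • e‖)) := by
  have hK : 0 < K := (norm_nonneg r).trans_lt hrK
  -- The case `n = 0`, that is, absolute convergence at `s = 0`. It dominates all the other moments,
  -- so it justifies the interchange of sum and integral.
  have h0 : IntegrableOn (fun t => f.density t / t) (Set.Ioc 0 1) := by simpa using (hF.natCast 0).1
  have hlow : ∀ t ∈ Set.Ioc (0 : ℝ) 1, K - ‖r‖ ≤ ‖t • r - K • e‖ := fun t ht => by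
    have h1 := norm_sub_norm_le (K • e) (t • r)
    rw [norm_smul, norm_smul, he, mul_one, Real.norm_of_nonneg hK.le, Real.norm_of_nonneg ht.1.le,
      norm_sub_rev] at h1
    nlinarith [norm_nonneg r, ht.2]
  have hexp : ∀ t ∈ Set.Ioc (0 : ℝ) 1, HasSum (fun n : ℕ => ‖r‖ ^ n / K ^ (n + 1) *
      (legendreP n).eval (inner ℝ e r / ‖r‖) * (f.density t / t * t ^ n))
      (f.density t / t * (1 / ‖t • r - K • e‖)) := fun t ht => by
    have hn : ‖t • r‖ = t * ‖r‖ := by rw [norm_smul, Real.norm_of_nonneg ht.1.le]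
    have h1 := (hasSum_inv_norm_sub_smul he (r := t • r) (x := K)
      (by rw [hn]; nlinarith [norm_nonneg r, ht.2])).mul_left (f.density t / t)
    rw [hn, inner_smul_right, mul_div_mul_left _ _ ht.1.ne'] at h1
    refine h1.congr_fun fun n => ?_
    rw [mul_pow]
    ring
  refine ⟨?_, ?_⟩
  · refine Integrable.mul_bdd (c := 1 / (K - ‖r‖)) h0
      (by fun_prop : Measurable fun t : ℝ => 1 / ‖t • r - K • e‖).aestronglyMeasurable ?_
    filter_upwards [ae_restrict_mem measurableSet_Ioc] with t ht
    rw [norm_div, norm_one, norm_norm]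
    exact one_div_le_one_div_of_le (sub_pos.2 hrK) (hlow t ht)
  · have hs := hasSum_integral_of_summable_integral_norm (μ := volume.restrict (Set.Ioc (0 : ℝ) 1))
      (F := fun (n : ℕ) t => ‖r‖ ^ n / K ^ (n + 1) * (legendreP n).eval (inner ℝ e r / ‖r‖) *
        (f.density t / t * t ^ n)) (fun n => (hF.natCast n).1.const_mul _) ?_
    · simp_rw [integral_const_mul] at hs
      rwa [setIntegral_congr_fun measurableSet_Ioc fun t ht => (hexp t ht).tsum_eq] at hs
    · have hq : ‖r‖ / K < 1 := (div_lt_one hK).2 hrK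
      refine .of_nonneg_of_le (fun n => by positivity) (fun n => ?_)
        ((summable_geometric_of_lt_one (by positivity) hq).mul_left
          (1 / K * ∫ t in Set.Ioc (0 : ℝ) 1, ‖f.density t / t‖))
      have hle : ∫ t in Set.Ioc (0 : ℝ) 1, ‖f.density t / t * t ^ n‖ ≤
          ∫ t in Set.Ioc (0 : ℝ) 1, ‖f.density t / t‖ := by
        refine setIntegral_mono_on (hF.natCast n).1.norm h0.norm measurableSet_Ioc fun t ht => ?_
        rw [norm_mul, norm_pow, Real.norm_of_nonneg ht.1.le]
        exact mul_le_of_le_one_right (norm_nonneg _) (pow_le_one₀ ht.1.le ht.2)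
      simp_rw [norm_mul (_ * _ : ℝ) (_ * _ ^ _), integral_const_mul]
      have hP := abs_legendreP_le_one (abs_inner_div_norm_le he r) n
      calc _ ≤ ‖r‖ ^ n / K ^ (n + 1) * 1 * ∫ t in Set.Ioc (0 : ℝ) 1, ‖f.density t / t‖ := by
            rw [norm_mul, Real.norm_of_nonneg (by positivity : 0 ≤ ‖r‖ ^ n / K ^ (n + 1)),
              Real.norm_eq_abs]
            gcongr
        _ = _ := by rw [div_pow, pow_succ]; field_simp

/-- In the Kirkwood series `M_n` is replaced by its moments. The atom sums to the potential of a
charge at the Kelvin point; the density sums to an integral over `t`, which `x = r_K / t` carries to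
the ray. The prefactor `R / r_s` is `r_K / R`. -/
theorem kirkwood_sum_eq_linePotential {εi εo κ R : ℝ} (hR : 0 < R) {rs : Space} (hrs : rs ≠ 0)
    (hrsR : ‖rs‖ < R) {f : GenFun}
    (hf : IsFiniteMellinTransform f (harmonicCoeff (εi / εo) (κ * R))) {r : Space} {Φ : ℝ}
    (hr : ‖r‖ ≤ R) (hΦ : HasSum (kirkwoodTerm εi εo κ R rs r) (Φ : ℂ)) :
    IntegrableOn (lineIntegrand R f rs r) (Set.Ioi ‖kelvinPoint R rs‖) ∧
      Φ = linePotential εi R f rs r := by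
  set p := ‖rs‖ with hp
  have hp0 : 0 < p := norm_pos_iff.2 hrs
  set e : Space := p⁻¹ • rs with he
  have he1 : ‖e‖ = 1 := by rw [he, norm_smul, norm_inv, norm_norm, inv_mul_cancel₀ hp0.ne']
  have hKe : kelvinPoint R rs = ‖kelvinPoint R rs‖ • e := kelvinPoint_eq_smul hrs
  have hKn : ‖kelvinPoint R rs‖ = R ^ 2 / p := norm_kelvinPoint hrs
  set K := ‖kelvinPoint R rs‖ with hK
  have hK0 : 0 < K := by rw [hKn]; positivity
  have hrK : ‖r‖ < K := by
    rw [hKn, lt_div_iff₀ hp0]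
    nlinarith [norm_nonneg r]
  obtain ⟨hint, hsum⟩ := hasSum_mellin_legendreP he1 hrK hf
  -- the substitution `x = K / t`
  have hd : ∀ t ∈ Set.Ioo (0 : ℝ) 1, HasDerivWithinAt (fun t : ℝ => K / t) (-(K / t ^ 2))
      (Set.Ioo 0 1) t := fun t ht => by
    have := ((hasDerivAt_inv ht.1.ne').const_mul K).hasDerivWithinAt (s := Set.Ioo (0 : ℝ) 1)
    simpa [div_eq_mul_inv] using this
  have hinj : Set.InjOn (fun t : ℝ => K / t) (Set.Ioo 0 1) := fun s hs t ht hst =>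
    inv_injective (mul_left_cancel₀ hK0.ne' (by simpa [div_eq_mul_inv] using hst))
  have hsub : ∀ t ∈ Set.Ioo (0 : ℝ) 1, |-(K / t ^ 2)| • lineIntegrand R f rs r (K / t) =
      K / R * (f.density t / t * (1 / ‖t • r - K • e‖)) := fun t ht => by
    have hn : ‖r - (K / t / p) • rs‖ = ‖t • r - K • e‖ / t := by
      rw [eq_div_iff ht.1.ne', mul_comm, ← Real.norm_of_nonneg ht.1.le, ← norm_smul,
        Real.norm_of_nonneg ht.1.le, smul_sub, he, smul_smul, smul_smul]
      congr 3
      have := ht.1.ne'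
      field_simp
    have ht0 := ht.1
    rw [lineIntegrand, ← hK, ← hp, hn, abs_neg, abs_of_pos (by positivity), smul_eq_mul,
      div_div_cancel₀ hK0.ne']
    field_simp
  have hint' : IntegrableOn (fun t => |-(K / t ^ 2)| • lineIntegrand R f rs r (K / t))
      (Set.Ioo 0 1) :=
    IntegrableOn.congr_fun ((hint.mono_set Set.Ioo_subset_Ioc_self).const_mul (K / R))
      (fun t ht => (hsub t ht).symm) measurableSet_Ioo
  have hval : ∫ x in Set.Ioi K, lineIntegrand R f rs r x =
      K / R * ∫ t in Set.Ioc (0 : ℝ) 1, f.density t / t * (1 / ‖t • r - K • e‖) := by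
    rw [← image_div_Ioo hK0, integral_image_eq_integral_abs_deriv_smul measurableSet_Ioo hd hinj,
      setIntegral_congr_fun measurableSet_Ioo hsub, integral_const_mul,
      integral_Ioc_eq_integral_Ioo]
  refine ⟨?_, ?_⟩
  · rw [← image_div_Ioo hK0,
      integrableOn_image_iff_integrableOn_abs_deriv_smul measurableSet_Ioo hd hinj]
    exact hint'
  · have h1 := (((hasSum_inv_norm_sub_smul he1 hrK).mul_left f.atom).add hsum).mul_left
      (R / p / (4 * Real.pi * εi))
    have h2 := Complex.hasSum_ofReal.2 h1
    have hcos : Real.cos (InnerProductGeometry.angle rs r) = inner ℝ e r / ‖r‖ := cos_angle_eq r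
    have h3 := hΦ.unique (h2.congr_fun fun n => ?_)
    · rw [Complex.ofReal_inj.1 h3, linePotential, ← hK, hval, hKe]
      have hKR : R / p = K / R := by rw [hKn]; field_simp
      rw [hKR]
      ring
    · rw [kirkwoodTerm, (hf.natCast n).2, hcos, ← hK, ← hp]
      rw [← Complex.ofReal_mul, ← Complex.ofReal_mul]
      congr 1
      ring

end ImageCharge

/-! ### Assembly of the theorem -/

theorem mainTheorem1 (εi εo κ R : ℝ) (hεi : 0 < εi) (hεo : 0 < εo) (hκ : 0 < κ) (hR : 0 < R) :
    -- the inverse finite Mellin transform of the harmonic coefficients exists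
    (∃ f : ImageCharge.GenFun,
      ImageCharge.IsFiniteMellinPair f (ImageCharge.harmonicCoeff (εi / εo) (κ * R))) ∧
    ∀ rs : ImageCharge.Space, rs ≠ 0 → ‖rs‖ < R →
      -- the Green's function problem is solvable
      (∃ Gi Go Φ : ImageCharge.Space → ℝ,
        ImageCharge.IsGreenSolution εi εo κ R rs Gi Go Φ) ∧
      -- Kirkwood series and image charge representation of the reaction potential
      ∀ Gi Go Φ : ImageCharge.Space → ℝ,
        ImageCharge.IsGreenSolution εi εo κ R rs Gi Go Φ →
        ∀ r ∈ Metric.closedBall (0 : ImageCharge.Space) R,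
          HasSum (ImageCharge.kirkwoodTerm εi εo κ R rs r) (Φ r : ℂ) ∧
          ∀ f : ImageCharge.GenFun,
            ImageCharge.IsFiniteMellinPair f
              (ImageCharge.harmonicCoeff (εi / εo) (κ * R)) →
            IntegrableOn (ImageCharge.lineIntegrand R f rs r)
              (Set.Ioi ‖ImageCharge.kelvinPoint R rs‖) ∧
            Φ r = ImageCharge.linePotential εi R f rs r := by
  refine ⟨⟨_, ImageCharge.isFiniteMellinPair_coeffGenFun (div_pos hεi hεo) (mul_pos hκ hR)⟩,
    fun rs hrs hrsR => ?_⟩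
  obtain ⟨Gi₀, Go₀, Φ₀, h₀, hk₀⟩ := ImageCharge.exists_isGreenSolution hεi hεo hκ hR hrs hrsR
  refine ⟨⟨Gi₀, Go₀, Φ₀, h₀⟩, fun Gi Go Φ h r hr => ?_⟩
  have hk : HasSum (ImageCharge.kirkwoodTerm εi εo κ R rs r) (Φ r : ℂ) := by
    -- By uniqueness, the series of the constructed solution holds for every solution.
    rw [h.eq hεi hεo hκ hR hrsR h₀ hr]
    exact hk₀ r hr
  exact ⟨hk, fun f hf => ImageCharge.kirkwood_sum_eq_linePotential hR hrs hrsR hf.1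
    (mem_closedBall_zero_iff.1 hr) hk⟩
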